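/- **Setting.** All functions are superfunctions, i.e. formal power series in the odd coordinates and in the ghosts and antifields, whose coefficients are smooth real functions of the even coordinates; $\varepsilon$ denotes Grassmann parity, and $\overleftarrow{\partial}$ a right derivative. Let $S_0=S_0(\varphi)$ be an even original action of fields $\varphi^i\equiv\Phi^{\alpha_{-1}}$, $i=1,\dots,m_{-1}$, of parity $\varepsilon_i$. Let $Z^{\alpha_{s-1}}{}_{\alpha_s}(\varphi)$, $s=0,\dots,L$, $\alpha_s\in\{1,\dots,m_s\}$, be gauge(-for-gauge)$^s$ generators of parity $\varepsilon_{\alpha_{s-1}}+\varepsilon_{\alpha_s}$, with $R^i{}_{\alpha_0}:=Z^{\alpha_{-1}}{}_{\alpha_0}$. Put $T_i:=S_0\overleftarrow{\partial}/\partial\varphi^i$, $m_s:=0$ for $s>L$, and $M_s:=\sum_{r\ge 0}(-1)^r m_{r+s}$. Assume the Noether identities $$T_iR^i{}_{\alpha_0}=0,\qquad Z^{\alpha_{s-2}}{}_{\alpha_{s-1}}Z^{\alpha_{s-1}}{}_{\alpha_s}=T_iB^{i\alpha_{s-2}}_{\alpha_s}\quad(1\le s\le L)$$ for some functions $B(\varphi)$,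 and that near the stationary points ($T_i=0$) the Hessian $\overrightarrow{\partial}_iS_0\overleftarrow{\partial}_j$ has rank $M_{-1}$ and $(Z^{\alpha_{s-1}}{}_{\alpha_s})$ has rank $M_s$ for $0\le s\le L$ (ranks of the matrices of values at the points of the underlying ordinary domain). Let a choice of transversal and longitudinal fields be given on a domain $V$ of field space, i.e. a non-singular change of coordinates $\varphi^i\to\bar\varphi=(\xi^I,\theta^{A})$, $I=1,\dots,M_{-1}$, $A=1,\dots,M_0$, with $(\xi^I\overleftarrow{\partial}/\partial\varphi^i)R^i{}_{\alpha_0}=T_iK^{iI}_{\alpha_0}$ for some functions $K(\varphi)$, the $\xi^I$ being normalized to vanish at the stationary points of $V$. Besides the fields there are the ghosts $c^{\alpha_s}$, $0\le s\le L$, of parity $\varepsilon_{\alpha_s}+s+1$, and the antifields $\Phi^*_{\alpha_s}$, $-1\le s\le L$, of parity $\varepsilon_{\alpha_s}+s$; here $\varphi^*_i:=\Phi^*_{\alpha_{-1}}$ and $c^*_{\alpha_s}:=\Phi^*_{\alpha_s}$ for $s\ge0$. The shifted antifield number is given by $\mathrm{safn}(\xi^I)=1$, $\mathrm{safn}(\Phi^*_{\alpha_s})=s+3$,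 $\mathrm{safn}(\theta)=\mathrm{safn}(c)=0$; the component $f_{(r)}$ of a function $f$ of shifted antifield number $r$ is obtained from its Taylor expansion in $\xi$ (around $\xi=0$ at fixed $\theta$) and in the antifields. We write $\mathrm{safn}(f)>0$ if $f_{(0)}=0$, i.e. if $f$ vanishes when $\xi=0$ and $\Phi^*=0$; in particular this holds if $f=f_{(r)}$ for some $r>0$. The shifted Koszul–Tate operator is $$\delta=T_{(1)i}\frac{\overrightarrow{\partial}}{\partial\varphi^*_i}+\sum_{s=0}^{L}\Phi^*_{\alpha_{s-1}}Z^{\alpha_{s-1}}_{(0)\,\alpha_s}\frac{\overrightarrow{\partial}}{\partial c^*_{\alpha_s}}.$$ **Statement (local acyclicity of the shifted Koszul–Tate operator).** Every stationary point $p\in V$ has arbitrarily small open neighbourhoods $U\subseteq V$ in field space, closed under $(\xi,\theta)\mapsto(t\xi,\theta)$ for $t\in[0,1]$, such that over $U$ one has $\delta^2=0$, and $$\forall f:\qquad \delta f=0\ \wedge\ \mathrm{safn}(f)>0\ \Longrightarrow\ \exists g:\ f=\delta g .$$ Moreover, $g$ can be chosen polynomial in the ghosts and antifields if $f$ is. 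-/

import Mathlib

open scoped ContDiff Topology

noncomputable section

namespace BV

/-- Index data of a gauge theory of reducibility stage `L`, with a choice of numbers and parities of
transversal and longitudinal coordinates. Stages are shifted by one, so that index `0` is the stage
`-1` of the original fields: `m k` is the multiplicity `m_{k-1}`, and `ε k` are the Grassmann
parities `ε_{α_{k-1}}`. The index of a transversal field is `Sum.inl I`, the index of a longitudinal
field is `Sum.inr A`. -/
structure FieldContent where
  L : ℕ
  m : ℕ → ℕ
  m_eq_zero : ∀ k, L + 1 < k → m k = 0
  ε : (k : ℕ) → Fin (m k) → ZMod 2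
  numXi : ℕ
  numTheta : ℕ
  εbar : Fin numXi ⊕ Fin numTheta → ZMod 2

namespace FieldContent

variable (C : FieldContent)

/-- `altSum k` is the number `M_{k-1} = ∑_{r ≥ 0} (-1)^r m_{r+k-1}`
(terms with `r > L + 1` vanish). -/
def altSum (k : ℕ) : ℤ := ∑ r ∈ Finset.range (C.L + 2), (-1) ^ r * (C.m (r + k) : ℤ)

/-- Indices of the coordinates `φbar = (ξ, θ)`. -/
abbrev Coord : Type := Fin C.numXi ⊕ Fin C.numTheta

/-- Points of the body: the values of the even coordinates among `(ξ, θ)`. -/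
abbrev Pt : Type := {j : C.Coord // C.εbar j = 0} → ℝ

/-- The variables other than the even coordinates among `(ξ, θ)`: the odd coordinates, the
stage-`s` ghosts `c^{α_s}`, and the antifields; `anti k α` is the antifield of the stage-`(k-1)`
variable, so `anti 0 i` is `φ*_i` and `anti (s+1) α` is `c*_{α_s}`. -/
inductive Var : Type
  | field (j : {j : C.Coord // C.εbar j ≠ 0}) : Var
  | ghost (s : ℕ) (α : Fin (C.m (s + 1))) : Var
  | anti (k : ℕ) (α : Fin (C.m k)) : Var

namespace Var

variable {C}

/-- Grassmann parity: ghosts `ε_{α_s} + s + 1`, original antifields `ε_i + 1`, ghost antifields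
`ε_{α_s} + s`. -/
def par : C.Var → ZMod 2
  | field j => C.εbar j.1
  | ghost s α => C.ε (s + 1) α + (s : ZMod 2) + 1
  | anti k α => C.ε k α + (k : ZMod 2) + 1

/-- Shifted antifield number of the variables: `1` for `ξ`, `s + 3` for the antifields of stage `s`,
and `0` for `θ` and for ghosts. -/
def safn : C.Var → ℕ
  | field ⟨Sum.inl _, _⟩ => 1
  | field ⟨Sum.inr _, _⟩ => 0
  | ghost _ _ => 0
  | anti k _ => k + 2

/-- Whether a variable is a coordinate, as opposed to an auxiliary variable. -/
def IsField : C.Var → Prop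
  | field _ => True
  | ghost _ _ => False
  | anti _ _ => False

/-- An injective code, which orders the variables. -/
def code : C.Var → ℕ ×ₗ ℕ ×ₗ ℕ
  | field ⟨Sum.inl i, _⟩ => toLex (0, toLex (0, (i : ℕ)))
  | field ⟨Sum.inr i, _⟩ => toLex (0, toLex (1, (i : ℕ)))
  | ghost s α => toLex (1, toLex (s, (α : ℕ)))
  | anti k α => toLex (2, toLex (k, (α : ℕ)))

theorem code_injective : Function.Injective (code (C := C)) := by
  intro v w h
  rcases v with ⟨j, hj⟩ | ⟨s, α⟩ | ⟨k, α⟩ <;> rcases w with ⟨j', hj'⟩ | ⟨s', α'⟩ | ⟨k', α'⟩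
  · rcases j with j | j <;> rcases j' with j' | j' <;> simp [code, Fin.ext_iff] at h ⊢ <;> exact h
  · rcases j with j | j <;> simp [code] at h
  · rcases j with j | j <;> simp [code] at h
  · rcases j' with j' | j' <;> simp [code] at h
  · simp [code] at h
    obtain ⟨rfl, h⟩ := h
    rw [Fin.ext h]
  · simp [code] at h
  · rcases j' with j' | j' <;> simp [code] at h
  · simp [code] at h
  · simp [code] at h
    obtain ⟨rfl, h⟩ := h
    rw [Fin.ext h]

/-- The order in which the factors of a monomial are written. -/
instance : LinearOrder C.Var := LinearOrder.lift' code code_injective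

end Var

/-- Exponents of a monomial. -/
abbrev Mono : Type := C.Var →₀ ℕ

/-- Formal series in the odd coordinates and in the auxiliary variables, with coefficients that are
functions of the even coordinates: `f` stands for `∑_μ f_μ(x) z^μ`, where in `z^μ` the
variables are written in increasing order. -/
abbrev SFun : Type := C.Mono → C.Pt → ℝ

end FieldContent

open FieldContent

variable {C : FieldContent}

/-- A monomial is legal if no odd variable occurs twice. -/
def Legal (μ : C.Mono) : Prop := ∀ v, v.par ≠ 0 → μ v ≤ 1

/-- Grassmann parity of a monomial. -/
def monoPar (μ : C.Mono) : ZMod 2 := ∑ v ∈ μ.support, (μ v : ZMod 2) * v.par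

/-- Shifted antifield number of a monomial. -/
def monoSafn (μ : C.Mono) : ℕ := ∑ v ∈ μ.support, μ v * v.safn

/-- `f` is a superfunction over the open set `U`. -/
def IsSuperFun (U : Set C.Pt) (f : C.SFun) : Prop :=
  (∀ μ, ContDiffOn ℝ ∞ (f μ) U) ∧ ∀ μ, ¬ Legal μ → ∀ x ∈ U, f μ x = 0

/-- Equality of superfunctions over `U`. -/
def SEq (U : Set C.Pt) (f g : C.SFun) : Prop := ∀ μ, ∀ x ∈ U, f μ x = g μ x

/-- `f` has Grassmann parity `p` over `U`. -/
def HasParity (U : Set C.Pt) (p : ZMod 2) (f : C.SFun) : Prop :=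
  ∀ μ, monoPar μ ≠ p → ∀ x ∈ U, f μ x = 0

/-- `f` is a superfunction over `U` of the original fields only (no ghosts, no antifields). -/
def IsFieldFun (U : Set C.Pt) (f : C.SFun) : Prop :=
  IsSuperFun U f ∧ ∀ μ, (∃ v ∈ μ.support, ¬ v.IsField) → ∀ x ∈ U, f μ x = 0

/-- `f` is polynomial in the auxiliary variables over `U`. -/
def IsPoly (U : Set C.Pt) (f : C.SFun) : Prop := {μ | ∃ x ∈ U, f μ x ≠ 0}.Finite

/-- The body of `f`: the value at a point, with all other variables put to zero. -/
def body (f : C.SFun) (x : C.Pt) : ℝ := f 0 x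

/-- The constant function `1`. -/
def one : C.SFun := fun μ _ => if μ = 0 then 1 else 0

/-- A variable, as a superfunction. -/
def gen (v : C.Var) : C.SFun := fun μ _ => if μ = Finsupp.single v 1 then 1 else 0

/-- The number of transpositions of odd variables that bring `z^a z^b` to increasing order. -/
def swaps (a b : C.Mono) : ℕ :=
  ∑ v ∈ a.support, ∑ w ∈ b.support,
    if w < v then v.par.val * w.par.val * (a v * b w) else 0

open Classical in
/-- The supercommutative product. -/
def mul (f g : C.SFun) : C.SFun := fun μ x =>
  if Legal μ then
    ∑ p ∈ Finset.HasAntidiagonal.antidiagonal μ, (-1) ^ swaps p.1 p.2 * (f p.1 x * g p.2 x)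
  else 0

open Classical in
/-- The left derivative with respect to the variable `v`. -/
def dLeft (v : C.Var) (f : C.SFun) : C.SFun := fun μ x =>
  if Legal (μ + Finsupp.single v 1) then
    (-1) ^ (∑ w ∈ μ.support, if w < v then v.par.val * w.par.val * μ w else 0) *
      ((μ v + 1 : ℕ) * f (μ + Finsupp.single v 1) x)
  else 0

open Classical in
/-- The right derivative with respect to the variable `v`. -/
def dRight (v : C.Var) (f : C.SFun) : C.SFun := fun μ x =>
  if Legal (μ + Finsupp.single v 1) then
    (-1) ^ (∑ w ∈ μ.support, if v < w then v.par.val * w.par.val * μ w else 0) *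
      ((μ v + 1 : ℕ) * f (μ + Finsupp.single v 1) x)
  else 0

/-- The right derivative with respect to the coordinate `φbar^j`. -/
def dCoord (j : C.Coord) (f : C.SFun) : C.SFun :=
  if h : C.εbar j = 0 then fun μ x => fderiv ℝ (f μ) x (Pi.single ⟨j, h⟩ 1)
  else dRight (Var.field ⟨j, h⟩) f

/-- The point obtained from `x` by multiplying the (even) transversal coordinates by `t`. -/
def scaleXi (t : ℝ) (x : C.Pt) : C.Pt := fun j =>
  match j.1 with
  | Sum.inl _ => t * x j
  | Sum.inr _ => x j

/-- The component `f_(r)` of shifted antifield number `r`: each coefficient is replaced by the part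
of its Taylor expansion in the even transversal coordinates, around `ξ = 0` at fixed `θ`, whose
degree is `r` minus the shifted antifield number of the monomial. -/
def safnPart (r : ℕ) (f : C.SFun) : C.SFun := fun μ x =>
  if monoSafn μ ≤ r then
    iteratedDeriv (r - monoSafn μ) (fun t => f μ (scaleXi t x)) 0 / ((r - monoSafn μ).factorial : ℝ)
  else 0

/-- The shifted antifield number of `f` is strictly positive. It is never negative, so this says
that the component of shifted antifield number zero vanishes. -/
def SafnPos (U : Set C.Pt) (f : C.SFun) : Prop := SEq U (safnPart 0 f) 0

/-- An original action with gauge generators and gauge-for-gauge generators of all stages, on a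
superdomain `dom` that carries, besides the original fields `φ^i`, the coordinates `φbar^j`. All
functions are written in the coordinates `φbar^j`.
`jac j i` is the derivative of `φbar^j` with respect to `φ^i`, that is, the inverse of the
Jacobian matrix of the change of coordinates.
`Z 0` is the gauge generator `R^i_{α_0}`, and `Z s` is `Z^{α_{s-1}}_{α_s}`;
`B s` is the structure function `B^{i α_{s-1}}_{α_{s+1}}`, and `B 0` is `B^{ji}_{α_1}`. -/
structure GaugeData (C : FieldContent) where
  dom : Set C.Pt
  φ : Fin (C.m 0) → C.SFun
  jac : C.Coord → Fin (C.m 0) → C.SFun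
  S₀ : C.SFun
  Z : (s : ℕ) → Fin (C.m s) → Fin (C.m (s + 1)) → C.SFun
  B : (s : ℕ) → Fin (C.m 0) → Fin (C.m s) → Fin (C.m (s + 2)) → C.SFun

namespace GaugeData

variable (G : GaugeData C)

/-- The right derivative with respect to the original field `φ^i`. -/
def dPhi (i : Fin (C.m 0)) (f : C.SFun) : C.SFun := ∑ j, mul (dCoord j f) (G.jac j i)

/-- The equations of motion `T_i`, the right derivatives of the original action. -/
def T (i : Fin (C.m 0)) : C.SFun := G.dPhi i G.S₀

/-- The Hessian `∂_i S₀ ∂_j` of the original action, the left derivative of `T_j` with respect to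
`φ^i`; as `T_j` has parity `ε_j`, it is `(-1)^{ε_i (ε_j + 1)}` times the right derivative. -/
def hessian (i j : Fin (C.m 0)) : C.SFun :=
  (-1 : ℝ) ^ ((C.ε 0 i).val * ((C.ε 0 j).val + 1)) • G.dPhi i (G.T j)

/-- Stationary points of the original action. -/
def IsStationary (x : C.Pt) : Prop := x ∈ G.dom ∧ ∀ i, body (G.T i) x = 0

/-- The data form a gauge theory: the original fields are related to the coordinates `φbar` by a
non-singular change of coordinates, all parities are right, the Noether identities of all stages
hold, and the matrices have the required ranks near the stationary points. -/
structure IsGaugeTheory : Prop where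
  isOpen_dom : IsOpen G.dom
  φ_fun : ∀ i, IsFieldFun G.dom (G.φ i)
  φ_par : ∀ i, HasParity G.dom (C.ε 0 i) (G.φ i)
  jac_fun : ∀ j i, IsFieldFun G.dom (G.jac j i)
  jac_par : ∀ j i, HasParity G.dom (C.εbar j + C.ε 0 i) (G.jac j i)
  jac_right : ∀ i k, SEq G.dom (∑ j, mul (dCoord j (G.φ i)) (G.jac j k)) (if i = k then one else 0)
  jac_left : ∀ j k, SEq G.dom (∑ i, mul (G.jac j i) (dCoord k (G.φ i))) (if j = k then one else 0)
  S₀_fun : IsFieldFun G.dom G.S₀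
  S₀_par : HasParity G.dom 0 G.S₀
  Z_fun : ∀ s α β, IsFieldFun G.dom (G.Z s α β)
  Z_par : ∀ s α β, HasParity G.dom (C.ε s α + C.ε (s + 1) β) (G.Z s α β)
  B_fun : ∀ s i α β, IsFieldFun G.dom (G.B s i α β)
  noether_zero : ∀ α, SEq G.dom (∑ i, mul (G.T i) (G.Z 0 i α)) 0
  noether : ∀ s α γ, SEq G.dom
    (∑ β, mul (G.Z s α β) (G.Z (s + 1) β γ)) (∑ i, mul (G.T i) (G.B s i α γ))
  rank_hessian : ∀ x, G.IsStationary x → ∀ᶠ y in 𝓝 x,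
    ((Matrix.of fun i j => body (G.hessian i j) y).rank : ℤ) = C.altSum 0
  rank_Z : ∀ s x, G.IsStationary x → ∀ᶠ y in 𝓝 x,
    ((Matrix.of fun α β => body (G.Z s α β) y).rank : ℤ) = C.altSum (s + 1)

/-- The coordinates `φbar = (ξ, θ)` consist of `M_{-1}` transversal fields and `M_0` longitudinal
fields: the `ξ^I` are gauge invariant on-shell, and normalized to vanish at the stationary
points. -/
structure IsTransversal : Prop where
  numXi_eq : (C.numXi : ℤ) = C.altSum 0
  numTheta_eq : (C.numTheta : ℤ) = C.altSum 1
  invariant : ∃ K : Fin (C.m 0) → Fin C.numXi → Fin (C.m 1) → C.SFun,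
    (∀ i I α, IsFieldFun G.dom (K i I α)) ∧
    ∀ I α, SEq G.dom (∑ i, mul (G.jac (Sum.inl I) i) (G.Z 0 i α)) (∑ i, mul (G.T i) (K i I α))
  normalized : ∀ x, G.IsStationary x → ∀ I (h : C.εbar (Sum.inl I) = 0), x ⟨Sum.inl I, h⟩ = 0

/-- The shifted Koszul-Tate operator
`δ = T_(1)i ∂/∂φ*_i + ∑_{s=0}^L Φ*_{α_{s-1}} Z_(0)^{α_{s-1}}_{α_s} ∂/∂c*_{α_s}`. -/
def delta (f : C.SFun) : C.SFun :=
  ∑ i, mul (safnPart 1 (G.T i)) (dLeft (Var.anti 0 i) f) +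
  ∑ s ∈ Finset.range (C.L + 1), ∑ α, ∑ β,
    mul (mul (gen (Var.anti s α)) (safnPart 0 (G.Z s α β))) (dLeft (Var.anti (s + 1) β) f)

end GaugeData

end BV

end

open scoped ContDiff Topology

noncomputable section

namespace BV

open FieldContent TopologicalSpace

variable {C : FieldContent}

/-! Collect the transversal fields and the antifields into one family `y`. Then `δ` is a linear
vector field `∑ y_v D_vw ∂/∂y_w` whose matrix `D` depends on `θ` only (`rep_delta`,
`D_mem_thetaSub`). The anticommutator of two odd fields of this kind is the linear field of the
anticommutator of their matrices (`vf_vf_add_vf_vf`). So `D² = 0` gives `δ² = 0`, and an odd `σ`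
with `Dσ + σD = 1` gives a vector field whose anticommutator with `δ` is the Euler field `N = ∑ y_v
∂/∂y_v`. On functions that vanish at `y = 0`, integration along `ξ ↦ tξ` provides a right inverse of
`N`, and `N` is injective there (`euler_eulerInv`, `eq_zero_of_euler`). As `N` commutes with `δ`,
the function `N⁻¹f` is closed if `f` is, whence `f = δ(σN⁻¹f)`; none of these operations destroys
polynomiality (`exists_vf_eq`).

That `D² = 0` is not formal: the Noether identities hold modulo `T`, so `T` must vanish on the whole
locus `ξ = 0`, while the normalization only says that stationary points lie on it. Differentiate
`T_j R^j = 0` and restrict to `ξ = 0`. The transversal components of `R` lie in the ideal of `T`,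
and the longitudinal block of `R` has a right inverse near `p` because of its rank. By symmetry of
second derivatives, all longitudinal derivatives of the restricted `T` then lie in the ideal that
the restricted `T` generates. This is a homogeneous linear differential system in `θ` with zero
initial value at `p`: the body vanishes by Grönwall, the nilpotent part by induction on the degree
(`eq_zero_of_pd_mem_ideal`, `rho_T_eq_zero`).

For `σ`, look first at bodies at `p`. The rank conditions and `M_s + M_{s+1} = m_s` make the complex
of real matrices exact, so it has a contraction `s` (`exists_bodyD_contraction`). Near `p` the
matrix `Ds + sD` keeps an invertible body, hence is invertible over the functions of `θ`, the rest
being nilpotent. It commutes with `D`, so `s(Ds + sD)⁻¹` is a contraction, and its component of the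
right parity is `σ` (`exists_homotopy`).

Superfunctions over `U` are extended by zero outside `U`, so that equality over `U` becomes equality
in a ring `SA U`; `Rep` translates back. -/

/-! ### Signs -/

/-- The sign `(-1)^p` of a parity. -/
def sg (p : ZMod 2) : ℝ := (-1) ^ p.val

@[simp] theorem sg_zero : sg 0 = 1 := by simp [sg]

@[simp] theorem sg_one : sg 1 = -1 := by simp [sg, ZMod.val_one]

theorem zmod2_cases (p : ZMod 2) : p = 0 ∨ p = 1 := by revert p; decide

theorem zmod2_add_self (p : ZMod 2) : p + p = 0 := by revert p; decide

theorem zmod2_mul_self (p : ZMod 2) : p * p = p := by revert p; decide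

theorem sg_add (p q : ZMod 2) : sg (p + q) = sg p * sg q := by
  rcases zmod2_cases p with rfl | rfl <;> rcases zmod2_cases q with rfl | rfl <;>
    simp [zmod2_add_self]

theorem sg_mul_self (p : ZMod 2) : sg p * sg p = 1 := by
  rw [← sg_add, zmod2_add_self, sg_zero]

theorem sg_natCast (n : ℕ) : sg (n : ZMod 2) = (-1) ^ n := by
  rw [sg, ZMod.val_natCast]
  exact (neg_one_pow_eq_pow_mod_two (R := ℝ) n).symm

theorem zmod2_val_cast (p : ZMod 2) : ((p.val : ℕ) : ZMod 2) = p := ZMod.natCast_zmod_val p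

/-! ### Monomials -/

/-- The exponent of the sign in `z^a z^b = ± z^(a+b)`, as a biadditive form. -/
def chi (a b : C.Mono) : ZMod 2 :=
  a.sum fun v i => b.sum fun w j => if w < v then v.par * w.par * ((i : ZMod 2) * j) else 0

theorem neg_one_pow_swaps (a b : C.Mono) : (-1 : ℝ) ^ swaps a b = sg (chi a b) := by
  rw [← sg_natCast]
  congr 1
  simp only [swaps, chi, Finsupp.sum]
  push_cast
  refine Finset.sum_congr rfl fun v _ => Finset.sum_congr rfl fun w _ => ?_
  split_ifs
  · rw [zmod2_val_cast, zmod2_val_cast]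
  · simp

theorem chi_add_left (a b c : C.Mono) : chi (a + b) c = chi a c + chi b c := by
  unfold chi
  refine Finsupp.sum_add_index' (fun v => ?_) fun v i j => ?_
  · simp [Finsupp.sum]
  · rw [← Finsupp.sum_add]
    refine Finsupp.sum_congr fun w _ => ?_
    split_ifs
    · push_cast; ring
    · simp

theorem chi_add_right (a b c : C.Mono) : chi a (b + c) = chi a b + chi a c := by
  unfold chi
  rw [← Finsupp.sum_add]
  refine Finsupp.sum_congr fun v _ => ?_
  refine Finsupp.sum_add_index' (fun w => ?_) fun w i j => ?_
  · simp
  · split_ifs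
    · push_cast; ring
    · simp

@[simp] theorem chi_zero_left (a : C.Mono) : chi 0 a = 0 := by simp [chi]

@[simp] theorem chi_zero_right (a : C.Mono) : chi a 0 = 0 := by simp [chi]

theorem monoPar_eq_sum (a : C.Mono) : monoPar a = a.sum fun v i => (i : ZMod 2) * v.par := rfl

theorem monoSafn_eq_sum (a : C.Mono) : monoSafn a = a.sum fun v i => i * v.safn := rfl

theorem monoPar_add (a b : C.Mono) : monoPar (a + b) = monoPar a + monoPar b := by
  simp only [monoPar_eq_sum]
  exact Finsupp.sum_add_index' (by simp) fun v i j => by push_cast; ring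

theorem monoSafn_add (a b : C.Mono) : monoSafn (a + b) = monoSafn a + monoSafn b := by
  simp only [monoSafn_eq_sum]
  exact Finsupp.sum_add_index' (by simp) fun v i j => by ring

@[simp] theorem monoPar_zero : monoPar (0 : C.Mono) = 0 := by simp [monoPar]

@[simp] theorem monoSafn_zero : monoSafn (0 : C.Mono) = 0 := by simp [monoSafn]

@[simp] theorem monoPar_single (v : C.Var) : monoPar (Finsupp.single v 1) = v.par := by
  simp [monoPar_eq_sum]

@[simp] theorem monoSafn_single (v : C.Var) : monoSafn (Finsupp.single v 1) = v.safn := by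
  simp [monoSafn_eq_sum]

theorem monoSafn_eq_zero {a : C.Mono} : monoSafn a = 0 ↔ ∀ v, a v ≠ 0 → v.safn = 0 := by
  simp only [monoSafn, Finset.sum_eq_zero_iff, Finsupp.mem_support_iff, mul_eq_zero]
  exact forall_congr' fun v => ⟨fun h h' => (h h').resolve_left h', fun h h' => Or.inr (h h')⟩

theorem Legal.of_add_left {a b : C.Mono} (h : Legal (a + b)) : Legal a := fun v hv => by
  have := h v hv
  simp only [Finsupp.add_apply] at this
  omega

theorem Legal.of_add_right {a b : C.Mono} (h : Legal (a + b)) : Legal b := by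
  rw [add_comm] at h
  exact h.of_add_left

theorem legal_zero : Legal (0 : C.Mono) := fun v _ => by simp

theorem legal_single (v : C.Var) : Legal (Finsupp.single v 1) := fun w _ => by
  rw [Finsupp.single_apply]
  split_ifs <;> simp

/-- Each pair of distinct variables is counted by exactly one of the two forms. A repeated variable
is counted by neither; legality makes its contribution to the right side vanish, as an odd variable
occurs in only one of the two monomials. -/
theorem chi_swap {a b : C.Mono} (h : Legal (a + b)) :
    chi a b + chi b a = monoPar a * monoPar b := by
  have hb : chi b a =
      a.sum fun v i => b.sum fun w j => if v < w then v.par * w.par * ((i : ZMod 2) * j) else 0 := by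
    simp only [chi, Finsupp.sum]
    rw [Finset.sum_comm]
    refine Finset.sum_congr rfl fun v _ => Finset.sum_congr rfl fun w _ => ?_
    split_ifs <;> ring
  rw [hb]
  simp only [chi, monoPar, Finsupp.sum, Finset.sum_mul_sum, ← Finset.sum_add_distrib]
  refine Finset.sum_congr rfl fun v _ => Finset.sum_congr rfl fun w _ => ?_
  rcases lt_trichotomy v w with hvw | rfl | hvw
  · rw [if_neg hvw.not_gt, if_pos hvw]; ring
  · simp only [lt_irrefl, if_false, add_zero]
    by_cases hp : v.par = 0
    · simp [hp]
    · have := h v hp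
      simp only [Finsupp.add_apply] at this
      have h0 : a v = 0 ∨ b v = 0 := by omega
      rcases h0 with h0 | h0 <;> simp [h0]
  · rw [if_pos hvw, if_neg hvw.not_gt]; ring

/-! ### Products and derivatives with their signs expressed by `chi` -/

theorem dLeft_sign (v : C.Var) (μ : C.Mono) :
    (-1 : ℝ) ^ (∑ w ∈ μ.support, if w < v then v.par.val * w.par.val * μ w else 0) =
      sg (chi (Finsupp.single v 1) μ) := by
  rw [← sg_natCast]
  congr 1
  rw [chi, Finsupp.sum_single_index (by simp [Finsupp.sum])]
  simp only [Finsupp.sum]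
  push_cast
  refine Finset.sum_congr rfl fun w _ => ?_
  split_ifs <;> simp

theorem dRight_sign (v : C.Var) (μ : C.Mono) :
    (-1 : ℝ) ^ (∑ w ∈ μ.support, if v < w then v.par.val * w.par.val * μ w else 0) =
      sg (chi μ (Finsupp.single v 1)) := by
  rw [← sg_natCast]
  congr 1
  simp only [chi, Finsupp.sum]
  push_cast
  refine Finset.sum_congr rfl fun w _ => ?_
  rw [Finsupp.support_single v one_ne_zero, Finset.sum_singleton]
  split_ifs <;> simp [mul_comm]

open Classical in
theorem mul_apply (f g : C.SFun) (μ : C.Mono) (x : C.Pt) (h : Legal μ) : mul f g μ x =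
    ∑ p ∈ Finset.HasAntidiagonal.antidiagonal μ, sg (chi p.1 p.2) * (f p.1 x * g p.2 x) := by
  simp only [mul, if_pos h, neg_one_pow_swaps]

theorem mul_apply_of_not_legal (f g : C.SFun) (μ : C.Mono) (x : C.Pt) (h : ¬ Legal μ) :
    mul f g μ x = 0 := by
  simp [mul, h]

theorem dLeft_apply (v : C.Var) (f : C.SFun) (μ : C.Mono) (x : C.Pt)
    (h : Legal (μ + Finsupp.single v 1)) : dLeft v f μ x =
      sg (chi (Finsupp.single v 1) μ) * ((μ v + 1 : ℕ) * f (μ + Finsupp.single v 1) x) := by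
  simp only [dLeft, if_pos h, dLeft_sign]

theorem dLeft_apply_of_not_legal (v : C.Var) (f : C.SFun) (μ : C.Mono) (x : C.Pt)
    (h : ¬ Legal (μ + Finsupp.single v 1)) : dLeft v f μ x = 0 := by
  simp [dLeft, h]

theorem dRight_apply (v : C.Var) (f : C.SFun) (μ : C.Mono) (x : C.Pt)
    (h : Legal (μ + Finsupp.single v 1)) : dRight v f μ x =
      sg (chi μ (Finsupp.single v 1)) * ((μ v + 1 : ℕ) * f (μ + Finsupp.single v 1) x) := by
  simp only [dRight, if_pos h, dRight_sign]

open Classical in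
-- Biadditivity makes `sg ∘ chi` a cocycle: both bracketings of a triple of monomials carry the same
-- sign. What remains is the usual reindexing of triples.
theorem mul_assoc' (f g k : C.SFun) : mul (mul f g) k = mul f (mul g k) := by
  funext μ x
  by_cases h : Legal μ
  · rw [mul_apply _ _ _ _ h, mul_apply _ _ _ _ h]
    have h1 : ∀ p ∈ Finset.HasAntidiagonal.antidiagonal μ,
        sg (chi p.1 p.2) * (mul f g p.1 x * k p.2 x) =
        ∑ q ∈ Finset.HasAntidiagonal.antidiagonal p.1,
          sg (chi p.1 p.2) * ((sg (chi q.1 q.2) * (f q.1 x * g q.2 x)) * k p.2 x) := fun p hp => by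
      rw [Finset.HasAntidiagonal.mem_antidiagonal] at hp
      rw [mul_apply _ _ _ _ (Legal.of_add_left (hp ▸ h)), Finset.sum_mul, Finset.mul_sum]
    have h2 : ∀ p ∈ Finset.HasAntidiagonal.antidiagonal μ,
        sg (chi p.1 p.2) * (f p.1 x * mul g k p.2 x) =
        ∑ q ∈ Finset.HasAntidiagonal.antidiagonal p.2,
          sg (chi p.1 p.2) * (f p.1 x * (sg (chi q.1 q.2) * (g q.1 x * k q.2 x))) := fun p hp => by
      rw [Finset.HasAntidiagonal.mem_antidiagonal] at hp
      rw [mul_apply _ _ _ _ (Legal.of_add_right (hp ▸ h)), Finset.mul_sum, Finset.mul_sum]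
    rw [Finset.sum_congr rfl h1, Finset.sum_congr rfl h2, Finset.sum_sigma', Finset.sum_sigma']
    refine Finset.sum_nbij' (fun ⟨⟨_i, j⟩, ⟨k, l⟩⟩ ↦ ⟨(k, l + j), (l, j)⟩)
      (fun ⟨⟨i, _j⟩, ⟨k, l⟩⟩ ↦ ⟨(i + k, l), (i, k)⟩) ?_ ?_ ?_ ?_ ?_
    · rintro ⟨⟨i, j⟩, ⟨a, b⟩⟩ hp
      simp only [Finset.mem_sigma, Finset.HasAntidiagonal.mem_antidiagonal] at hp ⊢
      exact ⟨by rw [← add_assoc, hp.2, hp.1], trivial⟩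
    · rintro ⟨⟨i, j⟩, ⟨a, b⟩⟩ hp
      simp only [Finset.mem_sigma, Finset.HasAntidiagonal.mem_antidiagonal] at hp ⊢
      exact ⟨by rw [add_assoc, hp.2, hp.1], trivial⟩
    · rintro ⟨⟨i, j⟩, ⟨a, b⟩⟩ hp
      simp only [Finset.mem_sigma, Finset.HasAntidiagonal.mem_antidiagonal] at hp
      obtain ⟨-, rfl⟩ := hp
      rfl
    · rintro ⟨⟨i, j⟩, ⟨a, b⟩⟩ hp
      simp only [Finset.mem_sigma, Finset.HasAntidiagonal.mem_antidiagonal] at hp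
      obtain ⟨-, rfl⟩ := hp
      rfl
    · rintro ⟨⟨i, j⟩, ⟨a, b⟩⟩ hp
      simp only [Finset.mem_sigma, Finset.HasAntidiagonal.mem_antidiagonal] at hp
      obtain ⟨-, rfl⟩ := hp
      simp only [chi_add_left, chi_add_right, sg_add]
      ring
  · rw [mul_apply_of_not_legal _ _ _ _ h, mul_apply_of_not_legal _ _ _ _ h]

theorem mul_add' (f g k : C.SFun) : mul f (g + k) = mul f g + mul f k := by
  funext μ x
  simp only [mul, Pi.add_apply]
  split_ifs
  · rw [← Finset.sum_add_distrib]
    exact Finset.sum_congr rfl fun _ _ => by ring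
  · simp

theorem add_mul' (f g k : C.SFun) : mul (f + g) k = mul f k + mul g k := by
  funext μ x
  simp only [mul, Pi.add_apply]
  split_ifs
  · rw [← Finset.sum_add_distrib]
    exact Finset.sum_congr rfl fun _ _ => by ring
  · simp

theorem smul_mul' (c : ℝ) (f g : C.SFun) : mul (c • f) g = c • mul f g := by
  funext μ x
  simp only [mul, Pi.smul_apply, smul_eq_mul]
  split_ifs
  · rw [Finset.mul_sum]
    exact Finset.sum_congr rfl fun _ _ => by ring
  · simp

theorem mul_smul' (c : ℝ) (f g : C.SFun) : mul f (c • g) = c • mul f g := by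
  funext μ x
  simp only [mul, Pi.smul_apply, smul_eq_mul]
  split_ifs
  · rw [Finset.mul_sum]
    exact Finset.sum_congr rfl fun _ _ => by ring
  · simp

theorem mul_congr {f f' g g' : C.SFun} {x : C.Pt} (hf : ∀ μ, f μ x = f' μ x)
    (hg : ∀ μ, g μ x = g' μ x) (μ : C.Mono) : mul f g μ x = mul f' g' μ x := by
  simp only [mul, hf, hg]

/-! ### The algebra of superfunctions over an open set -/

/-- `f` is a superfunction over `U`, extended by zero. -/
def MemSA (U : Opens C.Pt) (f : C.SFun) : Prop :=
  (∀ μ, ContDiffOn ℝ ∞ (f μ) U) ∧ ∀ μ x, (¬ Legal μ ∨ x ∉ U) → f μ x = 0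

/-- The superfunctions over `U`, extended by zero outside `U`. -/
def saSub (U : Opens C.Pt) : Submodule ℝ C.SFun where
  carrier := {f | MemSA U f}
  add_mem' := fun {f g} hf hg =>
    ⟨fun μ => (hf.1 μ).add (hg.1 μ), fun μ x h => by simp [hf.2 μ x h, hg.2 μ x h]⟩
  zero_mem' := ⟨fun _ => contDiffOn_const, fun _ _ _ => rfl⟩
  smul_mem' := fun c f hf =>
    ⟨fun μ => (hf.1 μ).const_smul c, fun μ x h => by simp [hf.2 μ x h]⟩

/-- The algebra of superfunctions over `U`. -/
def SA (U : Opens C.Pt) : Type := saSub U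

namespace SA

variable {U : Opens C.Pt}

instance : AddCommGroup (SA U) := inferInstanceAs (AddCommGroup (saSub U))

instance : Module ℝ (SA U) := inferInstanceAs (Module ℝ (saSub U))

/-- A superfunction over `U` from its coefficients. -/
def mk (f : C.SFun) (h : MemSA U f) : SA U := ⟨f, h⟩

theorem mem (f : SA U) : MemSA U f.1 := f.2

instance : CoeFun (SA U) fun _ => C.Mono → C.Pt → ℝ := ⟨fun f => f.1⟩

theorem smooth (f : SA U) (μ : C.Mono) : ContDiffOn ℝ ∞ (f μ) U := f.mem.1 μ

theorem eq_zero_of_not_legal (f : SA U) {μ : C.Mono} (h : ¬ Legal μ) (x : C.Pt) : f μ x = 0 :=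
  f.mem.2 μ x (Or.inl h)

theorem eq_zero_of_notMem (f : SA U) (μ : C.Mono) {x : C.Pt} (h : x ∉ U) : f μ x = 0 :=
  f.mem.2 μ x (Or.inr h)

theorem contDiffAt (f : SA U) (μ : C.Mono) {x : C.Pt} (hx : x ∈ U) : ContDiffAt ℝ ∞ (f μ) x :=
  (f.smooth μ).contDiffAt (U.isOpen.mem_nhds hx)

theorem differentiableAt (f : SA U) (μ : C.Mono) {x : C.Pt} (hx : x ∈ U) :
    DifferentiableAt ℝ (f μ) x :=
  (f.contDiffAt μ hx).differentiableAt (by simp)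

theorem ext' {f g : SA U} (h : ∀ μ x, f μ x = g μ x) : f = g :=
  Subtype.ext (funext fun μ => funext fun x => h μ x)

theorem ext {f g : SA U} (h : ∀ μ, Legal μ → ∀ x ∈ U, f μ x = g μ x) : f = g := by
  refine ext' fun μ x => ?_
  by_cases hμ : Legal μ
  · by_cases hx : x ∈ U
    · exact h μ hμ x hx
    · rw [f.eq_zero_of_notMem μ hx, g.eq_zero_of_notMem μ hx]
  · rw [f.eq_zero_of_not_legal hμ, g.eq_zero_of_not_legal hμ]

@[simp] theorem add_apply (f g : SA U) (μ : C.Mono) (x : C.Pt) : (f + g) μ x = f μ x + g μ x := rfl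

@[simp] theorem neg_apply (f : SA U) (μ : C.Mono) (x : C.Pt) : (-f) μ x = -f μ x := rfl

@[simp] theorem zero_apply (μ : C.Mono) (x : C.Pt) : (0 : SA U) μ x = 0 := rfl

@[simp] theorem smul_apply (c : ℝ) (f : SA U) (μ : C.Mono) (x : C.Pt) : (c • f) μ x = c * f μ x :=
  rfl

/-- Evaluation of a coefficient. -/
def coeff (μ : C.Mono) (x : C.Pt) : SA U →ₗ[ℝ] ℝ where
  toFun f := f μ x
  map_add' _ _ := rfl
  map_smul' _ _ := rfl

theorem sum_apply {ι : Type*} (s : Finset ι) (f : ι → SA U) (μ : C.Mono) (x : C.Pt) :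
    (∑ i ∈ s, f i) μ x = ∑ i ∈ s, f i μ x :=
  map_sum (coeff (U := U) μ x) f s

open Classical in
/-- The superfunction over `U` that agrees with `f` on `U`. -/
def ofSFun (f : C.SFun) (hf : IsSuperFun (U : Set C.Pt) f) : SA U :=
  mk (fun μ x => if x ∈ U then f μ x else 0)
    ⟨fun μ => (hf.1 μ).congr fun x hx => if_pos hx, fun μ x h => by
      by_cases hx : x ∈ U
      · simp only [if_pos hx]
        exact hf.2 μ (h.resolve_right (not_not.2 hx)) x hx
      · simp only [if_neg hx]⟩

theorem ofSFun_apply (f : C.SFun) (hf : IsSuperFun (U : Set C.Pt) f) (μ : C.Mono) {x : C.Pt}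
    (hx : x ∈ U) : ofSFun f hf μ x = f μ x :=
  if_pos hx

theorem isSuperFun (f : SA U) : IsSuperFun (U : Set C.Pt) f.1 :=
  ⟨f.smooth, fun _ h x _ => f.eq_zero_of_not_legal h x⟩

end SA

theorem isSuperFun_mul {U : Set C.Pt} {f g : C.SFun} (hf : IsSuperFun U f) (hg : IsSuperFun U g) :
    IsSuperFun U (mul f g) := by
  refine ⟨fun μ => ?_, fun μ h x _ => mul_apply_of_not_legal f g μ x h⟩
  by_cases h : Legal μ
  · have := fun x => mul_apply f g μ x h
    rw [funext this]
    exact ContDiffOn.sum fun p _ => contDiffOn_const.mul ((hf.1 _).mul (hg.1 _))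
  · rw [funext fun x => mul_apply_of_not_legal f g μ x h]
    exact contDiffOn_const

namespace SA

variable {U : Opens C.Pt}

instance : Mul (SA U) where
  mul f g := mk (mul f.1 g.1) ⟨(isSuperFun_mul f.isSuperFun g.isSuperFun).1, fun μ x h => by
    by_cases hμ : Legal μ
    · rw [mul_apply _ _ _ _ hμ]
      refine Finset.sum_eq_zero fun p _ => ?_
      rw [f.eq_zero_of_notMem _ (h.resolve_left (not_not.2 hμ))]
      ring
    · exact mul_apply_of_not_legal _ _ _ _ hμ⟩

open Classical in
/-- The superfunction over `U` whose only coefficient is the function `a`, at the monomial `ν`. -/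
def monom (ν : C.Mono) (hν : Legal ν) (a : C.Pt → ℝ) (ha : ContDiffOn ℝ ∞ a U) : SA U :=
  mk (fun μ x => if μ = ν ∧ x ∈ U then a x else 0) ⟨fun μ => by
      by_cases h : μ = ν
      · exact ha.congr fun x hx => if_pos ⟨h, hx⟩
      · simp only [h, false_and, if_false]
        exact contDiffOn_const,
    fun μ x h => if_neg fun h' => by
      rcases h with h | h
      · exact h (h'.1 ▸ hν)
      · exact h h'.2⟩

open Classical in
theorem monom_apply (ν : C.Mono) (hν : Legal ν) (a : C.Pt → ℝ) (ha : ContDiffOn ℝ ∞ a U)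
    (μ : C.Mono) {x : C.Pt} (hx : x ∈ U) : monom ν hν a ha μ x = if μ = ν then a x else 0 := by
  change (if μ = ν ∧ x ∈ U then a x else 0) = _
  simp [hx]

/-- A smooth function on the body, as a superfunction. -/
def const (a : C.Pt → ℝ) (ha : ContDiffOn ℝ ∞ a U) : SA U := monom 0 legal_zero a ha

instance : One (SA U) := ⟨const (fun _ => 1) contDiffOn_const⟩

open Classical in
theorem mul_apply (f g : SA U) {μ : C.Mono} (h : Legal μ) (x : C.Pt) : (f * g) μ x =
    ∑ p ∈ Finset.HasAntidiagonal.antidiagonal μ, sg (chi p.1 p.2) * (f p.1 x * g p.2 x) :=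
  BV.mul_apply f.1 g.1 μ x h

open Classical in
theorem const_apply (a : C.Pt → ℝ) (ha : ContDiffOn ℝ ∞ a U) (μ : C.Mono) {x : C.Pt}
    (hx : x ∈ U) : const a ha μ x = if μ = 0 then a x else 0 :=
  monom_apply _ _ _ _ _ hx

open Classical in
theorem one_apply (μ : C.Mono) {x : C.Pt} (hx : x ∈ U) :
    (1 : SA U) μ x = if μ = 0 then 1 else 0 :=
  const_apply (fun _ => 1) contDiffOn_const μ hx

theorem const_mul_apply (a : C.Pt → ℝ) (ha : ContDiffOn ℝ ∞ a U) (f : SA U) (μ : C.Mono)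
    {x : C.Pt} (hx : x ∈ U) : (const a ha * f) μ x = a x * f μ x := by
  classical
  by_cases h : Legal μ
  · rw [mul_apply _ _ h, Finset.sum_eq_single (0, μ)]
    · simp [const_apply _ _ _ hx]
    · rintro ⟨p, q⟩ hp hne
      rw [const_apply _ _ _ hx, if_neg]
      · ring
      · rintro rfl
        rw [Finset.HasAntidiagonal.mem_antidiagonal] at hp
        exact hne (by simp_all)
    · simp
  · simp [eq_zero_of_not_legal _ h]

theorem mul_const_apply (a : C.Pt → ℝ) (ha : ContDiffOn ℝ ∞ a U) (f : SA U) (μ : C.Mono)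
    {x : C.Pt} (hx : x ∈ U) : (f * const a ha) μ x = f μ x * a x := by
  classical
  by_cases h : Legal μ
  · rw [mul_apply _ _ h, Finset.sum_eq_single (μ, 0)]
    · simp [const_apply _ _ _ hx]
    · rintro ⟨p, q⟩ hp hne
      rw [const_apply _ _ _ hx, if_neg]
      · ring
      · rintro rfl
        rw [Finset.HasAntidiagonal.mem_antidiagonal] at hp
        exact hne (by simp_all)
    · simp
  · simp [eq_zero_of_not_legal _ h]

instance : Ring (SA U) where
  __ := (inferInstance : AddCommGroup (SA U))
  mul := (· * ·)
  one := 1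
  mul_assoc f g k := Subtype.ext (mul_assoc' f.1 g.1 k.1)
  left_distrib f g k := Subtype.ext (mul_add' f.1 g.1 k.1)
  right_distrib f g k := Subtype.ext (add_mul' f.1 g.1 k.1)
  zero_mul f := Subtype.ext (show mul 0 f.1 = 0 by simpa using smul_mul' 0 0 f.1)
  mul_zero f := Subtype.ext (show mul f.1 0 = 0 by simpa using mul_smul' 0 f.1 0)
  one_mul f := ext fun μ _ x hx => by
    exact (const_mul_apply (fun _ => 1) contDiffOn_const f μ hx).trans (one_mul _)
  mul_one f := ext fun μ _ x hx => by
    exact (mul_const_apply (fun _ => 1) contDiffOn_const f μ hx).trans (mul_one _)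

instance : IsScalarTower ℝ (SA U) (SA U) := ⟨fun c f g => Subtype.ext (smul_mul' c f.1 g.1)⟩

instance : SMulCommClass ℝ (SA U) (SA U) := ⟨fun c f g => Subtype.ext (mul_smul' c f.1 g.1).symm⟩

theorem mul_apply_zero (f g : SA U) (x : C.Pt) : (f * g) 0 x = f 0 x * g 0 x := by
  classical
  rw [mul_apply _ _ legal_zero]
  simp

/-! ### Parity -/

/-- `f` has parity `p`. -/
def Par (p : ZMod 2) (f : SA U) : Prop := ∀ μ x, monoPar μ ≠ p → f μ x = 0

theorem Par.add {p : ZMod 2} {f g : SA U} (hf : Par p f) (hg : Par p g) : Par p (f + g) :=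
  fun μ x h => by simp [hf μ x h, hg μ x h]

theorem Par.smul {p : ZMod 2} {f : SA U} (c : ℝ) (hf : Par p f) : Par p (c • f) :=
  fun μ x h => by simp [hf μ x h]

theorem par_zero (p : ZMod 2) : Par p (0 : SA U) := fun _ _ _ => rfl

theorem Par.sum {p : ZMod 2} {ι : Type*} {s : Finset ι} {f : ι → SA U}
    (h : ∀ i ∈ s, Par p (f i)) : Par p (∑ i ∈ s, f i) := fun μ x hμ => by
  rw [sum_apply]
  exact Finset.sum_eq_zero fun i hi => h i hi μ x hμ

theorem Par.mul {p q : ZMod 2} {f g : SA U} (hf : Par p f) (hg : Par q g) : Par (p + q) (f * g) := by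
  classical
  intro μ x hμ
  by_cases h : Legal μ
  · rw [mul_apply _ _ h]
    refine Finset.sum_eq_zero fun a ha => ?_
    rw [Finset.HasAntidiagonal.mem_antidiagonal] at ha
    by_cases h1 : monoPar a.1 = p
    · by_cases h2 : monoPar a.2 = q
      · exact absurd (by rw [← ha, monoPar_add, h1, h2]) hμ
      · rw [hg _ _ h2]; ring
    · rw [hf _ _ h1]; ring
  · exact eq_zero_of_not_legal _ h x

/-- Termwise this is `chi_swap`; monomials of the wrong parity have zero coefficient. -/
theorem mul_comm_of_par {p q : ZMod 2} {f g : SA U} (hf : Par p f) (hg : Par q g) :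
    f * g = sg (p * q) • (g * f) := by
  classical
  refine ext fun μ h x hx => ?_
  rw [smul_apply, mul_apply _ _ h, mul_apply _ _ h, Finset.mul_sum]
  refine Finset.sum_nbij' Prod.swap Prod.swap (by simp [Finset.HasAntidiagonal.mem_antidiagonal, add_comm]) (by simp [Finset.HasAntidiagonal.mem_antidiagonal, add_comm]) (by simp) (by simp) ?_
  rintro ⟨a, b⟩ hab
  rw [Finset.HasAntidiagonal.mem_antidiagonal] at hab
  simp only [Prod.swap]
  by_cases h1 : monoPar a = p
  · by_cases h2 : monoPar b = q
    · have := chi_swap (hab.symm ▸ h : Legal (a + b))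
      rw [h1, h2] at this
      rw [← this, sg_add]
      linear_combination (-sg (chi a b) * f a x * g b x) * sg_mul_self (chi b a)
    · rw [hg _ _ h2]; ring
  · rw [hf _ _ h1]; ring

open Classical in
/-- The component of parity `p`. -/
def proj (p : ZMod 2) : SA U →ₗ[ℝ] SA U where
  toFun f := mk (fun μ x => if monoPar μ = p then f μ x else 0) ⟨fun μ => by
      by_cases h : monoPar μ = p
      · simpa only [if_pos h] using f.smooth μ
      · simpa only [if_neg h] using contDiffOn_const,
    fun μ x h => by simp [f.mem.2 μ x h]⟩
  map_add' f g := ext' fun μ x => by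
    change (if monoPar μ = p then (f + g) μ x else 0) = (if monoPar μ = p then f μ x else 0) +
      (if monoPar μ = p then g μ x else 0)
    split_ifs <;> simp
  map_smul' c f := ext' fun μ x => by
    change (if monoPar μ = p then (c • f) μ x else 0) = c * (if monoPar μ = p then f μ x else 0)
    split_ifs <;> simp

open Classical in
theorem proj_apply (p : ZMod 2) (f : SA U) (μ : C.Mono) (x : C.Pt) :
    proj p f μ x = if monoPar μ = p then f μ x else 0 := rfl

theorem par_proj (p : ZMod 2) (f : SA U) : Par p (proj p f) := fun μ x h => by
  rw [proj_apply, if_neg h]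

theorem Par.eq_zero_of_ne {p q : ZMod 2} {f : SA U} (hf : Par p f) (h : p ≠ q) : proj q f = 0 := by
  refine ext' fun μ x => ?_
  rw [proj_apply, zero_apply]
  split_ifs with h'
  · exact hf μ x (h' ▸ h.symm)
  · rfl

theorem Par.proj_eq {p : ZMod 2} {f : SA U} (hf : Par p f) : proj p f = f := by
  refine ext' fun μ x => ?_
  rw [proj_apply]
  split_ifs with h
  · rfl
  · exact (hf μ x h).symm

theorem proj_add_proj (p : ZMod 2) (f : SA U) : proj p f + proj (p + 1) f = f := by
  refine ext' fun μ x => ?_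
  rw [add_apply, proj_apply, proj_apply]
  generalize monoPar μ = q
  rcases zmod2_cases p with rfl | rfl <;> rcases zmod2_cases q with rfl | rfl <;>
    simp [zmod2_add_self]

/-- With its mirror image, this lets an identity between matrices with homogeneous entries on one
side be cut down to a single parity. -/
theorem proj_mul_left {p q : ZMod 2} {f g : SA U} (hf : Par p f) :
    proj q (f * g) = f * proj (p + q) g := by
  have h1 : Par q (f * proj (p + q) g) := by
    simpa [← add_assoc, zmod2_add_self] using hf.mul (par_proj (p + q) g)
  have h2 : Par (q + 1) (f * proj (p + q + 1) g) := by
    simpa [← add_assoc, zmod2_add_self] using hf.mul (par_proj (p + q + 1) g)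
  conv_lhs => rw [← proj_add_proj (p + q) g]
  rw [mul_add, map_add, h1.proj_eq, h2.eq_zero_of_ne (by simp), add_zero]

theorem proj_mul_right {p q : ZMod 2} {f g : SA U} (hg : Par p g) :
    proj q (f * g) = proj (q + p) f * g := by
  have h1 : Par q (proj (q + p) f * g) := by
    simpa [add_assoc, zmod2_add_self] using (par_proj (q + p) f).mul hg
  have h2 : Par (q + 1) (proj (q + p + 1) f * g) := by
    have := (par_proj (q + p + 1) f).mul hg
    rwa [add_right_comm, add_assoc q, zmod2_add_self, add_zero] at this
  conv_lhs => rw [← proj_add_proj (q + p) f]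
  rw [add_mul, map_add, h1.proj_eq, h2.eq_zero_of_ne (by simp), add_zero]

theorem par_one : Par 0 (1 : SA U) := fun μ x h => by
  classical
  by_cases hx : x ∈ U
  · rw [one_apply _ hx, if_neg]
    rintro rfl
    simp at h
  · exact eq_zero_of_notMem _ _ hx

end SA

/-! ### Combinatorics behind the graded Leibniz rule -/

theorem legal_add_single {μ : C.Mono} {v : C.Var} (h : Legal μ)
    (hv : v.par ≠ 0 → μ v = 0) : Legal (μ + Finsupp.single v 1) := fun w hw => by
  rw [Finsupp.add_apply, Finsupp.single_apply]
  split_ifs with h'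
  · subst h'; rw [hv hw]
  · exact h w hw

/-- In contrast to `chi_swap` no legality is assumed, so the term `w = v` of `monoPar` is surplus;
the last summand cancels it, because a parity is equal to its square. -/
theorem chi_single_add (v : C.Var) (μ : C.Mono) :
    chi (Finsupp.single v 1) μ + chi μ (Finsupp.single v 1) =
      v.par * monoPar μ + v.par * μ v := by
  have h1 : chi (Finsupp.single v 1) μ = μ.sum fun w j => if w < v then v.par * w.par * j else 0 := by
    rw [chi, Finsupp.sum_single_index (by simp [Finsupp.sum])]
    simp
  have h2 : chi μ (Finsupp.single v 1) = μ.sum fun w j => if v < w then v.par * w.par * j else 0 := by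
    rw [chi]
    refine Finsupp.sum_congr fun w _ => ?_
    rw [Finsupp.sum_single_index (by simp)]
    split_ifs
    · push_cast; ring
    · rfl
  have h3 : v.par * (μ v : ZMod 2) =
      μ.sum fun w j => if w = v then v.par * w.par * j else 0 := by
    simp only [Finsupp.sum]
    rw [Finset.sum_ite_eq', zmod2_mul_self]
    split_ifs with h
    · rfl
    · simp [Finsupp.notMem_support_iff.1 h]
  rw [h1, h2, h3, monoPar_eq_sum]
  simp only [Finsupp.sum, Finset.mul_sum, ← Finset.sum_add_distrib]
  refine Finset.sum_congr rfl fun w _ => ?_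
  rcases lt_trichotomy v w with h | rfl | h
  · simp [h, h.not_gt, h.ne']; ring
  · simp; ring_nf
    rw [mul_two, zmod2_add_self]
  · simp [h, h.not_gt, h.ne]; ring

open Classical in
-- The weight kills the splittings whose first part lacks `v`; all others arise once by adding `v`
-- to the first part of a splitting of `μ`.
theorem sum_antidiagonal_fst (v : C.Var) (μ : C.Mono) (F : C.Mono × C.Mono → ℝ) :
    ∑ p ∈ Finset.HasAntidiagonal.antidiagonal (μ + Finsupp.single v 1), ((p : C.Mono × C.Mono).1 v : ℝ) * F p =
    ∑ q ∈ Finset.HasAntidiagonal.antidiagonal μ,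
      ((q.1 v : ℝ) + 1) * F (q.1 + Finsupp.single v 1, q.2) := by
  symm
  refine Finset.sum_of_injOn (fun q => (q.1 + Finsupp.single v 1, q.2)) ?_ ?_ ?_ ?_
  · rintro ⟨a, b⟩ _ ⟨a', b'⟩ _ h
    simpa using h
  · rintro ⟨a, b⟩ h
    simp only [SetLike.mem_coe, Finset.HasAntidiagonal.mem_antidiagonal] at h ⊢
    rw [← h]; abel
  · rintro ⟨a, b⟩ h h'
    rw [Finset.HasAntidiagonal.mem_antidiagonal] at h
    have : a v = 0 := by
      by_contra h0
      have hle : Finsupp.single v 1 ≤ a := by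
        rw [Finsupp.single_le_iff]; omega
      refine h' ⟨(a - Finsupp.single v 1, b), ?_, ?_⟩
      · simp only [SetLike.mem_coe, Finset.HasAntidiagonal.mem_antidiagonal]
        have h2 : a - Finsupp.single v 1 + b + Finsupp.single v 1 = μ + Finsupp.single v 1 := by
          rw [← h, add_right_comm, tsub_add_cancel_of_le hle]
        exact add_right_cancel h2
      · simp [tsub_add_cancel_of_le hle]
    simp [this]
  · rintro ⟨a, b⟩ _
    simp

open Classical in
theorem sum_antidiagonal_snd (v : C.Var) (μ : C.Mono) (F : C.Mono × C.Mono → ℝ) :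
    ∑ p ∈ Finset.HasAntidiagonal.antidiagonal (μ + Finsupp.single v 1), ((p : C.Mono × C.Mono).2 v : ℝ) * F p =
    ∑ q ∈ Finset.HasAntidiagonal.antidiagonal μ,
      ((q.2 v : ℝ) + 1) * F (q.1, q.2 + Finsupp.single v 1) := by
  have hs : ∀ (ν : C.Mono) (G : C.Mono × C.Mono → ℝ),
      ∑ p ∈ Finset.HasAntidiagonal.antidiagonal ν, G p =
      ∑ p ∈ Finset.HasAntidiagonal.antidiagonal ν, G p.swap := fun ν G =>
    Finset.sum_nbij' Prod.swap Prod.swap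
      (by simp [Finset.HasAntidiagonal.mem_antidiagonal, add_comm])
      (by simp [Finset.HasAntidiagonal.mem_antidiagonal, add_comm]) (by simp) (by simp) (by simp)
  rw [hs, hs μ]
  exact sum_antidiagonal_fst v μ fun p => F p.swap

/-! ### Coordinates and derivations -/

/-- All variables: the even coordinates and the others. -/
abbrev GV (C : FieldContent) : Type := {j : C.Coord // C.εbar j = 0} ⊕ C.Var

/-- Parity of a variable. -/
def gpar : GV C → ZMod 2 := Sum.elim (fun _ => 0) Var.par

@[simp] theorem gpar_inl (j : {j : C.Coord // C.εbar j = 0}) : gpar (Sum.inl j : GV C) = 0 := rfl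

@[simp] theorem gpar_inr (v : C.Var) : gpar (Sum.inr v : GV C) = v.par := rfl

namespace SA

variable {U : Opens C.Pt}

open Classical in
/-- The derivative along an even coordinate. -/
def pdEven (j : {j : C.Coord // C.εbar j = 0}) (f : SA U) : SA U :=
  mk (fun μ x => if x ∈ U then fderiv ℝ (f μ) x (Pi.single j 1) else 0)
    ⟨fun μ => ((((f.smooth μ).fderiv_of_isOpen U.isOpen (m := ∞) (by simp)).clm_apply
        contDiffOn_const).congr fun x hx => if_pos hx), fun μ x h => by
      by_cases hx : x ∈ U
      · have : f μ = 0 := funext fun y => f.eq_zero_of_not_legal (h.resolve_right (not_not.2 hx)) y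
        simp [this]
      · simp [hx]⟩

theorem pdEven_apply (j : {j : C.Coord // C.εbar j = 0}) (f : SA U) (μ : C.Mono) {x : C.Pt}
    (hx : x ∈ U) : pdEven j f μ x = fderiv ℝ (f μ) x (Pi.single j 1) := if_pos hx

/-- The left derivative along a variable that is not an even coordinate. -/
def pdVar (v : C.Var) (f : SA U) : SA U :=
  mk (fun μ x => sg (chi (Finsupp.single v 1) μ) * ((μ v + 1 : ℕ) * f (μ + Finsupp.single v 1) x))
    ⟨fun μ => contDiffOn_const.mul (contDiffOn_const.mul (f.smooth _)), fun μ x h => by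
      have := f.mem.2 (μ + Finsupp.single v 1) x (h.imp_left fun h h' => h h'.of_add_left)
      simp only [this, mul_zero]⟩

theorem pdVar_apply (v : C.Var) (f : SA U) (μ : C.Mono) (x : C.Pt) : pdVar v f μ x =
    sg (chi (Finsupp.single v 1) μ) * ((μ v + 1 : ℕ) * f (μ + Finsupp.single v 1) x) := rfl

/-- The left derivative along a variable. -/
def pd : GV C → SA U →ₗ[ℝ] SA U
  | Sum.inl j =>
    { toFun := pdEven j
      map_add' := fun f g => ext fun μ _ x hx => by
        rw [add_apply, pdEven_apply _ _ _ hx, pdEven_apply _ _ _ hx, pdEven_apply _ _ _ hx]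
        change fderiv ℝ (f μ + g μ) x _ = _
        rw [fderiv_add (f.differentiableAt μ hx) (g.differentiableAt μ hx)]
        rfl
      map_smul' := fun c f => ext fun μ _ x hx => by
        rw [RingHom.id_apply, smul_apply, pdEven_apply _ _ _ hx, pdEven_apply _ _ _ hx]
        change fderiv ℝ (c • f μ) x _ = _
        rw [fderiv_const_smul (f.differentiableAt μ hx)]
        rfl }
  | Sum.inr v =>
    { toFun := pdVar v
      map_add' := fun f g => ext' fun μ x => by
        simp only [pdVar_apply, add_apply]
        ring
      map_smul' := fun c f => ext' fun μ x => by
        simp only [pdVar_apply, smul_apply, RingHom.id_apply]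
        ring }

theorem pd_inl_apply (j : {j : C.Coord // C.εbar j = 0}) (f : SA U) (μ : C.Mono) {x : C.Pt}
    (hx : x ∈ U) : pd (Sum.inl j) f μ x = fderiv ℝ (f μ) x (Pi.single j 1) :=
  pdEven_apply j f μ hx

theorem pd_inr_apply (v : C.Var) (f : SA U) (μ : C.Mono) (x : C.Pt) : pd (Sum.inr v) f μ x =
    sg (chi (Finsupp.single v 1) μ) * ((μ v + 1 : ℕ) * f (μ + Finsupp.single v 1) x) := rfl

theorem Par.pd {p : ZMod 2} {f : SA U} (hf : Par p f) (g : GV C) :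
    Par (gpar g + p) (SA.pd g f) := by
  intro μ x hμ
  rcases g with j | v
  · by_cases hx : x ∈ U
    · rw [pd_inl_apply _ _ _ hx]
      have : f μ = 0 := funext fun y => hf μ y (by simpa using hμ)
      simp [this]
    · exact eq_zero_of_notMem _ _ hx
  · rw [pd_inr_apply, hf]
    · ring
    · rw [monoPar_add, monoPar_single]
      intro h
      apply hμ
      rw [← h, gpar_inr, add_left_comm, zmod2_add_self, add_zero]

theorem pd_mul {p : ZMod 2} {f : SA U} (hf : Par p f) (g : GV C) (k : SA U) :
    pd g (f * k) = pd g f * k + sg (gpar g * p) • (f * pd g k) := by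
  classical
  refine ext fun μ hμ x hx => ?_
  rw [add_apply, smul_apply]
  rcases g with j | v
  · rw [pd_inl_apply _ _ _ hx, gpar_inl, zero_mul, sg_zero, one_mul, mul_apply _ _ hμ,
      mul_apply _ _ hμ, ← Finset.sum_add_distrib]
    have h1 : (f * k) μ = fun y => ∑ q ∈ Finset.HasAntidiagonal.antidiagonal μ,
        sg (chi q.1 q.2) * (f q.1 y * k q.2 y) := funext fun y => mul_apply f k hμ y
    have h2 : HasFDerivAt ((f * k) μ) (∑ q ∈ Finset.HasAntidiagonal.antidiagonal μ,
        sg (chi q.1 q.2) • (f q.1 x • fderiv ℝ (k q.2) x + k q.2 x • fderiv ℝ (f q.1) x)) x := by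
      rw [h1]
      exact HasFDerivAt.fun_sum fun q _ => ((f.differentiableAt q.1 hx).hasFDerivAt.mul
        (k.differentiableAt q.2 hx).hasFDerivAt).const_mul _
    rw [h2.fderiv, _root_.sum_apply]
    refine Finset.sum_congr rfl fun q _ => ?_
    rw [pd_inl_apply _ _ _ hx, pd_inl_apply _ _ _ hx]
    simp
    ring
  -- Both terms of the Leibniz rule become sums over the splittings of `μ + v`, weighted by the
  -- exponent of `v` in the first and in the second part. These weights add up to `μ v + 1`, the
  -- factor in the derivative of the product.
  · have h1 := sum_antidiagonal_fst v μ fun p => sg (chi p.1 p.2 + chi (Finsupp.single v 1) μ) *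
      (f p.1 x * k p.2 x)
    have h2 := sum_antidiagonal_snd v μ fun p => sg (v.par * p.1 v) *
      (sg (chi p.1 p.2 + chi (Finsupp.single v 1) μ) * (f p.1 x * k p.2 x))
    have h3 : (pd (Sum.inr v) f * k) μ x = ∑ p ∈ Finset.HasAntidiagonal.antidiagonal (μ + Finsupp.single v 1),
        ((p : C.Mono × C.Mono).1 v : ℝ) * (sg (chi p.1 p.2 + chi (Finsupp.single v 1) μ) * (f p.1 x * k p.2 x)) := by
      rw [h1, mul_apply _ _ hμ]
      refine Finset.sum_congr rfl fun q hq => ?_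
      rw [Finset.HasAntidiagonal.mem_antidiagonal] at hq
      rw [pd_inr_apply, ← hq]
      simp only [chi_add_left, chi_add_right, sg_add]
      push_cast
      linear_combination (-((q.1 v : ℝ) + 1) * f (q.1 + Finsupp.single v 1) x * k q.2 x *
        sg (chi q.1 q.2) * sg (chi (Finsupp.single v 1) q.1)) *
        sg_mul_self (chi (Finsupp.single v 1) q.2)
    have h4 : sg (gpar (Sum.inr v) * p) * (f * pd (Sum.inr v) k) μ x =
        ∑ p ∈ Finset.HasAntidiagonal.antidiagonal (μ + Finsupp.single v 1),
        ((p : C.Mono × C.Mono).2 v : ℝ) * (sg (v.par * p.1 v) *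
        (sg (chi p.1 p.2 + chi (Finsupp.single v 1) μ) * (f p.1 x * k p.2 x))) := by
      rw [h2, mul_apply _ _ hμ, Finset.mul_sum]
      refine Finset.sum_congr rfl fun q hq => ?_
      rw [Finset.HasAntidiagonal.mem_antidiagonal] at hq
      by_cases hp : monoPar q.1 = p
      · have h5 := chi_single_add v q.1
        have h6 : sg (v.par * p) = sg (chi (Finsupp.single v 1) q.1) *
            sg (chi q.1 (Finsupp.single v 1)) * sg (v.par * q.1 v) := by
          rw [← sg_add, h5, sg_add, mul_assoc, sg_mul_self, hp, mul_one]
        rw [pd_inr_apply, ← hq, gpar_inr, h6]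
        simp only [chi_add_right, sg_add]
        push_cast
        ring
      · rw [hf _ _ hp]; ring
    rw [h3, h4, ← Finset.sum_add_distrib, pd_inr_apply]
    by_cases hl : Legal (μ + Finsupp.single v 1)
    · rw [mul_apply _ _ hl, Finset.mul_sum, Finset.mul_sum]
      refine Finset.sum_congr rfl fun q hq => ?_
      rw [Finset.HasAntidiagonal.mem_antidiagonal] at hq
      have hv : (μ v : ℝ) + 1 = q.1 v + q.2 v := by
        have := congrArg (fun ν : C.Mono => ν v) hq
        simp only [Finsupp.add_apply, Finsupp.single_eq_same] at this
        exact_mod_cast this.symm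
      have h5 : (q.2 v : ℝ) * sg (v.par * q.1 v) = q.2 v := by
        by_cases h0 : v.par = 0
        · simp [h0]
        · have := (hq.symm ▸ hl : Legal (q.1 + q.2)) v h0
          simp only [Finsupp.add_apply] at this
          rcases (by omega : q.1 v = 0 ∨ q.2 v = 0) with h | h <;> simp [h]
      push_cast
      rw [hv, sg_add]
      linear_combination (-sg (chi q.1 q.2) * sg (chi (Finsupp.single v 1) μ) * f q.1 x * k q.2 x)
        * h5
    -- Here `v` is odd and already occurs in `μ`. The product has no such coefficient, and on the
    -- right side the splittings with one `v` in each part contribute opposite amounts to the two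
    -- terms.
    · rw [eq_zero_of_not_legal _ hl]
      symm
      rw [mul_zero, mul_zero]
      have hv : v.par ≠ 0 ∧ μ v ≠ 0 := by
        by_contra h0
        exact hl (legal_add_single hμ fun h => by tauto)
      have hv1 : v.par = 1 := (zmod2_cases _).resolve_left hv.1
      have hμ1 := hμ v hv.1
      refine Finset.sum_eq_zero fun q hq => ?_
      rw [Finset.HasAntidiagonal.mem_antidiagonal] at hq
      have hqv := congrArg (fun ν : C.Mono => ν v) hq
      simp only [Finsupp.add_apply, Finsupp.single_eq_same] at hqv
      by_cases h1 : q.1 v ≤ 1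
      · by_cases h2 : q.2 v ≤ 1
        · have h1' : q.1 v = 1 := by omega
          have h2' : q.2 v = 1 := by omega
          rw [h1', h2', hv1]
          simp
        · rw [k.eq_zero_of_not_legal fun h => h2 (h v hv.1)]; ring
      · rw [f.eq_zero_of_not_legal fun h => h1 (h v hv.1)]; ring

theorem pd_comm (a b : GV C) (f : SA U) :
    pd a (pd b f) = sg (gpar a * gpar b) • pd b (pd a f) := by
  have even_var : ∀ (j : {j : C.Coord // C.εbar j = 0}) (v : C.Var),
      pd (Sum.inl j) (pd (Sum.inr v) f) = pd (Sum.inr v) (pd (Sum.inl j) f) := fun j v =>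
    ext fun μ _ x hx => by
      rw [pd_inl_apply _ _ _ hx, pd_inr_apply, pd_inl_apply _ _ _ hx]
      have : pd (Sum.inr v) f μ = fun y => (sg (chi (Finsupp.single v 1) μ) * (μ v + 1 : ℕ)) *
          f (μ + Finsupp.single v 1) y := funext fun y => by rw [pd_inr_apply]; ring
      rw [this, fderiv_const_mul (f.differentiableAt _ hx)]
      simp [mul_assoc]
  rcases a with i | v <;> rcases b with j | w
  · simp only [gpar_inl, mul_zero, sg_zero, one_smul]
    have key : ∀ (i j : {j : C.Coord // C.εbar j = 0}) (μ : C.Mono) (x : C.Pt), x ∈ U →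
        pd (Sum.inl i) (pd (Sum.inl j) f) μ x =
          fderiv ℝ (fderiv ℝ (f μ)) x (Pi.single i 1) (Pi.single j 1) := fun i j μ x hx => by
      rw [pd_inl_apply _ _ _ hx]
      have h1 : pd (Sum.inl j) f μ =ᶠ[𝓝 x] fun y => fderiv ℝ (f μ) y (Pi.single j 1) :=
        Filter.eventually_of_mem (U.isOpen.mem_nhds hx) fun y hy => pd_inl_apply j f μ hy
      have h2 : DifferentiableAt ℝ (fderiv ℝ (f μ)) x :=
        ((f.contDiffAt μ hx).fderiv_right (m := ∞) (by simp)).differentiableAt (by simp)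
      rw [h1.fderiv_eq, fderiv_clm_apply h2 (differentiableAt_const _)]
      simp
    refine ext fun μ _ x hx => ?_
    rw [key i j μ x hx, key j i μ x hx]
    -- Symmetry of the second derivative, available from class `C^2` on.
    exact ((f.contDiffAt μ hx).isSymmSndFDerivAt (by simpa using WithTop.coe_le_coe.2 (le_top : (2 : ℕ∞) ≤ ⊤))).eq _ _
  · simp [even_var]
  · simp [even_var]
  · refine ext' fun μ x => ?_
    rw [smul_apply]
    simp only [pd_inr_apply, gpar_inr]
    by_cases hl : Legal (μ + Finsupp.single v 1 + Finsupp.single w 1)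
    · have hc := chi_swap (a := Finsupp.single v 1) (b := Finsupp.single w 1) (by
        rw [add_assoc] at hl
        exact hl.of_add_right)
      rw [monoPar_single, monoPar_single] at hc
      rw [← hc, add_right_comm μ (Finsupp.single w 1) (Finsupp.single v 1)]
      have hn : (μ v + 1) * ((μ + Finsupp.single v 1 : C.Mono) w + 1) =
          (μ w + 1) * ((μ + Finsupp.single w 1 : C.Mono) v + 1) := by
        simp only [Finsupp.add_apply, Finsupp.single_apply]
        by_cases h : v = w
        · subst h; rfl
        · rw [if_neg h, if_neg (Ne.symm h)]; ring
      have hn' : ((μ v + 1 : ℕ) : ℝ) * ((μ + Finsupp.single v 1 : C.Mono) w + 1 : ℕ) =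
          (μ w + 1 : ℕ) * ((μ + Finsupp.single w 1 : C.Mono) v + 1 : ℕ) := by exact_mod_cast hn
      simp only [chi_add_right, sg_add]
      linear_combination (sg (chi (Finsupp.single v 1) μ) * sg (chi (Finsupp.single w 1) μ) *
        sg (chi (Finsupp.single w 1) (Finsupp.single v 1)) *
        f (μ + Finsupp.single v 1 + Finsupp.single w 1) x) * hn' -
        (sg (chi (Finsupp.single v 1) μ) * sg (chi (Finsupp.single w 1) μ) *
        sg (chi (Finsupp.single w 1) (Finsupp.single v 1)) * (μ w + 1 : ℕ) *
        ((μ + Finsupp.single w 1 : C.Mono) v + 1 : ℕ) *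
        f (μ + Finsupp.single v 1 + Finsupp.single w 1) x) *
        sg_mul_self (chi (Finsupp.single v 1) (Finsupp.single w 1))
    · rw [add_right_comm μ (Finsupp.single w 1) (Finsupp.single v 1),
        f.eq_zero_of_not_legal hl]
      ring

/-- A variable, as a superfunction over `U`. -/
def z : GV C → SA U
  | Sum.inl j => const (fun x => x j) (contDiff_apply ℝ ℝ j).contDiffOn
  | Sum.inr v => monom (Finsupp.single v 1) (legal_single v) (fun _ => 1) contDiffOn_const

theorem par_z (g : GV C) : Par (gpar g) (z g : SA U) := fun μ x h => by
  classical
  by_cases hx : x ∈ U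
  · rcases g with j | v
    · rw [z, const_apply _ _ _ hx, if_neg]
      rintro rfl
      simp at h
    · rw [z, monom_apply _ _ _ _ _ hx, if_neg]
      rintro rfl
      simp at h
  · exact eq_zero_of_notMem _ _ hx

open Classical in
theorem pd_z (g g' : GV C) : pd g (z g' : SA U) = if g = g' then 1 else 0 := by
  refine ext fun μ hμ x hx => ?_
  rcases g with i | v <;> rcases g' with j | w
  · rw [pd_inl_apply _ _ _ hx]
    have h1 : (z (Sum.inl j) : SA U) μ =ᶠ[𝓝 x] fun y => if μ = 0 then y j else 0 :=
      Filter.eventually_of_mem (U.isOpen.mem_nhds hx) fun y hy => const_apply _ _ _ hy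
    rw [h1.fderiv_eq]
    by_cases h0 : μ = 0
    · simp only [h0, if_true]
      have : HasFDerivAt (fun y : C.Pt => y j) (ContinuousLinearMap.proj (R := ℝ) j) x :=
        (ContinuousLinearMap.proj (R := ℝ) (φ := fun _ => ℝ) j).hasFDerivAt
      rw [this.fderiv]
      simp only [ContinuousLinearMap.proj_apply, Pi.single_apply, Sum.inl.injEq]
      by_cases hij : i = j
      · simp [hij, one_apply _ hx]
      · simp [hij, Ne.symm hij]
    · simp only [h0, if_false]
      split_ifs <;> simp [one_apply _ hx, h0]
  · rw [pd_inl_apply _ _ _ hx]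
    have h1 : (z (Sum.inr w) : SA U) μ =ᶠ[𝓝 x] fun y => if μ = Finsupp.single w 1 then 1 else 0 :=
      Filter.eventually_of_mem (U.isOpen.mem_nhds hx) fun y hy => monom_apply _ (legal_single w) (fun _ => 1) contDiffOn_const _ hy
    rw [h1.fderiv_eq]
    simp
  · rw [pd_inr_apply, z, const_apply _ _ _ hx, if_neg]
    · simp
    · intro h
      simpa using congrArg (fun ν : C.Mono => ν v) h
  · rw [pd_inr_apply, z, monom_apply _ _ _ _ _ hx]
    by_cases hvw : v = w
    · subst hvw
      by_cases h0 : μ = 0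
      · simp [h0, one_apply _ hx]
      · simp [h0, one_apply _ hx]
    · rw [if_neg, if_neg (by simpa using hvw)]
      · simp
      · intro h
        have := congrArg (fun ν : C.Mono => ν v) h
        simp [Ne.symm hvw] at this

theorem z_mul_pd_inl (j : {j : C.Coord // C.εbar j = 0}) (f : SA U) (μ : C.Mono) {x : C.Pt}
    (hx : x ∈ U) :
    (z (Sum.inl j) * pd (Sum.inl j) f : SA U) μ x = x j * fderiv ℝ (f μ) x (Pi.single j 1) := by
  rw [z, const_mul_apply _ _ _ _ hx, pd_inl_apply _ _ _ hx]

theorem z_mul_apply (v : C.Var) (f : SA U) (μ : C.Mono) {x : C.Pt} (hx : x ∈ U)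
    (h : Legal (μ + Finsupp.single v 1)) :
    (z (Sum.inr v) * f : SA U) (μ + Finsupp.single v 1) x = sg (chi (Finsupp.single v 1) μ) * f μ x := by
  classical
  rw [mul_apply _ _ h, Finset.sum_eq_single (Finsupp.single v 1, μ)]
  · rw [z, monom_apply _ _ _ _ _ hx, if_pos rfl, one_mul]
  · rintro ⟨a, b⟩ hab hne
    rw [Finset.HasAntidiagonal.mem_antidiagonal] at hab
    rw [z, monom_apply _ _ _ _ _ hx, if_neg]
    · ring
    · rintro rfl
      have hb : b = μ := add_left_cancel (hab.trans (add_comm _ _))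
      exact hne (by rw [hb])
  · intro h'
    exact absurd (by rw [Finset.HasAntidiagonal.mem_antidiagonal, add_comm]) h'

theorem z_mul_apply_of_eq_zero (v : C.Var) (f : SA U) (μ : C.Mono) (x : C.Pt) (h : μ v = 0) :
    (z (Sum.inr v) * f : SA U) μ x = 0 := by
  classical
  by_cases hμ : Legal μ
  · by_cases hx : x ∈ U
    · rw [mul_apply _ _ hμ]
      refine Finset.sum_eq_zero fun q hq => ?_
      rw [Finset.HasAntidiagonal.mem_antidiagonal] at hq
      rw [z, monom_apply _ _ _ _ _ hx, if_neg]
      · ring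
      · intro h'
        rw [← hq, Finsupp.add_apply, h', Finsupp.single_eq_same] at h
        omega
    · exact eq_zero_of_notMem _ _ hx
  · exact eq_zero_of_not_legal _ hμ _

theorem z_mul_pd_inr (v : C.Var) (f : SA U) (μ : C.Mono) {x : C.Pt} (hx : x ∈ U) :
    (z (Sum.inr v) * pd (Sum.inr v) f : SA U) μ x = μ v * f μ x := by
  by_cases h0 : μ v = 0
  · rw [z_mul_apply_of_eq_zero _ _ _ _ h0, h0]
    simp
  · by_cases hμ : Legal μ
    · obtain ⟨ν, rfl⟩ : ∃ ν, μ = ν + Finsupp.single v 1 := ⟨μ - Finsupp.single v 1, by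
        rw [tsub_add_cancel_of_le]
        rw [Finsupp.single_le_iff]; omega⟩
      rw [z_mul_apply _ _ _ hx hμ, pd_inr_apply, ← mul_assoc, sg_mul_self]
      simp
    · rw [eq_zero_of_not_legal _ hμ, f.eq_zero_of_not_legal hμ, mul_zero]

end SA

theorem sum_four_comm {ι A : Type*} [Fintype ι] [AddCommMonoid A] (F : ι → ι → ι → ι → A) :
    ∑ v, ∑ w, ∑ a, ∑ b, F v w a b = ∑ a, ∑ b, ∑ v, ∑ w, F v w a b := by
  calc _ = ∑ p : ι × ι, ∑ q : ι × ι, F p.1 p.2 q.1 q.2 := by simp only [Fintype.sum_prod_type]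
    _ = ∑ q : ι × ι, ∑ p : ι × ι, F p.1 p.2 q.1 q.2 := Finset.sum_comm
    _ = _ := by simp only [Fintype.sum_prod_type]

/-! ### Scaling of the transversal coordinates -/

/-- Scaling of the transversal coordinates, as a continuous linear map. -/
def scaleL (t : ℝ) : C.Pt →L[ℝ] C.Pt :=
  ContinuousLinearMap.pi fun j => (Sum.elim (fun _ => t) (fun _ => 1) j.1 : ℝ) •
    ContinuousLinearMap.proj (R := ℝ) (φ := fun _ : {j : C.Coord // C.εbar j = 0} => ℝ) j

theorem scaleL_apply (t : ℝ) (x : C.Pt) : scaleL t x = scaleXi t x := by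
  funext ⟨j, hj⟩
  rcases j with j | j <;> simp [scaleL, scaleXi]

theorem contDiff_scaleL (t : ℝ) : ContDiff ℝ ∞ (fun x : C.Pt => scaleL t x) :=
  (scaleL (C := C) t).contDiff

theorem scaleXi_inl (t : ℝ) (x : C.Pt) (i : Fin C.numXi) (h : C.εbar (Sum.inl i) = 0) :
    scaleXi t x ⟨Sum.inl i, h⟩ = t * x ⟨Sum.inl i, h⟩ := rfl

theorem scaleXi_inr (t : ℝ) (x : C.Pt) (i : Fin C.numTheta) (h : C.εbar (Sum.inr i) = 0) :
    scaleXi t x ⟨Sum.inr i, h⟩ = x ⟨Sum.inr i, h⟩ := rfl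

theorem scaleXi_scaleXi (s t : ℝ) (x : C.Pt) : scaleXi s (scaleXi t x) = scaleXi (s * t) x := by
  funext ⟨j, hj⟩
  rcases j with j | j <;> simp [scaleXi, mul_assoc]

theorem scaleXi_one (x : C.Pt) : scaleXi 1 x = x := by
  funext ⟨j, hj⟩
  rcases j with j | j <;> simp [scaleXi]

/-- `U` is closed under contraction of the transversal coordinates. -/
class XiStar (U : Opens C.Pt) : Prop where
  scale_mem : ∀ x ∈ U, ∀ t ∈ Set.Icc (0 : ℝ) 1, scaleXi t x ∈ U

theorem XiStar.zero_mem {U : Opens C.Pt} [XiStar U] {x : C.Pt} (hx : x ∈ U) : scaleXi 0 x ∈ U :=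
  XiStar.scale_mem x hx 0 (by simp)

/-- Shifted antifield number of a variable. -/
def gsafn : GV C → ℕ
  | Sum.inl ⟨Sum.inl _, _⟩ => 1
  | Sum.inl ⟨Sum.inr _, _⟩ => 0
  | Sum.inr v => v.safn

namespace SA

variable {U : Opens C.Pt}

/-! ### Restriction to `ξ = 0` without antifields -/

section Rho

variable [XiStar U]

open Classical in
/-- Restriction to the locus where `ξ` and the antifields vanish. -/
def rho : SA U →+* SA U where
  toFun f := mk (fun μ x => if x ∈ U ∧ monoSafn μ = 0 then f μ (scaleXi 0 x) else 0)
    ⟨fun μ => by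
      by_cases h : monoSafn μ = 0
      · refine ContDiffOn.congr (f := fun x => f μ (scaleL 0 x)) ?_
          fun x hx => by
            simp only [scaleL_apply]
            exact if_pos ⟨hx, h⟩
        exact (f.smooth μ).comp (contDiff_scaleL 0).contDiffOn fun x hx => by
          rw [scaleL_apply]
          exact XiStar.zero_mem hx
      · simp only [h, and_false, if_false]
        exact contDiffOn_const,
    fun μ x h => by
      by_cases h' : x ∈ U ∧ monoSafn μ = 0
      · simp only [if_pos h']
        exact f.eq_zero_of_not_legal (h.resolve_right (not_not.2 h'.1)) _
      · simp only [if_neg h']⟩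
  map_one' := ext fun μ _ x hx => by
    change (if x ∈ U ∧ monoSafn μ = 0 then (1 : SA U) μ (scaleXi 0 x) else 0) = _
    rw [one_apply _ hx, one_apply _ (XiStar.zero_mem hx)]
    by_cases h : μ = 0 <;> simp [h, hx]
  map_zero' := ext fun μ _ x hx => by
    change (if x ∈ U ∧ monoSafn μ = 0 then (0 : SA U) μ (scaleXi 0 x) else 0) = _
    simp
  map_add' f g := ext fun μ _ x hx => by
    change (if x ∈ U ∧ monoSafn μ = 0 then (f + g) μ (scaleXi 0 x) else 0) =
      (if x ∈ U ∧ monoSafn μ = 0 then f μ (scaleXi 0 x) else 0) +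
      (if x ∈ U ∧ monoSafn μ = 0 then g μ (scaleXi 0 x) else 0)
    split_ifs <;> simp
  -- The weight `monoSafn` is additive with values in `ℕ`, so a product has weight zero only if both
  -- factors do. This makes the restriction multiplicative.
  map_mul' f g := ext fun μ hμ x hx => by
    change (if x ∈ U ∧ monoSafn μ = 0 then (f * g) μ (scaleXi 0 x) else 0) = _
    rw [mul_apply _ _ hμ, mul_apply _ _ hμ]
    by_cases h : x ∈ U ∧ monoSafn μ = 0
    · rw [if_pos h]
      refine Finset.sum_congr rfl fun q hq => ?_
      rw [Finset.HasAntidiagonal.mem_antidiagonal] at hq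
      have h' := h.2
      rw [← hq, monoSafn_add] at h'
      change _ = sg _ * ((if x ∈ U ∧ monoSafn q.1 = 0 then f q.1 (scaleXi 0 x) else 0) *
        (if x ∈ U ∧ monoSafn q.2 = 0 then g q.2 (scaleXi 0 x) else 0))
      rw [if_pos ⟨hx, by omega⟩, if_pos ⟨hx, by omega⟩]
    · rw [if_neg h]
      symm
      refine Finset.sum_eq_zero fun q hq => ?_
      rw [Finset.HasAntidiagonal.mem_antidiagonal] at hq
      have h' : ¬ monoSafn μ = 0 := fun h' => h ⟨hx, h'⟩
      rw [← hq, monoSafn_add] at h'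
      change sg _ * ((if x ∈ U ∧ monoSafn q.1 = 0 then f q.1 (scaleXi 0 x) else 0) *
        (if x ∈ U ∧ monoSafn q.2 = 0 then g q.2 (scaleXi 0 x) else 0)) = 0
      by_cases h1 : monoSafn q.1 = 0
      · rw [if_neg (c := x ∈ U ∧ monoSafn q.2 = 0) fun h2 => h' (by omega)]; ring
      · rw [if_neg (c := x ∈ U ∧ monoSafn q.1 = 0) fun h2 => h1 h2.2]; ring

theorem rho_apply (f : SA U) (μ : C.Mono) {x : C.Pt} (hx : x ∈ U) :
    rho f μ x = if monoSafn μ = 0 then f μ (scaleXi 0 x) else 0 := by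
  classical
  change (if x ∈ U ∧ monoSafn μ = 0 then f μ (scaleXi 0 x) else 0) = _
  simp [hx]

theorem rho_smul (c : ℝ) (f : SA U) : rho (c • f) = c • rho f := ext fun μ _ x hx => by
  rw [smul_apply, rho_apply _ _ hx, rho_apply _ _ hx]
  split_ifs <;> simp

theorem Par.rho {p : ZMod 2} {f : SA U} (hf : Par p f) : Par p (SA.rho f) := fun μ x h => by
  by_cases hx : x ∈ U
  · rw [rho_apply _ _ hx, hf μ _ h, ite_self]
  · exact eq_zero_of_notMem _ _ hx

theorem rho_z {g : GV C} (hg : gsafn g ≠ 0) : rho (z g : SA U) = 0 := ext fun μ _ x hx => by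
  classical
  have hx0 := XiStar.zero_mem hx
  rw [rho_apply _ _ hx, zero_apply]
  rcases g with ⟨j | j, hj⟩ | v
  · rw [z, const_apply _ _ _ hx0, scaleXi_inl, zero_mul]
    simp
  · exact absurd rfl hg
  · rw [z, monom_apply _ _ _ _ _ hx0]
    by_cases h : μ = Finsupp.single v 1
    · rw [h, monoSafn_single]
      exact if_neg hg
    · simp [h]

/-- Such a derivative is tangent to the locus onto which `rho` restricts. -/
theorem rho_pd {g : GV C} (hg : gsafn g = 0) (f : SA U) : rho (pd g f) = pd g (rho f) :=
  ext fun μ _ x hx => by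
    have hx0 := XiStar.zero_mem hx
    rw [rho_apply _ _ hx]
    rcases g with ⟨j | j, hj⟩ | v
    · exact absurd hg one_ne_zero
    · rw [pd_inl_apply _ _ _ hx, pd_inl_apply _ _ _ hx0]
      by_cases h : monoSafn μ = 0
      · have h1 : rho f μ =ᶠ[𝓝 x] fun y => f μ (scaleL 0 y) :=
          Filter.eventually_of_mem (U.isOpen.mem_nhds hx) fun y hy => by
            simp only [scaleL_apply]
            rw [rho_apply f μ hy, if_pos h]
        have h2 : HasFDerivAt (fun y => f μ (scaleL 0 y))
            ((fderiv ℝ (f μ) (scaleXi 0 x)).comp (scaleL 0)) x := by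
          have := (f.differentiableAt μ hx0).hasFDerivAt
          rw [← scaleL_apply] at this ⊢
          exact this.comp x (scaleL 0).hasFDerivAt
        rw [if_pos h, h1.fderiv_eq, h2.fderiv, ContinuousLinearMap.comp_apply]
        congr 1
        rw [scaleL_apply]
        funext ⟨k, hk⟩
        rcases k with k | k
        · simp [scaleXi]
        · rfl
      · have h1 : rho f μ =ᶠ[𝓝 x] fun _ => 0 :=
          Filter.eventually_of_mem (U.isOpen.mem_nhds hx) fun y hy => by
            rw [rho_apply f μ hy, if_neg h]
        rw [if_neg h, h1.fderiv_eq]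
        simp
    · change v.safn = 0 at hg
      rw [pd_inr_apply, pd_inr_apply, rho_apply _ _ hx, monoSafn_add, monoSafn_single, hg, add_zero]
      split_ifs <;> simp

end Rho

/-! ### Superfunctions of some of the variables -/

/-- The superfunctions that depend only on the even coordinates and on the variables in `P`. -/
def varSub (U : Opens C.Pt) (P : C.Var → Prop) : Subring (SA U) where
  carrier := {f | ∀ μ x, f μ x ≠ 0 → ∀ v, μ v ≠ 0 → P v}
  zero_mem' := fun μ x h => absurd rfl h
  one_mem' := fun μ x h v hv => by
    classical
    by_cases hx : x ∈ U
    · rw [one_apply _ hx] at h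
      by_cases h0 : μ = 0
      · simp [h0] at hv
      · simp [h0] at h
    · exact absurd (eq_zero_of_notMem _ _ hx) h
  add_mem' := fun {f g} hf hg μ x h => by
    by_cases h1 : f μ x = 0
    · refine hg μ x fun h2 => h ?_
      rw [add_apply, h1, h2, add_zero]
    · exact hf μ x h1
  neg_mem' := fun {f} hf μ x h => hf μ x fun h' => h (by rw [neg_apply, h', neg_zero])
  mul_mem' := fun {f g} hf hg μ x h v hv => by
    classical
    by_cases hμ : Legal μ
    · rw [mul_apply _ _ hμ] at h
      obtain ⟨q, hq, hne⟩ := Finset.exists_ne_zero_of_sum_ne_zero h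
      rw [Finset.HasAntidiagonal.mem_antidiagonal] at hq
      rw [← hq, Finsupp.add_apply] at hv
      have h3 := right_ne_zero_of_mul hne
      by_cases h4 : q.1 v = 0
      · exact hg q.2 x (right_ne_zero_of_mul h3) v (by omega)
      · exact hf q.1 x (left_ne_zero_of_mul h3) v h4
    · exact absurd (eq_zero_of_not_legal _ hμ _) h

theorem pd_mem_varSub {P : C.Var → Prop} {f : SA U} (hf : f ∈ varSub U P) (g : GV C) :
    pd g f ∈ varSub U P := by
  intro μ x h v hv
  have hx : x ∈ U := by
    by_contra hx
    exact h (eq_zero_of_notMem _ _ hx)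
  rcases g with j | w
  · rw [pd_inl_apply _ _ _ hx] at h
    by_contra hP
    have : f μ = 0 := funext fun y => by
      by_contra h'
      exact hP (hf μ y h' v hv)
    simp [this] at h
  · rw [pd_inr_apply] at h
    refine hf _ x (right_ne_zero_of_mul (right_ne_zero_of_mul h)) v ?_
    simp [hv]

theorem smul_mem_varSub {P : C.Var → Prop} {f : SA U} (hf : f ∈ varSub U P) (c : ℝ) :
    c • f ∈ varSub U P := fun μ x h => hf μ x fun h' => h (by rw [smul_apply, h', mul_zero])

theorem proj_mem_varSub {P : C.Var → Prop} {f : SA U} (hf : f ∈ varSub U P) (p : ZMod 2) :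
    proj p f ∈ varSub U P := fun μ x h => hf μ x fun h' => h (by rw [proj_apply, h', ite_self])

theorem rho_mem_varSub [XiStar U] {P : C.Var → Prop} {f : SA U} (hf : f ∈ varSub U P) :
    rho f ∈ varSub U fun v => P v ∧ v.safn = 0 := fun μ x h v hv => by
  have hx : x ∈ U := by
    by_contra hx
    exact h (eq_zero_of_notMem _ _ hx)
  rw [rho_apply _ _ hx] at h
  split_ifs at h with h'
  · exact ⟨hf μ _ h v hv, monoSafn_eq_zero.1 h' v hv⟩
  · exact absurd rfl h

theorem const_mem_varSub (P : C.Var → Prop) (a : C.Pt → ℝ) (ha : ContDiffOn ℝ ∞ a U) :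
    const a ha ∈ varSub U P := fun μ x h v hv => by
  classical
  by_cases hx : x ∈ U
  · rw [const_apply _ _ _ hx] at h
    by_cases h0 : μ = 0
    · simp [h0] at hv
    · simp [h0] at h
  · exact absurd (eq_zero_of_notMem _ _ hx) h

/-- The superfunctions of the fields. -/
abbrev fieldSub (U : Opens C.Pt) : Subring (SA U) := varSub U Var.IsField

/-- The superfunctions that do not depend on the even transversal coordinates. -/
def xiIndep (U : Opens C.Pt) [XiStar U] : Subring (SA U) where
  carrier := {f | ∀ μ, ∀ x ∈ U, f μ (scaleXi 0 x) = f μ x}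
  zero_mem' := fun μ x h => rfl
  one_mem' := fun μ x h => by rw [one_apply _ h, one_apply _ (XiStar.zero_mem h)]
  add_mem' := fun {f g} hf hg μ x h => by rw [add_apply, add_apply, hf μ x h, hg μ x h]
  neg_mem' := fun {f} hf μ x h => by rw [neg_apply, neg_apply, hf μ x h]
  mul_mem' := fun {f g} hf hg μ x h => by
    classical
    by_cases hμ : Legal μ
    · rw [mul_apply _ _ hμ, mul_apply _ _ hμ]
      exact Finset.sum_congr rfl fun q _ => by rw [hf _ x h, hg _ x h]
    · rw [eq_zero_of_not_legal _ hμ, eq_zero_of_not_legal _ hμ]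

/-- The superfunctions of the longitudinal fields. -/
def thetaSub (U : Opens C.Pt) [XiStar U] : Subring (SA U) :=
  varSub U (fun v => v.IsField ∧ v.safn = 0) ⊓ xiIndep U

section Theta

variable [XiStar U]

theorem rho_mem_thetaSub {f : SA U} (hf : f ∈ fieldSub U) : rho f ∈ thetaSub U :=
  ⟨rho_mem_varSub hf, fun μ x hx => by
    rw [rho_apply _ _ hx, rho_apply _ _ (XiStar.zero_mem hx), scaleXi_scaleXi, zero_mul]⟩

theorem proj_mem_thetaSub {f : SA U} (hf : f ∈ thetaSub U) (p : ZMod 2) : proj p f ∈ thetaSub U :=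
  ⟨proj_mem_varSub hf.1 p, fun μ x hx => by rw [proj_apply, proj_apply, hf.2 μ x hx]⟩

theorem pd_eq_zero_of_mem_thetaSub {f : SA U} (hf : f ∈ thetaSub U) {g : GV C}
    (hg : gsafn g ≠ 0) : pd g f = 0 := ext fun μ _ x hx => by
  rw [zero_apply]
  rcases g with ⟨j | j, hj⟩ | v
  · rw [pd_inl_apply _ _ _ hx]
    have h1 : f μ =ᶠ[𝓝 x] fun y => f μ (scaleL 0 y) :=
      Filter.eventually_of_mem (U.isOpen.mem_nhds hx) fun y hy => by
        simp only
        rw [scaleL_apply, hf.2 μ y hy]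
    have h2 : HasFDerivAt (fun y => f μ (scaleL 0 y))
        ((fderiv ℝ (f μ) (scaleXi 0 x)).comp (scaleL 0)) x := by
      have := (f.differentiableAt μ (XiStar.zero_mem hx)).hasFDerivAt
      rw [← scaleL_apply] at this ⊢
      exact this.comp x (scaleL 0).hasFDerivAt
    rw [h1.fderiv_eq, h2.fderiv, ContinuousLinearMap.comp_apply]
    have : scaleL 0 (Pi.single ⟨Sum.inl j, hj⟩ 1 : C.Pt) = 0 := by
      rw [scaleL_apply]
      funext ⟨k, hk⟩
      rcases k with k | k
      · simp [scaleXi]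
      · simp [scaleXi]
    rw [this, map_zero]
  · exact absurd rfl hg
  · rw [pd_inr_apply]
    by_cases h : f (μ + Finsupp.single v 1) x = 0
    · rw [h]; ring
    · exact absurd (hf.1 _ _ h v (by simp)).2 hg

end Theta

/-! ### Linear vector fields -/

section VectorField

variable {ι : Type*} [Fintype ι] (e : ι → GV C)

/-- The linear vector field with matrix `M` in the variables `e`. -/
def vf (M : Matrix ι ι (SA U)) (f : SA U) : SA U := ∑ v, ∑ w, z (e v) * M v w * pd (e w) f

/-- The entries of `M` have the parities of an odd operator. -/
def OddMat (M : Matrix ι ι (SA U)) : Prop := ∀ v w, Par (gpar (e v) + gpar (e w) + 1) (M v w)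

variable {e}

theorem vf_add (M N : Matrix ι ι (SA U)) (f : SA U) : vf e (M + N) f = vf e M f + vf e N f := by
  simp only [vf, Matrix.add_apply, mul_add, add_mul, Finset.sum_add_distrib]

theorem vf_apply_add (M : Matrix ι ι (SA U)) (f g : SA U) :
    vf e M (f + g) = vf e M f + vf e M g := by
  simp only [vf, map_add, mul_add, Finset.sum_add_distrib]

theorem vf_zero (f : SA U) : vf e 0 f = 0 := by simp [vf]

theorem vf_apply_zero (M : Matrix ι ι (SA U)) : vf e M 0 = 0 := by simp [vf]

theorem vf_one [DecidableEq ι] (f : SA U) : vf e 1 f = ∑ v, z (e v) * pd (e v) f := by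
  refine Finset.sum_congr rfl fun v _ => ?_
  rw [Finset.sum_eq_single v]
  · simp
  · intro w _ hw
    simp [Matrix.one_apply_ne' hw]
  · simp

theorem rho_vf [XiStar U] (he : ∀ v, gsafn (e v) ≠ 0) (M : Matrix ι ι (SA U)) (f : SA U) :
    rho (vf e M f) = 0 := by
  simp [vf, rho_z (he _)]

/-- The coefficients are constant along the variables `e`, so the first-order part of each composite
comes from differentiating the linear factor `z`, which produces the matrix product. The
second-order parts cancel: exchanging two odd coefficients and two graded-commuting derivatives
changes the sign. -/
theorem vf_vf_add_vf_vf (he : Function.Injective e) {M N : Matrix ι ι (SA U)} (hM : OddMat e M)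
    (hN : OddMat e N) (hM' : ∀ a v w, pd (e a) (M v w) = 0) (hN' : ∀ a v w, pd (e a) (N v w) = 0)
    (f : SA U) : vf e M (vf e N f) + vf e N (vf e M f) = vf e (M * N + N * M) f := by
  classical
  -- The second-order part of the composite. The sign is that of moving the derivative along `e w`
  -- past `z (e a) * N a b`, which has parity `gpar (e b) + 1`.
  let Q (M N : Matrix ι ι (SA U)) : SA U := ∑ v, ∑ w, ∑ a, ∑ b,
    sg (gpar (e w) * (gpar (e b) + 1)) •
      ((z (e v) * M v w) * (z (e a) * N a b) * pd (e w) (pd (e b) f))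
  have par_zM : ∀ {M : Matrix ι ι (SA U)}, OddMat e M → ∀ v w,
      Par (gpar (e w) + 1) (z (e v) * M v w) := fun {M} hM v w => by
    have := (par_z (U := U) (e v)).mul (hM v w)
    rwa [← add_assoc, ← add_assoc, zmod2_add_self, zero_add] at this
  have key : ∀ {M N : Matrix ι ι (SA U)}, OddMat e N → (∀ a v w, pd (e a) (N v w) = 0) →
      vf e M (vf e N f) = vf e (M * N) f + Q M N := fun {M N} hN hN' => by
    have h1 : ∀ w a b, pd (e w) (z (e a) * N a b * pd (e b) f) =
        (if w = a then 1 else 0) * N a b * pd (e b) f +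
        sg (gpar (e w) * (gpar (e b) + 1)) • (z (e a) * N a b * pd (e w) (pd (e b) f)) := by
      intro w a b
      rw [pd_mul (par_zM hN a b), pd_mul (par_z (e a)), hN', pd_z]
      simp [he.eq_iff]
    have h2 : ∀ v w, z (e v) * M v w * pd (e w) (vf e N f) =
        (∑ b, z (e v) * (M v w * N w b) * pd (e b) f) + ∑ a, ∑ b,
        sg (gpar (e w) * (gpar (e b) + 1)) •
          ((z (e v) * M v w) * (z (e a) * N a b) * pd (e w) (pd (e b) f)) := by
      intro v w
      simp only [vf, map_sum, h1, mul_add, Finset.sum_add_distrib, Finset.mul_sum, mul_smul_comm]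
      congr 1
      · rw [Finset.sum_eq_single w]
        · simp [mul_assoc]
        · intro a _ ha
          simp [Ne.symm ha]
        · simp
      · simp only [mul_assoc]
    rw [vf]
    simp only [h2, Finset.sum_add_distrib]
    congr 1
    rw [vf]
    refine Finset.sum_congr rfl fun v _ => ?_
    rw [Finset.sum_comm]
    refine Finset.sum_congr rfl fun b _ => ?_
    rw [Matrix.mul_apply, Finset.mul_sum, Finset.sum_mul]
  have hQ : Q M N = - Q N M := by
    have hc : Q N M = ∑ a, ∑ b, ∑ v, ∑ w, sg (gpar (e b) * (gpar (e w) + 1)) •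
      ((z (e a) * N a b) * (z (e v) * M v w) * pd (e b) (pd (e w) f)) := rfl
    rw [hc, ← Finset.sum_neg_distrib]
    have hr : Q M N = ∑ a, ∑ b, ∑ v, ∑ w, sg (gpar (e w) * (gpar (e b) + 1)) •
      ((z (e v) * M v w) * (z (e a) * N a b) * pd (e w) (pd (e b) f)) := by
      exact sum_four_comm _
    rw [hr]
    refine Finset.sum_congr rfl fun a _ => ?_
    simp only [← Finset.sum_neg_distrib]
    refine Finset.sum_congr rfl fun b _ => Finset.sum_congr rfl fun v _ =>
      Finset.sum_congr rfl fun w _ => ?_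
    rw [mul_comm_of_par (par_zM hM v w) (par_zM hN a b), pd_comm (e w) (e b), smul_mul_assoc,
      mul_smul_comm, smul_smul, smul_smul, ← neg_smul]
    congr 1
    rcases zmod2_cases (gpar (e w)) with h | h <;> rcases zmod2_cases (gpar (e b)) with h' | h' <;>
      simp [h, h', zmod2_add_self]
  rw [key hN hN', key hM hM', hQ, vf_add]
  abel

end VectorField

end SA

/-! ### Smoothness of parametric integrals -/

section Parametric

variable {E : Type} [NormedAddCommGroup E] [NormedSpace ℝ E] [ProperSpace E]

/-- Differentiation under the integral sign: the partial derivative is continuous on the product of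
`[0, 1]` with a compact ball inside `U`, and is therefore bounded there by a constant. -/
theorem hasFDerivAt_integral_of_contDiffOn {G : Type} [NormedAddCommGroup G] [NormedSpace ℝ G]
    {K : ℝ × E → G} {Ω : Set (ℝ × E)} (hΩ : IsOpen Ω) {U : Set E} (hU : IsOpen U)
    (hΩU : ∀ t ∈ Set.Icc (0 : ℝ) 1, ∀ x ∈ U, (t, x) ∈ Ω) (hK : ContDiffOn ℝ ∞ K Ω) {x : E}
    (hx : x ∈ U) : HasFDerivAt (fun y => ∫ t in (0 : ℝ)..1, K (t, y))
      (∫ t in (0 : ℝ)..1, (fderiv ℝ K (t, x)).comp (ContinuousLinearMap.inr ℝ ℝ E)) x := by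
  obtain ⟨r, hr, hrU⟩ := Metric.nhds_basis_closedBall.mem_iff.1 (hU.mem_nhds hx)
  have hK' : ContinuousOn (fun p => (fderiv ℝ K p).comp (ContinuousLinearMap.inr ℝ ℝ E)) Ω :=
    ((hK.continuousOn_fderiv_of_isOpen hΩ (by simp)).clm_comp continuousOn_const)
  have hsub : Set.Icc (0 : ℝ) 1 ×ˢ Metric.closedBall x r ⊆ Ω := fun p hp =>
    hΩU p.1 hp.1 p.2 (hrU hp.2)
  have hslice : ∀ y ∈ U, Set.MapsTo (fun t : ℝ => (t, y)) (Set.Icc 0 1) Ω := fun y hy t ht =>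
    hΩU t ht y hy
  have hcont : ∀ y : E, ContinuousOn (fun t : ℝ => (t, y)) (Set.Icc 0 1) := fun y => by fun_prop
  obtain ⟨b, hb⟩ := (isCompact_Icc.prod (isCompact_closedBall x r)).exists_bound_of_continuousOn
    (hK'.mono hsub)
  have hI : Set.uIoc (0 : ℝ) 1 ⊆ Set.Icc 0 1 := by
    rw [Set.uIoc_of_le zero_le_one]
    exact Set.Ioc_subset_Icc_self
  refine intervalIntegral.hasFDerivAt_integral_of_dominated_of_fderiv_le
    (F := fun y t => K (t, y))
    (F' := fun y t => (fderiv ℝ K (t, y)).comp (ContinuousLinearMap.inr ℝ ℝ E))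
    (bound := fun _ => b) (s := Metric.closedBall x r) (Metric.closedBall_mem_nhds x hr) ?_ ?_ ?_ ?_
    intervalIntegrable_const ?_
  · filter_upwards [hU.mem_nhds hx] with y hy
    exact (((hK.continuousOn.comp (hcont y) (hslice y hy))).mono hI).aestronglyMeasurable
      measurableSet_uIoc
  · refine ContinuousOn.intervalIntegrable ?_
    rw [Set.uIcc_of_le zero_le_one]
    exact hK.continuousOn.comp (hcont x) (hslice x hx)
  · exact ((hK'.comp (hcont x) (hslice x hx)).mono hI).aestronglyMeasurable measurableSet_uIoc
  · exact Filter.Eventually.of_forall fun t ht y hy => hb (t, y) ⟨hI ht, hy⟩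
  · refine Filter.Eventually.of_forall fun t ht y hy => ?_
    have h1 : HasFDerivAt K (fderiv ℝ K (t, y)) (t, y) :=
      ((hK.contDiffAt (hΩ.mem_nhds (hsub ⟨hI ht, hy⟩))).differentiableAt (by simp)).hasFDerivAt
    exact h1.comp y (hasFDerivAt_prodMk_right t y)

/-- The derivative is an integral of the same kind with values in a space of linear maps. The
induction on the order therefore has to vary the target space. -/
theorem contDiffOn_integral {G : Type} [NormedAddCommGroup G] [NormedSpace ℝ G]
    {K : ℝ × E → G} {Ω : Set (ℝ × E)} (hΩ : IsOpen Ω) {U : Set E} (hU : IsOpen U)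
    (hΩU : ∀ t ∈ Set.Icc (0 : ℝ) 1, ∀ x ∈ U, (t, x) ∈ Ω) (hK : ContDiffOn ℝ ∞ K Ω) :
    ContDiffOn ℝ ∞ (fun y => ∫ t in (0 : ℝ)..1, K (t, y)) U := by
  refine contDiffOn_infty.2 fun n => ?_
  induction n generalizing G with
  | zero =>
    refine contDiffOn_zero.2 fun x hx => ?_
    exact (hasFDerivAt_integral_of_contDiffOn hΩ hU hΩU hK hx).continuousAt.continuousWithinAt
  | succ n ih =>
    push_cast
    rw [contDiffOn_succ_iff_fderiv_of_isOpen hU]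
    refine ⟨fun x hx => (hasFDerivAt_integral_of_contDiffOn hΩ hU hΩU hK
      hx).differentiableAt.differentiableWithinAt, by simp, ?_⟩
    refine (ih (K := fun p => (fderiv ℝ K p).comp (ContinuousLinearMap.inr ℝ ℝ E)) ?_).congr
      fun x hx => (hasFDerivAt_integral_of_contDiffOn hΩ hU hΩU hK hx).fderiv
    exact (hK.fderiv_of_isOpen hΩ (by simp)).clm_comp contDiffOn_const

end Parametric

/-! ### Inversion of the Euler vector field on functions of the body -/

/-- The transversal part of a point. -/
def xiPart (x : C.Pt) : C.Pt := fun j => Sum.elim (fun _ => x j) (fun _ => 0) j.1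

theorem scaleL_eq (t : ℝ) (x : C.Pt) : scaleL t x = scaleXi 0 x + t • xiPart x := by
  rw [scaleL_apply]
  funext ⟨j, hj⟩
  rcases j with j | j <;> simp [scaleXi, xiPart]

theorem xiPart_scaleL (t : ℝ) (x : C.Pt) : xiPart (scaleL t x) = t • xiPart x := by
  rw [scaleL_apply]
  funext ⟨j, hj⟩
  rcases j with j | j <;> simp [scaleXi, xiPart]

theorem scaleL_xiPart (t : ℝ) (x : C.Pt) : scaleL t (xiPart x) = t • xiPart x := by
  rw [scaleL_apply]
  funext ⟨j, hj⟩
  rcases j with j | j <;> simp [scaleXi, xiPart]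

/-- The transversal part, as a continuous linear map. -/
def xiPartL : C.Pt →L[ℝ] C.Pt := ContinuousLinearMap.id ℝ C.Pt - scaleL 0

theorem xiPartL_apply (x : C.Pt) : xiPartL x = xiPart x := by
  simp only [xiPartL, sub_apply, ContinuousLinearMap.id_apply, scaleL_apply]
  funext ⟨j, hj⟩
  rcases j with j | j <;> simp [scaleXi, xiPart]

theorem contDiff_scaleL_uncurry : ContDiff ℝ ∞ fun p : ℝ × C.Pt => scaleL p.1 p.2 := by
  refine contDiff_pi.2 fun j => ?_
  obtain ⟨j, hj⟩ := j
  have h2 : ContDiff ℝ ∞ fun p : ℝ × C.Pt => p.2 ⟨j, hj⟩ :=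
    (contDiff_apply ℝ ℝ _).comp contDiff_snd
  rcases j with j | j
  · simpa [scaleL] using contDiff_fst.mul h2
  · simpa [scaleL] using h2

section Jint

variable {U : Opens C.Pt} {G : Type} [NormedAddCommGroup G] [NormedSpace ℝ G]

/-- The average of `F` along the contraction of the transversal coordinates. -/
def jInt (n : ℕ) (F : C.Pt → G) (x : C.Pt) : G := ∫ t in (0 : ℝ)..1, t ^ n • F (scaleL t x)

theorem isOpen_scaleL_mem (U : Opens C.Pt) : IsOpen {p : ℝ × C.Pt | scaleL p.1 p.2 ∈ U} :=
  U.isOpen.preimage contDiff_scaleL_uncurry.continuous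

theorem XiStar.scaleL_mem [XiStar U] {t : ℝ} (ht : t ∈ Set.Icc (0 : ℝ) 1) {x : C.Pt} (hx : x ∈ U) :
    scaleL t x ∈ U := by
  rw [scaleL_apply]
  exact XiStar.scale_mem x hx t ht

theorem contDiffOn_jInt_integrand (n : ℕ) {F : C.Pt → G} (hF : ContDiffOn ℝ ∞ F U) :
    ContDiffOn ℝ ∞ (fun p : ℝ × C.Pt => p.1 ^ n • F (scaleL p.1 p.2))
      {p : ℝ × C.Pt | scaleL p.1 p.2 ∈ U} :=
  (contDiff_fst.pow n).contDiffOn.smul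
    (hF.comp contDiff_scaleL_uncurry.contDiffOn fun _ hp => hp)

theorem contDiffOn_jInt [XiStar U] (n : ℕ) {F : C.Pt → G} (hF : ContDiffOn ℝ ∞ F U) :
    ContDiffOn ℝ ∞ (jInt n F) U :=
  contDiffOn_integral (isOpen_scaleL_mem U) U.isOpen
    (fun _ ht _ hx => XiStar.scaleL_mem ht hx) (contDiffOn_jInt_integrand n hF)

theorem hasDerivAt_scaleL {F : C.Pt → G} (hF : ContDiffOn ℝ ∞ F U) {t : ℝ} {x : C.Pt}
    (hx : scaleL t x ∈ U) : HasDerivAt (fun s => F (scaleL s x))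
      (fderiv ℝ F (scaleL t x) (xiPart x)) t := by
  have h1 : HasFDerivAt F (fderiv ℝ F (scaleL t x)) (scaleL t x) :=
    ((hF.contDiffAt (U.isOpen.mem_nhds hx)).differentiableAt (by simp)).hasFDerivAt
  have h2 : HasDerivAt (fun s => scaleL s x) (xiPart x) t := by
    simp only [scaleL_eq]
    simpa using ((hasDerivAt_id t).smul_const (xiPart x)).const_add (scaleXi 0 x)
  exact h1.comp_hasDerivAt t h2

theorem continuousOn_fderiv_scaleL [XiStar U] {F : C.Pt → G} (hF : ContDiffOn ℝ ∞ F U) {x : C.Pt}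
    (hx : x ∈ U) : ContinuousOn (fun t => fderiv ℝ F (scaleL t x)) (Set.Icc 0 1) := by
  refine (hF.continuousOn_fderiv_of_isOpen U.isOpen (by simp)).comp ?_
    fun t ht => XiStar.scaleL_mem ht hx
  exact (contDiff_scaleL_uncurry.continuous.comp (by fun_prop : Continuous fun t : ℝ => (t, x))).continuousOn

/-- A primitive of `F` for the Euler vector field in the transversal coordinates. -/
def eulerPrim (F : C.Pt → G) (x : C.Pt) : G := jInt 0 (jInt 0 (fderiv ℝ F)) x (xiPart x)

theorem jInt_eq_zero [XiStar U] (n : ℕ) {F : C.Pt → G} (hF : ∀ x ∈ U, F x = 0) {x : C.Pt}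
    (hx : x ∈ U) : jInt n F x = 0 := by
  rw [jInt, intervalIntegral.integral_congr (g := fun _ => 0)]
  · simp
  · intro t ht
    rw [Set.uIcc_of_le zero_le_one] at ht
    simp [hF _ (XiStar.scaleL_mem ht hx)]

theorem eulerPrim_eq_zero [XiStar U] {F : C.Pt → G} (hF : ∀ x ∈ U, F x = 0) {x : C.Pt}
    (hx : x ∈ U) : eulerPrim F x = 0 := by
  have h1 : ∀ y ∈ U, fderiv ℝ F y = 0 := fun y hy => by
    have : F =ᶠ[𝓝 y] fun _ => 0 := Filter.eventually_of_mem (U.isOpen.mem_nhds hy) hF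
    rw [this.fderiv_eq]
    simp
  rw [eulerPrim, jInt_eq_zero 0 (fun y hy => jInt_eq_zero 0 h1 hy) hx]
  rfl

theorem contDiffOn_eulerPrim [XiStar U] {F : C.Pt → G} (hF : ContDiffOn ℝ ∞ F U) :
    ContDiffOn ℝ ∞ (eulerPrim F) U := by
  have h1 : ContDiff ℝ ∞ (xiPart : C.Pt → C.Pt) := by
    rw [← funext (xiPartL_apply (C := C))]
    exact (xiPartL (C := C)).contDiff
  exact (contDiffOn_jInt 0 (contDiffOn_jInt 0 (hF.fderiv_of_isOpen U.isOpen (by simp)))).clm_apply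
    h1.contDiffOn

/-- The extra power of `t` comes from the chain rule: the contraction multiplies transversal vectors
by `t`. -/
theorem fderiv_jInt_xiPart [XiStar U] (n : ℕ) {F : C.Pt → G} (hF : ContDiffOn ℝ ∞ F U) {x : C.Pt}
    (hx : x ∈ U) : fderiv ℝ (jInt n F) x (xiPart x) =
      ∫ t in (0 : ℝ)..1, t ^ (n + 1) • fderiv ℝ F (scaleL t x) (xiPart x) := by
  have h := hasFDerivAt_integral_of_contDiffOn (isOpen_scaleL_mem U) U.isOpen
    (fun _ ht _ hx => XiStar.scaleL_mem ht hx) (contDiffOn_jInt_integrand n hF) hx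
  have hK := contDiffOn_jInt_integrand n hF
  rw [show jInt n F = fun y => ∫ t in (0 : ℝ)..1, t ^ n • F (scaleL t y) from rfl, h.fderiv,
    ContinuousLinearMap.intervalIntegral_apply]
  · refine intervalIntegral.integral_congr fun t ht => ?_
    rw [Set.uIcc_of_le zero_le_one] at ht
    have hm := XiStar.scaleL_mem ht hx
    have h1 : HasFDerivAt (fun y => t ^ n • F (scaleL t y))
        (t ^ n • (fderiv ℝ F (scaleL t x)).comp (scaleL t)) x :=
      (((hF.contDiffAt (U.isOpen.mem_nhds hm)).differentiableAt
        (by simp)).hasFDerivAt.comp x (scaleL t).hasFDerivAt).const_smul _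
    have h2 := ((hK.contDiffAt ((isOpen_scaleL_mem U).mem_nhds
      (show (t, x) ∈ _ from hm))).differentiableAt (by simp)).hasFDerivAt.comp x
      (hasFDerivAt_prodMk_right t x)
    have h3 := h2.unique h1
    refine (DFunLike.congr_fun h3 (xiPart x)).trans ?_
    simp only [_root_.smul_apply, ContinuousLinearMap.comp_apply, scaleL_xiPart,
      map_smul, smul_smul, pow_succ]
  · refine ContinuousOn.intervalIntegrable ?_
    rw [Set.uIcc_of_le zero_le_one]
    refine ((hK.continuousOn_fderiv_of_isOpen (isOpen_scaleL_mem U) (by simp)).comp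
      (by fun_prop : Continuous fun t : ℝ => (t, x)).continuousOn
      fun t ht => XiStar.scaleL_mem ht hx).clm_comp continuousOn_const

variable [CompleteSpace G]

/-- The two integrands add up to the derivative of `t ^ (n + 1) • F (scaleL t x)`, which is `F x` at
`t = 1` and zero at `t = 0`. Thus `jInt n` inverts `n + 1` plus the Euler field of the body. -/
theorem jInt_euler [XiStar U] (n : ℕ) {F : C.Pt → G} (hF : ContDiffOn ℝ ∞ F U) {x : C.Pt}
    (hx : x ∈ U) : ((n + 1 : ℕ) : ℝ) • jInt n F x + fderiv ℝ (jInt n F) x (xiPart x) = F x := by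
  have hFc : ContinuousOn (fun t => F (scaleL t x)) (Set.Icc 0 1) :=
    hF.continuousOn.comp (contDiff_scaleL_uncurry.continuous.comp
      (by fun_prop : Continuous fun t : ℝ => (t, x))).continuousOn
      fun t ht => XiStar.scaleL_mem ht hx
  have hF' : ContinuousOn (fun t => fderiv ℝ F (scaleL t x) (xiPart x)) (Set.Icc 0 1) :=
    (continuousOn_fderiv_scaleL hF hx).clm_apply continuousOn_const
  have hi1 : IntervalIntegrable (fun t : ℝ => t ^ n • F (scaleL t x)) MeasureTheory.volume 0 1 := by
    refine ContinuousOn.intervalIntegrable ?_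
    rw [Set.uIcc_of_le zero_le_one]
    exact (continuousOn_pow n).smul hFc
  have hi2 : IntervalIntegrable (fun t : ℝ => t ^ (n + 1) • fderiv ℝ F (scaleL t x) (xiPart x))
      MeasureTheory.volume 0 1 := by
    refine ContinuousOn.intervalIntegrable ?_
    rw [Set.uIcc_of_le zero_le_one]
    exact (continuousOn_pow (n + 1)).smul hF'
  have hi3 : IntervalIntegrable (fun t : ℝ => ((n + 1 : ℕ) : ℝ) • t ^ n • F (scaleL t x))
      MeasureTheory.volume 0 1 := hi1.smul _
  rw [fderiv_jInt_xiPart n hF hx, jInt, ← intervalIntegral.integral_smul,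
    ← intervalIntegral.integral_add hi3 hi2]
  rw [intervalIntegral.integral_eq_sub_of_hasDerivAt (f := fun t => t ^ (n + 1) • F (scaleL t x))]
  · simp [scaleL_apply, scaleXi_one]
  · intro t ht
    rw [Set.uIcc_of_le zero_le_one] at ht
    have h1 := (hasDerivAt_pow (n + 1) t).smul (hasDerivAt_scaleL hF (XiStar.scaleL_mem ht hx))
    refine h1.congr_deriv ?_
    rw [add_comm, smul_smul]
    simp
  · exact hi3.add hi2

theorem jInt_fderiv_xiPart [XiStar U] {F : C.Pt → G} (hF : ContDiffOn ℝ ∞ F U) {x : C.Pt}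
    (hx : x ∈ U) : jInt 0 (fderiv ℝ F) x (xiPart x) = F x - F (scaleXi 0 x) := by
  have hF' := continuousOn_fderiv_scaleL hF hx
  rw [jInt, ContinuousLinearMap.intervalIntegral_apply]
  · simp only [pow_zero, one_smul]
    rw [intervalIntegral.integral_eq_sub_of_hasDerivAt (f := fun t => F (scaleL t x))]
    · simp [scaleL_apply, scaleXi_one]
    · intro t ht
      rw [Set.uIcc_of_le zero_le_one] at ht
      exact hasDerivAt_scaleL hF (XiStar.scaleL_mem ht hx)
    · refine ContinuousOn.intervalIntegrable ?_
      rw [Set.uIcc_of_le zero_le_one]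
      exact hF'.clm_apply continuousOn_const
  · refine ContinuousOn.intervalIntegrable ?_
    rw [Set.uIcc_of_le zero_le_one]
    simpa using hF'

/-- The obvious primitive has the integrand `(F (tξ) - F 0) / t`. Hadamard's lemma removes the
division: `F - F(ξ = 0)` is `jInt 0 (fderiv ℝ F)` paired with `ξ`. Since the Euler field also acts
on the paired `ξ`, the linear-map-valued factor has to be inverted for `1` plus that field, and this
is a second `jInt 0`. -/
theorem eulerPrim_euler [XiStar U] {F : C.Pt → G} (hF : ContDiffOn ℝ ∞ F U) {x : C.Pt}
    (hx : x ∈ U) : fderiv ℝ (eulerPrim F) x (xiPart x) = F x - F (scaleXi 0 x) := by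
  have hF' : ContDiffOn ℝ ∞ (fderiv ℝ F) U := hF.fderiv_of_isOpen U.isOpen (by simp)
  have hJ := contDiffOn_jInt 0 hF'
  have hJJ := contDiffOn_jInt 0 hJ
  have h1 : HasFDerivAt (xiPart : C.Pt → C.Pt) xiPartL x := by
    have := (xiPartL (C := C)).hasFDerivAt (x := x)
    exact this.congr_of_eventuallyEq (Filter.Eventually.of_forall fun y => (xiPartL_apply y).symm)
  have h2 := ((hJJ.contDiffAt (U.isOpen.mem_nhds hx)).differentiableAt (by simp)).hasFDerivAt
  have h3 : HasFDerivAt (eulerPrim F) _ x := h2.clm_apply h1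
  rw [h3.fderiv, ← jInt_fderiv_xiPart hF hx, ← jInt_euler 0 hJ hx]
  have h4 : xiPart (xiPart x) = xiPart x := by
    funext ⟨j, hj⟩
    rcases j with j | j <;> simp [xiPart]
  simp [xiPartL_apply, h4]

end Jint

/-- The function `t ^ c * F (scaleL t x)` has zero derivative on `(0, 1)`, so by the mean value
theorem its values at `0` and `1` agree. At `0` it vanishes because of the power, or for `c = 0` by
the assumption on the locus `ξ = 0`. -/
theorem eq_zero_of_euler_eq_zero {U : Opens C.Pt} [XiStar U] {F : C.Pt → ℝ}
    (hF : ContDiffOn ℝ ∞ F U) (c : ℕ) (h : ∀ x ∈ U, c * F x + fderiv ℝ F x (xiPart x) = 0)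
    (h0 : c = 0 → ∀ x ∈ U, F (scaleXi 0 x) = 0) {x : C.Pt} (hx : x ∈ U) : F x = 0 := by
  have hd : ∀ t ∈ Set.Icc (0 : ℝ) 1, HasDerivAt (fun s => s ^ c * F (scaleL s x))
      (c * t ^ (c - 1) * F (scaleL t x) + t ^ c * fderiv ℝ F (scaleL t x) (xiPart x)) t :=
    fun t ht => (hasDerivAt_pow c t).mul (hasDerivAt_scaleL hF (XiStar.scaleL_mem ht hx))
  obtain ⟨t, ht, hs⟩ := exists_hasDerivAt_eq_slope _ _ zero_lt_one
    (fun t ht => (hd t ht).continuousAt.continuousWithinAt)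
    (fun t ht => hd t (Set.Ioo_subset_Icc_self ht))
  have h1 := h _ (XiStar.scaleL_mem (Set.Ioo_subset_Icc_self ht) hx)
  rw [xiPart_scaleL, map_smul, smul_eq_mul] at h1
  have ht0 : t ≠ 0 := ht.1.ne'
  have h2 : c * t ^ (c - 1) * F (scaleL t x) + t ^ c * fderiv ℝ F (scaleL t x) (xiPart x) = 0 := by
    rcases c with _ | c
    · simp at h1 ⊢
      exact h1.resolve_left ht0
    · simp only [Nat.add_sub_cancel]
      rw [pow_succ]
      linear_combination t ^ c * h1
  rw [h2] at hs
  have h3 : (0 : ℝ) ^ c * F (scaleL 0 x) = 0 := by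
    rcases c with _ | c
    · rw [scaleL_apply, h0 rfl x hx, mul_zero]
    · simp
  simp only [h3] at hs
  simpa [scaleL_apply, scaleXi_one] using hs.symm

/-! ### The Euler vector field in the transversal fields and antifields -/

/-- A coordinate, as a variable. -/
def gcoord (j : C.Coord) : GV C :=
  if h : C.εbar j = 0 then Sum.inl ⟨j, h⟩ else Sum.inr (Var.field ⟨j, h⟩)

theorem gpar_gcoord (j : C.Coord) : gpar (gcoord j) = C.εbar j := by
  unfold gcoord
  split_ifs with h
  · simp [h]
  · rfl

theorem gcoord_injective : Function.Injective (gcoord (C := C)) := by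
  intro i j h
  unfold gcoord at h
  split_ifs at h <;> simpa using h

theorem gsafn_gcoord_inl (I : Fin C.numXi) : gsafn (gcoord (C := C) (Sum.inl I)) = 1 := by
  unfold gcoord
  split_ifs <;> rfl

theorem gsafn_gcoord_inr (A : Fin C.numTheta) : gsafn (gcoord (C := C) (Sum.inr A)) = 0 := by
  unfold gcoord
  split_ifs <;> rfl

/-- Indices of the transversal fields and of the antifields. -/
abbrev YI (C : FieldContent) : Type := Fin C.numXi ⊕ Σ k : Fin (C.L + 2), Fin (C.m k)

/-- The transversal fields and the antifields. -/
def ev : YI C → GV C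
  | Sum.inl I => gcoord (Sum.inl I)
  | Sum.inr ⟨k, α⟩ => Sum.inr (Var.anti k α)

theorem ev_injective : Function.Injective (ev (C := C)) := by
  rintro (I | ⟨k, α⟩) (J | ⟨l, β⟩) h
  · simpa using gcoord_injective h
  · replace h : gcoord (Sum.inl I) = Sum.inr (Var.anti l β) := h
    unfold gcoord at h
    split_ifs at h; all_goals simp at h
  · replace h : Sum.inr (Var.anti k α) = gcoord (Sum.inl J) := h
    unfold gcoord at h
    split_ifs at h; all_goals simp at h
  · simp only [ev, Sum.inr.injEq, Var.anti.injEq] at h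
    obtain ⟨h1, h2⟩ := h
    obtain rfl := Fin.ext h1
    rw [eq_of_heq h2]

theorem gsafn_ev (y : YI C) : gsafn (ev y) ≠ 0 := by
  rcases y with I | ⟨k, α⟩
  · rw [ev, gsafn_gcoord_inl]
    exact one_ne_zero
  · exact Nat.succ_ne_zero _

/-- The number of odd transversal fields and antifields in a monomial. -/
def xiCount (μ : C.Mono) : ℕ := ∑ y : YI C, Sum.elim (fun _ => 0) (fun v => μ v) (ev y)

theorem xiCount_eq_zero {μ : C.Mono} : xiCount μ = 0 ↔ monoSafn μ = 0 := by
  rw [xiCount, Finset.sum_eq_zero_iff, monoSafn_eq_zero]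
  constructor
  · intro h v hv
    by_contra hs
    obtain ⟨y, hy⟩ : ∃ y : YI C, ev y = Sum.inr v := by
      rcases v with ⟨⟨i | i, hi⟩⟩ | ⟨s, α⟩ | ⟨k, α⟩
      · exact ⟨Sum.inl i, by simp only [ev, gcoord]; rw [dif_neg hi]⟩
      · exact absurd rfl hs
      · exact absurd rfl hs
      -- An antifield beyond the last stage cannot occur, its index type being empty.
      · have hk : k < C.L + 2 := by
          by_contra hk
          have := C.m_eq_zero k (by omega)
          exact absurd α.2 (by omega)
        exact ⟨Sum.inr ⟨⟨k, hk⟩, α⟩, rfl⟩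
    have := h y (Finset.mem_univ _)
    rw [hy] at this
    exact hv this
  · intro h y _
    have hy := gsafn_ev y
    rcases hv : ev y with j | v
    · rfl
    · rw [hv] at hy
      by_contra h'
      exact hy (h v h')

theorem sum_single_xi (L : C.Pt →L[ℝ] ℝ) (x : C.Pt) : ∑ I : Fin C.numXi,
    (if h : C.εbar (Sum.inl I) = 0 then x ⟨Sum.inl I, h⟩ * L (Pi.single ⟨Sum.inl I, h⟩ 1) else 0) =
    L (xiPart x) := by
  have h1 : xiPart x = ∑ I : Fin C.numXi,
      (if h : C.εbar (Sum.inl I) = 0 then x ⟨Sum.inl I, h⟩ • Pi.single ⟨Sum.inl I, h⟩ (1 : ℝ)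
        else (0 : C.Pt)) := by
    funext ⟨j, hj⟩
    rw [Finset.sum_apply]
    rcases j with j | j
    · rw [Finset.sum_eq_single j]
      · simp [hj, xiPart]
      · intro I _ hI
        split_ifs <;> simp [Ne.symm hI]
      · simp
    · refine (Finset.sum_eq_zero fun I _ => ?_).symm
      split_ifs <;> simp
  rw [h1, map_sum]
  refine Finset.sum_congr rfl fun I _ => ?_
  split_ifs <;> simp

namespace SA

variable {U : Opens C.Pt}

/-- This reduces the Euler field to ordinary smooth functions, one coefficient at a time. -/
theorem euler_apply (f : SA U) (μ : C.Mono) {x : C.Pt} (hx : x ∈ U) :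
    vf ev 1 f μ x = xiCount μ * f μ x + fderiv ℝ (f μ) x (xiPart x) := by
  have h1 : ∀ I : Fin C.numXi, (z (gcoord (Sum.inl I)) * pd (gcoord (Sum.inl I)) f : SA U) μ x =
      ((Sum.elim (fun _ => 0) (fun v => μ v) (gcoord (C := C) (Sum.inl I)) : ℕ) : ℝ) * f μ x +
      (if h : C.εbar (Sum.inl I) = 0 then x ⟨Sum.inl I, h⟩ *
        fderiv ℝ (f μ) x (Pi.single ⟨Sum.inl I, h⟩ 1) else 0) := fun I => by
    unfold gcoord
    split_ifs with h
    · rw [z_mul_pd_inl _ _ _ hx]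
      simp
    · rw [z_mul_pd_inr _ _ _ hx]
      simp
  rw [vf_one, sum_apply, xiCount, Fintype.sum_sum_type, Fintype.sum_sum_type]
  simp only [ev, h1, z_mul_pd_inr _ _ _ hx, Finset.sum_add_distrib, sum_single_xi]
  push_cast
  simp only [Sum.elim_inr, ← Finset.sum_mul]
  ring

section EulerInv

variable [XiStar U]

open Classical in
/-- The inverse of the Euler vector field. -/
def eulerInv (f : SA U) : SA U :=
  mk (fun μ x => if x ∈ U then
      (if xiCount μ = 0 then eulerPrim (f μ) x else jInt (xiCount μ - 1) (f μ) x) else 0)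
    ⟨fun μ => by
      by_cases h : xiCount μ = 0
      · exact (contDiffOn_eulerPrim (f.smooth μ)).congr fun x hx => by
          simp only [h, if_true]
          exact if_pos hx
      · exact (contDiffOn_jInt _ (f.smooth μ)).congr fun x hx => by
          simp only [h, if_false]
          exact if_pos hx,
    fun μ x h => by
      by_cases hx : x ∈ U
      · have hf : ∀ y ∈ U, f μ y = 0 := fun y _ =>
          f.eq_zero_of_not_legal (h.resolve_right (not_not.2 hx)) y
        simp only [if_pos hx, eulerPrim_eq_zero hf hx, jInt_eq_zero _ hf hx, ite_self]
      · simp only [if_neg hx]⟩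

theorem eulerInv_apply (f : SA U) (μ : C.Mono) {x : C.Pt} (hx : x ∈ U) : eulerInv f μ x =
    if xiCount μ = 0 then eulerPrim (f μ) x else jInt (xiCount μ - 1) (f μ) x := by
  classical
  exact if_pos hx

/-- Where `n = xiCount μ` is positive, `n` plus the Euler field of the body is inverted by `jInt (n
- 1)` without any condition. Where it is zero, `eulerPrim` recovers the coefficient up to its value
at `ξ = 0`, which is zero because of `rho f = 0`. -/
theorem euler_eulerInv {f : SA U} (hf : rho f = 0) : vf ev 1 (eulerInv f) = f := by
  refine ext fun μ _ x hx => ?_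
  rw [euler_apply _ _ hx]
  have hsm := f.smooth μ
  by_cases h : xiCount μ = 0
  · have h1 : eulerInv f μ =ᶠ[𝓝 x] eulerPrim (f μ) :=
      Filter.eventually_of_mem (U.isOpen.mem_nhds hx) fun y hy => by
        rw [eulerInv_apply _ _ hy, if_pos h]
    rw [h1.fderiv_eq, eulerPrim_euler hsm hx, h]
    have h2 := rho_apply f μ hx
    rw [hf, zero_apply, if_pos (xiCount_eq_zero.1 h)] at h2
    rw [← h2]
    simp
  · have h1 : eulerInv f μ =ᶠ[𝓝 x] jInt (xiCount μ - 1) (f μ) :=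
      Filter.eventually_of_mem (U.isOpen.mem_nhds hx) fun y hy => by
        rw [eulerInv_apply _ _ hy, if_neg h]
    rw [h1.fderiv_eq, h1.eq_of_nhds, ← jInt_euler (xiCount μ - 1) hsm hx,
      Nat.sub_add_cancel (Nat.one_le_iff_ne_zero.2 h), smul_eq_mul]

theorem eq_zero_of_euler {f : SA U} (hf : rho f = 0) (h : vf ev 1 f = 0) : f = 0 :=
  ext fun μ _ x hx => by
    refine eq_zero_of_euler_eq_zero (f.smooth μ) (xiCount μ) (fun y hy => ?_) (fun h0 y hy => ?_) hx
    · rw [← euler_apply _ _ hy, h, zero_apply]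
    · have h2 := rho_apply f μ hy
      rwa [hf, zero_apply, if_pos (xiCount_eq_zero.1 h0), eq_comm] at h2

end EulerInv

/-! ### Polynomials -/

/-- `f` has finitely many coefficients. -/
def FinSupp (f : SA U) : Prop := {μ | ∃ x, f μ x ≠ 0}.Finite

theorem FinSupp.of_subset {f : SA U} {s : Set C.Mono} (hs : s.Finite)
    (h : ∀ μ x, f μ x ≠ 0 → μ ∈ s) : FinSupp f :=
  hs.subset fun μ ⟨x, hx⟩ => h μ x hx

theorem FinSupp.add {f g : SA U} (hf : FinSupp f) (hg : FinSupp g) : FinSupp (f + g) :=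
  FinSupp.of_subset (hf.union hg) fun μ x h => by
    by_contra h'
    simp only [Set.mem_union, Set.mem_ofPred_eq, not_or, not_exists, not_not] at h'
    exact h (by rw [add_apply, h'.1, h'.2, add_zero])

theorem finSupp_zero : FinSupp (0 : SA U) :=
  FinSupp.of_subset Set.finite_empty fun _ _ h => absurd rfl h

theorem FinSupp.sum {ι : Type*} {s : Finset ι} {f : ι → SA U} (h : ∀ i ∈ s, FinSupp (f i)) :
    FinSupp (∑ i ∈ s, f i) :=
  Finset.sum_induction f FinSupp (fun _ _ => FinSupp.add) finSupp_zero h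

theorem FinSupp.mul {f g : SA U} (hf : FinSupp f) (hg : FinSupp g) : FinSupp (f * g) := by
  classical
  refine FinSupp.of_subset (Set.Finite.image2 (· + ·) hf hg) fun μ x h => ?_
  by_cases hμ : Legal μ
  · rw [mul_apply _ _ hμ] at h
    obtain ⟨q, hq, hne⟩ := Finset.exists_ne_zero_of_sum_ne_zero h
    rw [Finset.HasAntidiagonal.mem_antidiagonal] at hq
    have h3 := right_ne_zero_of_mul hne
    exact ⟨q.1, ⟨x, left_ne_zero_of_mul h3⟩, q.2, ⟨x, right_ne_zero_of_mul h3⟩, hq⟩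
  · exact absurd (eq_zero_of_not_legal _ hμ _) h

theorem FinSupp.pd {f : SA U} (hf : FinSupp f) (g : GV C) : FinSupp (SA.pd g f) := by
  rcases g with j | v
  · refine FinSupp.of_subset hf fun μ x h => ?_
    by_contra h'
    simp only [Set.mem_ofPred_eq, not_exists, not_not] at h'
    by_cases hx : x ∈ U
    · rw [pd_inl_apply _ _ _ hx, show f μ = 0 from funext h'] at h
      simp at h
    · exact h (eq_zero_of_notMem _ _ hx)
  · refine FinSupp.of_subset (hf.preimage (f := fun μ => μ + Finsupp.single v 1)
      ((add_left_injective _).injOn)) fun μ x h => ?_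
    rw [pd_inr_apply] at h
    exact ⟨x, right_ne_zero_of_mul (right_ne_zero_of_mul h)⟩

theorem finSupp_monom (ν : C.Mono) (hν : Legal ν) (a : C.Pt → ℝ) (ha : ContDiffOn ℝ ∞ a U) :
    FinSupp (monom ν hν a ha) := by
  classical
  refine FinSupp.of_subset (Set.finite_singleton ν) fun μ x h => ?_
  by_cases hx : x ∈ U
  · rw [monom_apply _ _ _ _ _ hx] at h
    by_contra h'
    exact h (if_neg h')
  · exact absurd (eq_zero_of_notMem _ _ hx) h

theorem finSupp_z (g : GV C) : FinSupp (z g : SA U) := by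
  rcases g with j | v
  · exact finSupp_monom 0 legal_zero (fun x => x j) (contDiff_apply ℝ ℝ j).contDiffOn
  · exact finSupp_monom _ (legal_single v) (fun _ => 1) contDiffOn_const

theorem FinSupp.eulerInv [XiStar U] {f : SA U} (hf : FinSupp f) : FinSupp (SA.eulerInv f) :=
  FinSupp.of_subset hf fun μ x h => by
    by_contra h'
    simp only [Set.mem_ofPred_eq, not_exists, not_not] at h'
    by_cases hx : x ∈ U
    · rw [eulerInv_apply _ _ hx, eulerPrim_eq_zero (fun y _ => h' y) hx,
        jInt_eq_zero _ (fun y _ => h' y) hx, ite_self] at h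
      exact h rfl
    · exact h (eq_zero_of_notMem _ _ hx)

/-- The coordinates among the formal variables are all odd, so each occurs at most once. Functions
of the fields are thus automatically polynomial, and those without body are nilpotent. -/
theorem finite_legal_field : {μ : C.Mono | Legal μ ∧ ∀ v, μ v ≠ 0 → v.IsField}.Finite := by
  let F : C.Mono → ({j : C.Coord // C.εbar j ≠ 0} → Fin 2) := fun μ j => Fin.ofNat 2 (μ (Var.field j))
  refine Set.Finite.of_injOn (f := F) (t := Set.univ) (fun _ _ => Set.mem_univ _) ?_ Set.finite_univ
  rintro μ ⟨hμ, hμ'⟩ ν ⟨hν, hν'⟩ h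
  ext v
  rcases v with j | ⟨s, α⟩ | ⟨k, α⟩
  · have h1 := congrFun h j
    have h2 := hμ (Var.field j) j.2
    have h3 := hν (Var.field j) j.2
    simp only [F, Fin.ext_iff, Fin.val_ofNat] at h1
    omega
  · rw [show μ (Var.ghost s α) = 0 from by_contra fun h' => hμ' _ h',
      show ν (Var.ghost s α) = 0 from by_contra fun h' => hν' _ h']
  · rw [show μ (Var.anti k α) = 0 from by_contra fun h' => hμ' _ h',
      show ν (Var.anti k α) = 0 from by_contra fun h' => hν' _ h']

theorem finSupp_of_mem_varSub {P : C.Var → Prop} (hP : ∀ v, P v → v.IsField) {f : SA U}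
    (hf : f ∈ varSub U P) : FinSupp f :=
  FinSupp.of_subset finite_legal_field fun μ x h =>
    ⟨by_contra fun h' => h (f.eq_zero_of_not_legal h' x), fun v hv => hP v (hf μ x h v hv)⟩

theorem FinSupp.vf {ι : Type*} [Fintype ι] {e : ι → GV C} {M : Matrix ι ι (SA U)} [XiStar U]
    (hM : ∀ v w, M v w ∈ thetaSub U) {f : SA U} (hf : FinSupp f) : FinSupp (SA.vf e M f) :=
  FinSupp.sum fun v _ => FinSupp.sum fun w _ => ((finSupp_z _).mul
    (finSupp_of_mem_varSub (fun _ h => h.1) (hM v w).1)).mul (hf.pd _)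

/-! ### Acyclicity from a contracting homotopy of the generators -/

theorem vf_vf_eq_zero [XiStar U] {D : Matrix (YI C) (YI C) (SA U)} (hD : OddMat ev D)
    (hD' : ∀ v w, D v w ∈ thetaSub U) (hDD : D * D = 0) (f : SA U) :
    vf ev D (vf ev D f) = 0 := by
  have hc : ∀ a v w, pd (ev a) (D v w) = 0 := fun a v w =>
    pd_eq_zero_of_mem_thetaSub (hD' v w) (gsafn_ev a)
  have h := vf_vf_add_vf_vf ev_injective hD hD hc hc f
  rw [hDD, add_zero, vf_zero, ← two_smul ℝ] at h
  exact (smul_eq_zero.1 h).resolve_left two_ne_zero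

/-- The standard homotopy argument with the Euler field in place of the identity: its inverse is
applied first, and the result is again closed. -/
theorem exists_vf_eq [XiStar U] {D σ : Matrix (YI C) (YI C) (SA U)} (hD : OddMat ev D)
    (hσ : OddMat ev σ) (hD' : ∀ v w, D v w ∈ thetaSub U) (hσ' : ∀ v w, σ v w ∈ thetaSub U)
    (hDD : D * D = 0) (hDσ : D * σ + σ * D = 1) {f : SA U} (hf : vf ev D f = 0)
    (hρ : rho f = 0) : ∃ g, (FinSupp f → FinSupp g) ∧ f = vf ev D g := by
  have hc : ∀ {M : Matrix (YI C) (YI C) (SA U)}, (∀ v w, M v w ∈ thetaSub U) →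
      ∀ a v w, pd (ev a) (M v w) = 0 := fun hM a v w =>
    pd_eq_zero_of_mem_thetaSub (hM v w) (gsafn_ev a)
  have hN : ∀ k : SA U, vf ev D (vf ev σ k) + vf ev σ (vf ev D k) = vf ev 1 k := fun k => by
    rw [vf_vf_add_vf_vf ev_injective hD hσ (hc hD') (hc hσ'), hDσ]
  have hDD' := vf_vf_eq_zero hD hD' hDD
  have h1 := euler_eulerInv hρ
  -- The operator of `D` commutes with the Euler field. Hence the Euler field sends this function to
  -- that operator applied to `f`, which is zero; its restriction to `y = 0` is zero too, so
  -- injectivity applies.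
  have h2 : vf ev D (eulerInv f) = 0 := by
    refine eq_zero_of_euler (rho_vf gsafn_ev _ _) ?_
    rw [← hN, hDD', vf_apply_zero, add_zero]
    have h3 := hN (eulerInv f)
    rw [h1] at h3
    have h4 : vf ev D (vf ev D (vf ev σ (eulerInv f))) +
        vf ev D (vf ev σ (vf ev D (eulerInv f))) = vf ev D f := by
      rw [← vf_apply_add, h3]
    rwa [hDD', zero_add, hf] at h4
  refine ⟨vf ev σ (eulerInv f), fun h => FinSupp.vf hσ' h.eulerInv, ?_⟩
  have h3 := hN (eulerInv f)
  rw [h1, h2, vf_apply_zero, add_zero] at h3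
  exact h3.symm

end SA

/-! ### Linear algebra over the reals -/

section LinearAlgebra

/-- Let `s` be a linear section of `D` over its range. Then `v - s (D v)` is a cycle, hence lies in
the range, and `σ v` is `s` applied to it. -/
theorem exists_contraction {ι : Type*} [Fintype ι] [DecidableEq ι] (D : Matrix ι ι ℝ)
    (hDD : D * D = 0) (hex : ∀ v, D.mulVec v = 0 → ∃ w, D.mulVec w = v) :
    ∃ σ : Matrix ι ι ℝ, D * σ + σ * D = 1 := by
  let f := Matrix.toLin' D
  have hff : ∀ v, f (f v) = 0 := fun v => by
    simp only [f, Matrix.toLin'_apply, Matrix.mulVec_mulVec, hDD, Matrix.zero_mulVec]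
  obtain ⟨s, hs⟩ := f.rangeRestrict.exists_rightInverse_of_surjective f.range_rangeRestrict
  have hs' : ∀ y, f (s y) = y := fun y => congrArg Subtype.val (LinearMap.congr_fun hs y)
  let q : (ι → ℝ) →ₗ[ℝ] LinearMap.range f :=
    (LinearMap.id - s ∘ₗ f.rangeRestrict).codRestrict (LinearMap.range f) fun v => by
      refine hex _ ?_
      have : f (v - s (f.rangeRestrict v)) = 0 := by
        rw [map_sub, hs']
        simp
      exact this
  have hq : ∀ v, (q v : ι → ℝ) = v - s (f.rangeRestrict v) := fun v => rfl
  refine ⟨LinearMap.toMatrix' (s ∘ₗ q), ?_⟩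
  apply Matrix.toLin'.injective
  refine LinearMap.ext fun v => ?_
  rw [map_add, Matrix.toLin'_mul, Matrix.toLin'_mul, Matrix.toLin'_toMatrix', Matrix.toLin'_one]
  change f (s (q v)) + s (q (f v)) = v
  have h2 : q (f v) = f.rangeRestrict v := by
    apply Subtype.ext
    rw [hq]
    have : f.rangeRestrict (f v) = 0 := Subtype.ext (hff v)
    rw [this, map_zero, sub_zero]
    rfl
  rw [hs', h2, hq]
  abel

/-- The range of `B` lies in the kernel of `A`, and by rank-nullity both have the same dimension. -/
theorem exists_mulVec_eq_of_rank {l m n : Type*} [Fintype l] [Fintype m] [Fintype n]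
    [DecidableEq m] [DecidableEq n] (A : Matrix l m ℝ) (B : Matrix m n ℝ) (hAB : A * B = 0)
    (hr : A.rank + B.rank = Fintype.card m) (v : m → ℝ) (hv : A.mulVec v = 0) :
    ∃ w, B.mulVec w = v := by
  have hle : LinearMap.range B.mulVecLin ≤ LinearMap.ker A.mulVecLin := by
    rintro _ ⟨w, rfl⟩
    simp [hAB]
  have h1 := LinearMap.finrank_range_add_finrank_ker A.mulVecLin
  rw [Module.finrank_fintype_fun_eq_card] at h1
  have h2 : LinearMap.range B.mulVecLin = LinearMap.ker A.mulVecLin := by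
    refine Submodule.eq_of_le_of_finrank_eq hle ?_
    unfold Matrix.rank at hr
    omega
  have h3 : v ∈ LinearMap.range B.mulVecLin := by
    rw [h2]
    simpa using hv
  exact h3

theorem exists_mulVec_eq_of_rank_eq {l m : Type*} [Fintype l] [Fintype m]
    (A : Matrix l m ℝ) (hr : A.rank = Fintype.card l) (v : l → ℝ) : ∃ w, A.mulVec w = v := by
  have h : LinearMap.range A.mulVecLin = ⊤ := by
    apply Submodule.eq_top_of_finrank_eq
    rw [Module.finrank_fintype_fun_eq_card]
    exact hr
  have h3 : v ∈ LinearMap.range A.mulVecLin := by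
    rw [h]
    trivial
  exact h3

theorem contDiffOn_det {E n : Type*} [NormedAddCommGroup E] [NormedSpace ℝ E] [Fintype n]
    [DecidableEq n] {A : E → Matrix n n ℝ} {s : Set E}
    (hA : ∀ i j, ContDiffOn ℝ ∞ (fun x => A x i j) s) : ContDiffOn ℝ ∞ (fun x => (A x).det) s := by
  simp only [Matrix.det_apply]
  exact ContDiffOn.sum fun σ _ => (contDiffOn_prod fun i _ => hA _ _).const_smul _

/-- Cramer's rule: the entries of the inverse are quotients of determinants. -/
theorem contDiffOn_inv {E n : Type*} [NormedAddCommGroup E] [NormedSpace ℝ E] [Fintype n]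
    [DecidableEq n] {A : E → Matrix n n ℝ} {s : Set E}
    (hA : ∀ i j, ContDiffOn ℝ ∞ (fun x => A x i j) s) (hdet : ∀ x ∈ s, (A x).det ≠ 0) (i j : n) :
    ContDiffOn ℝ ∞ (fun x => (A x)⁻¹ i j) s := by
  have h : ∀ x, (A x)⁻¹ i j = (A x).det⁻¹ * ((A x).updateRow j (Pi.single i 1)).det := fun x => by
    rw [Matrix.inv_def, Matrix.smul_apply, Ring.inverse_eq_inv', Matrix.adjugate_apply, smul_eq_mul]
  simp only [h]
  refine ((contDiffOn_det hA).inv hdet).mul (contDiffOn_det fun k l => ?_)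
  by_cases hk : k = j
  · subst hk
    simp only [Matrix.updateRow_self]
    exact contDiffOn_const
  · simp only [Matrix.updateRow_ne hk]
    exact hA k l

end LinearAlgebra

/-! ### The matrix of the Koszul-Tate operator -/

section Block

variable {R : Type*}

open Classical in
/-- The matrix on transversal fields and antifields with blocks `h` and `Z`. -/
def blk [AddCommMonoid R] (h : Fin C.numXi → Fin (C.m 0) → R)
    (Z : (k : ℕ) → Fin (C.m k) → Fin (C.m (k + 1)) → R) : Matrix (YI C) (YI C) R := fun v w =>
  match w with
  | Sum.inl _ => 0
  | Sum.inr ⟨⟨0, _⟩, i⟩ => Sum.elim (fun I => h I i) (fun _ => 0) v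
  | Sum.inr ⟨⟨k + 1, hk⟩, β⟩ =>
    ∑ α, if v = Sum.inr ⟨⟨k, Nat.lt_of_succ_lt hk⟩, α⟩ then Z k α β else 0

section

variable [AddCommMonoid R] (h : Fin C.numXi → Fin (C.m 0) → R)
    (Z : (k : ℕ) → Fin (C.m k) → Fin (C.m (k + 1)) → R)

theorem blk_inl (v : YI C) (I : Fin C.numXi) : blk h Z v (Sum.inl I) = 0 := rfl

theorem blk_zero (v : YI C) (i : Fin (C.m 0)) :
    blk h Z v (Sum.inr ⟨0, i⟩) = Sum.elim (fun I => h I i) (fun _ => 0) v := rfl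

open Classical in
theorem blk_succ (v : YI C) (k : Fin (C.L + 1)) (β : Fin (C.m (k + 1))) :
    blk h Z v (Sum.inr ⟨k.succ, β⟩) =
      ∑ α : Fin (C.m k), if v = Sum.inr ⟨k.castSucc, α⟩ then Z k α β else 0 := rfl

theorem map_blk {S : Type*} [AddCommMonoid S] (φ : R →+ S) (v w : YI C) :
    φ (blk h Z v w) = blk (fun I i => φ (h I i)) (fun k α β => φ (Z k α β)) v w := by
  classical
  rcases w with I | ⟨k, β⟩
  · simp [blk_inl]
  · induction k using Fin.cases with
    | zero =>
      erw [blk_zero, blk_zero]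
      rcases v with I | _ <;> simp
    | succ k =>
      erw [blk_succ, blk_succ]
      rw [map_sum]
      refine Finset.sum_congr rfl fun α _ => ?_
      split_ifs <;> simp

theorem blk_induction {P : YI C → YI C → R → Prop} (h0 : ∀ v w, P v w 0)
    (hadd : ∀ v w a b, P v w a → P v w b → P v w (a + b))
    (hh : ∀ I i, P (Sum.inl I) (Sum.inr ⟨0, i⟩) (h I i))
    (hZ : ∀ (k : Fin (C.L + 1)) α β,
      P (Sum.inr ⟨k.castSucc, α⟩) (Sum.inr ⟨k.succ, β⟩) (Z k α β)) (v w : YI C) :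
    P v w (blk h Z v w) := by
  classical
  rcases w with I | ⟨k, β⟩
  · exact h0 _ _
  · induction k using Fin.cases with
    | zero =>
      rcases v with I | _
      · exact hh I β
      · exact h0 _ _
    | succ k =>
      erw [blk_succ]
      refine Finset.sum_induction _ (P v _) (hadd _ _) (h0 _ _) fun α _ => ?_
      split_ifs with hv
      · subst hv
        exact hZ k α β
      · exact h0 _ _

end

section

variable [NonUnitalNonAssocSemiring R] (h : Fin C.numXi → Fin (C.m 0) → R)
    (Z : (k : ℕ) → Fin (C.m k) → Fin (C.m (k + 1)) → R)

theorem mul_blk_zero (M : YI C → R) (i : Fin (C.m 0)) :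
    ∑ a, M a * blk h Z a (Sum.inr ⟨0, i⟩) = ∑ I, M (Sum.inl I) * h I i := by
  rw [Fintype.sum_sum_type]
  simp [blk_zero]

theorem mul_blk_succ (M : YI C → R) (k : Fin (C.L + 1)) (β : Fin (C.m (k + 1))) :
    ∑ a, M a * blk h Z a (Sum.inr ⟨k.succ, β⟩) =
      ∑ α : Fin (C.m k), M (Sum.inr ⟨k.castSucc, α⟩) * Z k α β := by
  classical
  simp only [blk_succ, Finset.mul_sum]
  rw [Finset.sum_comm]
  refine Finset.sum_congr rfl fun α _ => ?_
  rw [Finset.sum_eq_single (Sum.inr ⟨k.castSucc, α⟩)]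
  · simp
  · intro b _ hb
    simp [hb]
  · simp

/-- The matrix connects consecutive stages only, so its square consists of products of consecutive
blocks. -/
theorem blk_mul_blk (h0 : ∀ I β, ∑ i, h I i * Z 0 i β = 0)
    (hZ : ∀ k α γ, ∑ β, Z k α β * Z (k + 1) β γ = 0) : blk h Z * blk h Z = 0 := by
  classical
  ext v w
  rw [Matrix.mul_apply, Matrix.zero_apply]
  rcases w with I | ⟨k, β⟩
  · simp [blk_inl]
  · induction k using Fin.cases with
    | zero =>
      erw [mul_blk_zero]
      simp [blk_inl]
    | succ k =>
      erw [mul_blk_succ]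
      induction k using Fin.cases with
      | zero =>
        rcases v with I | v
        · exact h0 I β
        · refine Finset.sum_eq_zero fun α _ => ?_
          change (0 : R) * _ = 0
          rw [zero_mul]
      | succ k =>
        have h1 : ∀ α : Fin (C.m (k.succ : Fin (C.L + 1))),
            blk h Z v (Sum.inr ⟨(k.succ : Fin (C.L + 1)).castSucc, α⟩) * Z (k + 1) α β =
            ∑ α' : Fin (C.m k), if v = Sum.inr ⟨k.castSucc.castSucc, α'⟩ then
              Z k α' α * Z (k + 1) α β else 0 := fun α => by
          have := blk_succ h Z v k.castSucc α
          erw [this, Finset.sum_mul]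
          refine Finset.sum_congr rfl fun α' _ => ?_
          split_ifs <;> simp
        refine (Finset.sum_congr rfl fun α _ => h1 α).trans ?_
        rw [Finset.sum_comm]
        refine Finset.sum_eq_zero fun α' _ => ?_
        split_ifs
        · exact hZ k α' β
        · simp

end

theorem blk_succ_castSucc [AddCommMonoid R] (h : Fin C.numXi → Fin (C.m 0) → R)
    (Z : (k : ℕ) → Fin (C.m k) → Fin (C.m (k + 1)) → R) (k : Fin (C.L + 1)) (α : Fin (C.m k))
    (β : Fin (C.m (k + 1))) :
    blk h Z (Sum.inr ⟨k.castSucc, α⟩) (Sum.inr ⟨k.succ, β⟩) = Z k α β := by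
  classical
  refine (blk_succ h Z _ k β).trans ((Finset.sum_eq_single α ?_ (by simp)).trans (if_pos rfl))
  intro α' _ hα
  refine if_neg fun h' => hα ?_
  simp only [Sum.inr.injEq, Sigma.mk.injEq, heq_eq_eq, true_and] at h'
  exact h'.symm

theorem blk_succ_of_ne [AddCommMonoid R] (h : Fin C.numXi → Fin (C.m 0) → R)
    (Z : (k : ℕ) → Fin (C.m k) → Fin (C.m (k + 1)) → R) (l : Fin (C.L + 2)) (α : Fin (C.m l))
    (k : Fin (C.L + 1)) (hl : (l : ℕ) ≠ k) (β : Fin (C.m (k + 1))) :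
    blk h Z (Sum.inr ⟨l, α⟩) (Sum.inr ⟨k.succ, β⟩) = 0 := by
  classical
  refine (blk_succ h Z _ k β).trans (Finset.sum_eq_zero fun α' _ => if_neg fun h' => hl ?_)
  exact congrArg (Sum.elim (fun _ => 0) (fun s => (s.1 : ℕ)) : YI C → ℕ) h'

theorem blk_mulVec_inl (h : Fin C.numXi → Fin (C.m 0) → ℝ)
    (Z : (k : ℕ) → Fin (C.m k) → Fin (C.m (k + 1)) → ℝ) (x : YI C → ℝ) (I : Fin C.numXi) :
    (blk h Z).mulVec x (Sum.inl I) = ∑ i : Fin (C.m 0), h I i * x (Sum.inr ⟨0, i⟩) := by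
  rw [Matrix.mulVec, dotProduct, Fintype.sum_sum_type, Fintype.sum_sigma, Fin.sum_univ_succ]
  have hz : ∑ k : Fin (C.L + 1), ∑ β : Fin (C.m k.succ),
      blk h Z (Sum.inl I) (Sum.inr ⟨k.succ, β⟩) * x (Sum.inr ⟨k.succ, β⟩) = 0 := by
    refine Finset.sum_eq_zero fun k _ => Finset.sum_eq_zero fun β _ => ?_
    erw [blk_succ]
    simp
  simp only [blk_inl, zero_mul, Finset.sum_const_zero, zero_add]
  rw [hz, add_zero]
  rfl

theorem blk_mulVec_inr (h : Fin C.numXi → Fin (C.m 0) → ℝ)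
    (Z : (k : ℕ) → Fin (C.m k) → Fin (C.m (k + 1)) → ℝ) (x : YI C → ℝ)
    (X : (k : ℕ) → Fin (C.m k) → ℝ) (hX : ∀ k α, x (Sum.inr ⟨k, α⟩) = X k α)
    (k : Fin (C.L + 2)) (α : Fin (C.m k)) :
    (blk h Z).mulVec x (Sum.inr ⟨k, α⟩) = ∑ β, Z k α β * X (k + 1) β := by
  rw [Matrix.mulVec, dotProduct, Fintype.sum_sum_type, Fintype.sum_sigma, Fin.sum_univ_succ]
  have hz : ∑ i : Fin (C.m (0 : Fin (C.L + 2))), blk h Z (Sum.inr ⟨k, α⟩) (Sum.inr ⟨0, i⟩) *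
      x (Sum.inr ⟨0, i⟩) = 0 := Finset.sum_eq_zero fun i _ => zero_mul _
  simp only [blk_inl, zero_mul, Finset.sum_const_zero, zero_add]
  rw [hz, zero_add]
  induction k using Fin.lastCases with
  | last =>
    have he : IsEmpty (Fin (C.m (Fin.last (C.L + 1) + 1))) := by
      have := C.m_eq_zero (Fin.last (C.L + 1) + 1) (by simp)
      rw [this]
      exact Fin.isEmpty'
    refine Eq.trans ?_ (Finset.sum_of_isEmpty _).symm
    refine Finset.sum_eq_zero fun l _ => Finset.sum_eq_zero fun β _ => ?_
    have := blk_succ_of_ne h Z _ α l (by simp only [Fin.val_last]; omega) β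
    exact (congrArg (· * _) this).trans (zero_mul _)
  | cast k =>
    refine (Finset.sum_eq_single k (fun l _ hl => ?_) (by simp)).trans ?_
    · refine Finset.sum_eq_zero fun β _ => ?_
      have := blk_succ_of_ne h Z _ α l (fun h' => hl (Fin.ext h'.symm)) β
      exact (congrArg (· * _) this).trans (zero_mul _)
    · exact Finset.sum_congr rfl fun β _ =>
        congrArg₂ (· * ·) (blk_succ_castSucc h Z k α β) (hX _ _)

/-- Exactness of the total matrix is checked stage by stage: the transversal component is reached
through `h`, the component of stage index `k` through the block `Z k`. -/
theorem blk_exact (h : Fin C.numXi → Fin (C.m 0) → ℝ)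
    (Z : (k : ℕ) → Fin (C.m k) → Fin (C.m (k + 1)) → ℝ)
    (hsurj : ∀ y : Fin C.numXi → ℝ, ∃ u : Fin (C.m 0) → ℝ, ∀ I, ∑ i, h I i * u i = y I)
    (hex0 : ∀ u : Fin (C.m 0) → ℝ, (∀ I, ∑ i, h I i * u i = 0) → 
      ∃ w : Fin (C.m 1) → ℝ, ∀ i, ∑ β, Z 0 i β * w β = u i)
    (hex : ∀ k (u : Fin (C.m (k + 1)) → ℝ), (∀ α, ∑ β, Z k α β * u β = 0) →
      ∃ w : Fin (C.m (k + 2)) → ℝ, ∀ α, ∑ β, Z (k + 1) α β * w β = u α)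
    (x : YI C → ℝ) (hx : (blk h Z).mulVec x = 0) : ∃ w, (blk h Z).mulVec w = x := by
  let X : (k : ℕ) → Fin (C.m k) → ℝ := fun k α =>
    if hk : k < C.L + 2 then x (Sum.inr ⟨⟨k, hk⟩, α⟩) else 0
  have hX : ∀ k α, x (Sum.inr ⟨k, α⟩) = X k α := fun k α => by simp [X]
  have h1 : ∀ I, ∑ i, h I i * X 0 i = 0 := fun I => by
    have := congrFun hx (Sum.inl I)
    rw [blk_mulVec_inl] at this
    simpa [X] using this
  have h2 : ∀ k α, ∑ β, Z k α β * X (k + 1) β = 0 := fun k α => by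
    by_cases hk : k < C.L + 2
    · have := congrFun hx (Sum.inr ⟨⟨k, hk⟩, α⟩)
      rwa [blk_mulVec_inr h Z x X hX] at this
    · have := C.m_eq_zero k (by omega)
      exact absurd α.2 (by omega)
  have h3 : ∀ k, ∃ w : Fin (C.m (k + 1)) → ℝ, ∀ α, ∑ β, Z k α β * w β = X k α := fun k => by
    rcases k with _ | k
    · exact hex0 _ h1
    · exact hex k _ (h2 k)
  obtain ⟨w0, hw0⟩ := hsurj fun I => x (Sum.inl I)
  choose W hW using h3
  -- The preimage of the component with index `k` has index `k + 1`; index `0` is left for the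
  -- preimage of the transversal component.
  let V : (k : ℕ) → Fin (C.m k) → ℝ := fun k => match k with
    | 0 => w0
    | k + 1 => W k
  let w : YI C → ℝ := Sum.elim (fun _ => 0) (fun s => V s.1 s.2)
  refine ⟨w, funext fun y => ?_⟩
  rcases y with I | ⟨k, α⟩
  · rw [blk_mulVec_inl]
    exact hw0 I
  · rw [blk_mulVec_inr h Z w V fun _ _ => rfl, hX]
    exact hW k α

end Block

namespace SA

variable {U : Opens C.Pt}

/-! ### Order of a superfunction in the variables other than the even coordinates -/

/-- All monomials of `f` have degree at least `d`. -/
def OrdGE (d : ℕ) (f : SA U) : Prop := ∀ μ x, f μ x ≠ 0 → d ≤ μ.degree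

theorem ordGE_zero (f : SA U) : OrdGE 0 f := fun _ _ _ => Nat.zero_le _

theorem OrdGE.add {d : ℕ} {f g : SA U} (hf : OrdGE d f) (hg : OrdGE d g) : OrdGE d (f + g) :=
  fun μ x h => by
    by_cases h1 : f μ x = 0
    · exact hg μ x fun h2 => h (by rw [add_apply, h1, h2, add_zero])
    · exact hf μ x h1

theorem OrdGE.sum {d : ℕ} {ι : Type*} {s : Finset ι} {f : ι → SA U}
    (h : ∀ i ∈ s, OrdGE d (f i)) : OrdGE d (∑ i ∈ s, f i) :=
  Finset.sum_induction f (OrdGE d) (fun _ _ => OrdGE.add) (fun _ _ h => absurd rfl h) h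

theorem OrdGE.mul {c d : ℕ} {f g : SA U} (hf : OrdGE c f) (hg : OrdGE d g) :
    OrdGE (c + d) (f * g) := fun μ x h => by
  classical
  by_cases hμ : Legal μ
  · rw [mul_apply _ _ hμ] at h
    obtain ⟨q, hq, hne⟩ := Finset.exists_ne_zero_of_sum_ne_zero h
    rw [Finset.HasAntidiagonal.mem_antidiagonal] at hq
    have h3 := right_ne_zero_of_mul hne
    rw [← hq, map_add]
    exact add_le_add (hf _ x (left_ne_zero_of_mul h3)) (hg _ x (right_ne_zero_of_mul h3))
  · exact absurd (eq_zero_of_not_legal _ hμ _) h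

theorem ordGE_one_iff {f : SA U} : OrdGE 1 f ↔ ∀ x, f 0 x = 0 := by
  constructor
  · intro h x
    by_contra h'
    simpa using h 0 x h'
  · intro h μ x hx
    rw [Nat.one_le_iff_ne_zero]
    intro h0
    rw [Finsupp.degree_eq_zero_iff] at h0
    exact hx (h0 ▸ h x)

theorem eq_zero_of_ordGE {f : SA U} (h : ∀ d, OrdGE d f) : f = 0 := ext' fun μ x => by
  by_contra h'
  have := h (μ.degree + 1) μ x h'
  omega

/-- The degree of a legal monomial in the odd coordinates is bounded, and the bound depends on the
field content alone. -/
theorem exists_ordGE_eq_zero (C : FieldContent) : ∃ n : ℕ, ∀ (U : Opens C.Pt) (f : SA U),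
    f ∈ fieldSub U → OrdGE n f → f = 0 := by
  obtain ⟨n, hn⟩ := ((finite_legal_field (C := C)).image Finsupp.degree).bddAbove
  refine ⟨n + 1, fun U f hf h => ext' fun μ x => ?_⟩
  by_contra h'
  have h1 := h μ x h'
  have h2 := hn ⟨μ, ⟨by_contra fun h2 => h' (f.eq_zero_of_not_legal h2 x), hf μ x h'⟩, rfl⟩
  omega

/-! ### Inversion of matrices of superfunctions -/

section Inverse

variable {n : Type*}

/-- The matrix of the bodies. -/
def bodyMat {m : Type*} (M : Matrix m n (SA U)) (x : C.Pt) : Matrix m n ℝ :=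
  Matrix.of fun i j => M i j 0 x

/-- A matrix of smooth functions of the body. -/
def constMat {m : Type*} (A : C.Pt → Matrix m n ℝ)
    (hA : ∀ i j, ContDiffOn ℝ ∞ (fun x => A x i j) U) : Matrix m n (SA U) :=
  Matrix.of fun i j => const (fun x => A x i j) (hA i j)

theorem bodyMat_mul {l m : Type*} [Fintype n] (M : Matrix l n (SA U)) (N : Matrix n m (SA U)) (x : C.Pt) :
    bodyMat (M * N) x = bodyMat M x * bodyMat N x := by
  ext i j
  simp only [bodyMat, Matrix.of_apply, Matrix.mul_apply, sum_apply, mul_apply_zero]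

theorem bodyMat_constMat {m : Type*} (A : C.Pt → Matrix m n ℝ)
    (hA : ∀ i j, ContDiffOn ℝ ∞ (fun x => A x i j) U) {x : C.Pt} (hx : x ∈ U) :
    bodyMat (constMat A hA) x = A x := by
  classical
  ext i j
  simp only [bodyMat, constMat, Matrix.of_apply]
  rw [const_apply _ _ _ hx, if_pos rfl]

theorem bodyMat_one [DecidableEq n] {x : C.Pt} (hx : x ∈ U) : bodyMat (1 : Matrix n n (SA U)) x = 1 := by
  classical
  ext i j
  simp only [bodyMat, Matrix.of_apply, Matrix.one_apply]
  split_ifs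
  · rw [one_apply _ hx, if_pos rfl]
  · rfl

theorem mul_mem_of_forall_mem {l m : Type*} [Fintype n] {S : Subring (SA U)} {M : Matrix l n (SA U)}
    {N : Matrix n m (SA U)} (hM : ∀ i j, M i j ∈ S) (hN : ∀ i j, N i j ∈ S) (i : l) (j : m) :
    (M * N) i j ∈ S := by
  rw [Matrix.mul_apply]
  exact S.sum_mem fun k _ => S.mul_mem (hM i k) (hN k j)

theorem one_mem_of_subring [DecidableEq n] {S : Subring (SA U)} (i j : n) : (1 : Matrix n n (SA U)) i j ∈ S := by
  rw [Matrix.one_apply]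
  split_ifs
  · exact S.one_mem
  · exact S.zero_mem

theorem pow_mem_of_forall_mem [Fintype n] [DecidableEq n] {S : Subring (SA U)} {M : Matrix n n (SA U)}
    (hM : ∀ i j, M i j ∈ S) (k : ℕ) : ∀ i j, (M ^ k) i j ∈ S := by
  induction k with
  | zero => exact fun i j => by rw [pow_zero]; exact one_mem_of_subring i j
  | succ k ih => exact fun i j => by rw [pow_succ]; exact mul_mem_of_forall_mem ih hM i j

/-- Entries without body have order at least one, so the order of a power grows with the exponent
until it exceeds the bound. -/
theorem exists_pow_eq_zero [Fintype n] [DecidableEq n] [XiStar U] {K : Matrix n n (SA U)} (hK : ∀ i j, K i j ∈ fieldSub U)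
    (h0 : ∀ x ∈ U, bodyMat K x = 0) : ∃ k, K ^ k = 0 := by
  obtain ⟨k, hk⟩ := exists_ordGE_eq_zero C
  have h1 : ∀ i j, OrdGE 1 (K i j) := fun i j => ordGE_one_iff.2 fun x => by
    by_cases hx : x ∈ U
    · exact congrFun (congrFun (h0 x hx) i) j
    · exact eq_zero_of_notMem _ _ hx
  have h2 : ∀ l i j, OrdGE l ((K ^ l) i j) := fun l => by
    induction l with
    | zero => exact fun i j => ordGE_zero _
    | succ l ih =>
      intro i j
      rw [pow_succ, Matrix.mul_apply]
      exact OrdGE.sum fun a _ => (ih i a).mul (h1 a j)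
  refine ⟨k, ?_⟩
  ext i j : 2
  exact hk U _ (pow_mem_of_forall_mem hK k i j) (h2 k i j)

theorem const_mem_thetaSub [XiStar U] (a : C.Pt → ℝ) (ha : ContDiffOn ℝ ∞ a U)
    (h : ∀ x ∈ U, a (scaleXi 0 x) = a x) : const a ha ∈ thetaSub U := by
  classical
  refine ⟨const_mem_varSub _ _ _, fun μ x hx => ?_⟩
  rw [const_apply _ _ _ hx, const_apply _ _ _ (XiStar.zero_mem hx), h x hx]

theorem constMat_mem_thetaSub [XiStar U] {m : Type*} (A : C.Pt → Matrix m n ℝ)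
    (hA : ∀ i j, ContDiffOn ℝ ∞ (fun x => A x i j) U) (h : ∀ x ∈ U, A (scaleXi 0 x) = A x)
    (i : m) (j : n) : constMat A hA i j ∈ thetaSub U :=
  const_mem_thetaSub (fun x => A x i j) (hA i j) fun x hx => congrFun (congrFun (h x hx) i) j

theorem fieldSub_of_thetaSub [XiStar U] {f : SA U} (hf : f ∈ thetaSub U) : f ∈ fieldSub U :=
  fun μ x h v hv => (hf.1 μ x h v hv).1

/-- Inverting the body gives an inverse up to a nilpotent error, which a finite geometric series
corrects. The entries do not commute, so this is done on both sides and the two one-sided inverses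
are then identified. -/
theorem exists_inverse [Fintype n] [DecidableEq n] [XiStar U] {M : Matrix n n (SA U)} (hM : ∀ i j, M i j ∈ thetaSub U)
    (hdet : ∀ x ∈ U, (bodyMat M x).det ≠ 0) :
    ∃ N : Matrix n n (SA U), (∀ i j, N i j ∈ thetaSub U) ∧ M * N = 1 ∧ N * M = 1 := by
  let B : Matrix n n (SA U) := constMat (fun x => (bodyMat M x)⁻¹)
    (contDiffOn_inv (fun i j => (M i j).smooth 0) hdet)
  have hB : ∀ i j, B i j ∈ thetaSub U := constMat_mem_thetaSub _ _ fun x hx =>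
    congrArg (·⁻¹) (Matrix.ext fun k l => (hM k l).2 0 x hx)
  have key : ∀ {P Q : Matrix n n (SA U)}, (∀ i j, P i j ∈ thetaSub U) →
      (∀ i j, Q i j ∈ thetaSub U) → (∀ x ∈ U, bodyMat P x * bodyMat Q x = 1) →
      ∃ k, (1 - P * Q) ^ k = 0 := fun {P Q} hP hQ h => by
    refine exists_pow_eq_zero (fun i j => fieldSub_of_thetaSub ((thetaSub U).sub_mem
      (one_mem_of_subring i j) (mul_mem_of_forall_mem hP hQ i j))) fun x hx => ?_
    have h1 : bodyMat (1 - P * Q) x = bodyMat 1 x - bodyMat (P * Q) x := rfl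
    rw [h1, bodyMat_mul, h x hx, bodyMat_one hx, sub_self]
  have hBx : ∀ x ∈ U, bodyMat B x = (bodyMat M x)⁻¹ := fun x hx => bodyMat_constMat _ _ hx
  obtain ⟨k, hk⟩ := key hM hB fun x hx => by
    rw [hBx x hx, Matrix.mul_nonsing_inv _ (isUnit_iff_ne_zero.2 (hdet x hx))]
  obtain ⟨l, hl⟩ := key hB hM fun x hx => by
    rw [hBx x hx, Matrix.nonsing_inv_mul _ (isUnit_iff_ne_zero.2 (hdet x hx))]
  have h1 : M * (B * ∑ i ∈ Finset.range k, (1 - M * B) ^ i) = 1 := by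
    have := mul_neg_geom_sum (1 - M * B) k
    rwa [sub_sub_cancel, hk, sub_zero, mul_assoc] at this
  have h2 : (∑ i ∈ Finset.range l, (1 - B * M) ^ i) * B * M = 1 := by
    have := geom_sum_mul_neg (1 - B * M) l
    rwa [sub_sub_cancel, hl, sub_zero, ← mul_assoc] at this
  have h3 := left_inv_eq_right_inv h2 h1
  refine ⟨_, fun i j => mul_mem_of_forall_mem hB (fun i j => ?_) i j, h1, h3 ▸ h2⟩
  rw [Matrix.sum_apply]
  exact (thetaSub U).sum_mem fun a _ => pow_mem_of_forall_mem (fun i j =>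
    (thetaSub U).sub_mem (one_mem_of_subring i j) (mul_mem_of_forall_mem hM hB i j)) a i j

end Inverse

/-! ### Contracting homotopy of the generators -/

theorem exists_homotopy [XiStar U] {ι : Type*} [Fintype ι] [DecidableEq ι] {e : ι → GV C}
    {D : Matrix ι ι (SA U)} (hD : OddMat e D)
    (hD' : ∀ v w, D v w ∈ thetaSub U) (hDD : D * D = 0) (s : Matrix ι ι ℝ)
    (hdet : ∀ x ∈ U, (bodyMat D x * s + s * bodyMat D x).det ≠ 0) :
    ∃ σ : Matrix ι ι (SA U), OddMat e σ ∧ (∀ v w, σ v w ∈ thetaSub U) ∧ D * σ + σ * D = 1 := by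
  let S : Matrix ι ι (SA U) := constMat (fun _ => s) fun _ _ => contDiffOn_const
  have hS : ∀ v w, S v w ∈ thetaSub U := constMat_mem_thetaSub _ _ fun _ _ => rfl
  have hSx : ∀ x ∈ U, bodyMat S x = s := fun x hx => bodyMat_constMat _ _ hx
  obtain ⟨N, hN, h1, h2⟩ := exists_inverse (M := D * S + S * D)
    (fun v w => (thetaSub U).add_mem (mul_mem_of_forall_mem hD' hS v w)
      (mul_mem_of_forall_mem hS hD' v w)) fun x hx => by
    have h : bodyMat (D * S + S * D) x = bodyMat (D * S) x + bodyMat (S * D) x := rfl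
    rw [h, bodyMat_mul, bodyMat_mul, hSx x hx]
    exact hdet x hx
  -- Because of `D² = 0`, the matrix `D` commutes with `DS + SD` and so with its inverse `N`. This
  -- makes `S * N` a contraction.
  have h3 : D * (D * S + S * D) = (D * S + S * D) * D := by
    rw [mul_add, add_mul, ← mul_assoc, hDD, zero_mul, zero_add, mul_assoc S, hDD, mul_zero, add_zero,
      mul_assoc]
  have h4 : N * D = D * N := by
    calc N * D = N * (D * (D * S + S * D)) * N := by rw [mul_assoc, mul_assoc, h1, mul_one]
      _ = (N * (D * S + S * D)) * D * N := by rw [h3]; simp only [mul_assoc]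
      _ = D * N := by rw [h2, one_mul]
  have h5 : D * (S * N) + S * N * D = 1 := by
    rw [mul_assoc S, h4, ← mul_assoc, ← mul_assoc, ← add_mul, h1]
  -- Nothing is known of the parities in `S * N`. As `D` is odd and the unit matrix even, projecting
  -- the entries to the parity of an odd matrix preserves the identity.
  refine ⟨Matrix.of fun v w => proj (gpar (e v) + gpar (e w) + 1) ((S * N) v w),
    fun v w => par_proj _ _, fun v w => proj_mem_thetaSub (mul_mem_of_forall_mem hS hN v w) _, ?_⟩
  ext v w : 2
  have h6 := congrArg (proj (gpar (e v) + gpar (e w))) (congrFun (congrFun h5 v) w)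
  have h7 : proj (gpar (e v) + gpar (e w)) ((1 : Matrix ι ι (SA U)) v w) =
      (1 : Matrix ι ι (SA U)) v w := by
    rw [Matrix.one_apply]
    split_ifs with h
    · rw [h, zmod2_add_self]
      exact par_one.proj_eq
    · exact map_zero _
  rw [h7] at h6
  rw [← h6, Matrix.add_apply, Matrix.add_apply, Matrix.mul_apply, Matrix.mul_apply,
    Matrix.mul_apply (M := D), Matrix.mul_apply (M := S * N), map_add, map_sum, map_sum]
  congr 1
  · refine Finset.sum_congr rfl fun a _ => ?_
    rw [proj_mul_left (hD v a), Matrix.of_apply]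
    have hp : ∀ p q r : ZMod 2, p + q + 1 + (p + r) = q + r + 1 := by decide
    rw [hp]
  · refine Finset.sum_congr rfl fun a _ => ?_
    rw [proj_mul_right (hD a w), Matrix.of_apply]
    have hp : ∀ p q r : ZMod 2, p + r + (q + r + 1) = p + q + 1 := by decide
    rw [hp]

end SA

/-! ### Vanishing of the equations of motion on the locus `ξ = 0` -/

theorem sum_single_theta (L : C.Pt →L[ℝ] ℝ) (v : C.Pt)
    (hv : ∀ I (h : C.εbar (Sum.inl I) = 0), v ⟨Sum.inl I, h⟩ = 0) : L v = ∑ A : Fin C.numTheta,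
    (if h : C.εbar (Sum.inr A) = 0 then v ⟨Sum.inr A, h⟩ * L (Pi.single ⟨Sum.inr A, h⟩ 1)
      else 0) := by
  have h1 : v = ∑ A : Fin C.numTheta,
      (if h : C.εbar (Sum.inr A) = 0 then v ⟨Sum.inr A, h⟩ • Pi.single ⟨Sum.inr A, h⟩ (1 : ℝ)
        else (0 : C.Pt)) := by
    funext ⟨j, hj⟩
    rw [Finset.sum_apply]
    rcases j with j | j
    · rw [hv]
      refine (Finset.sum_eq_zero fun I _ => ?_).symm
      split_ifs <;> simp
    · rw [Finset.sum_eq_single j]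
      · simp [hj]
      · intro I _ hI
        split_ifs <;> simp [Ne.symm hI]
      · simp
  conv_lhs => rw [h1, map_sum]
  refine Finset.sum_congr rfl fun I _ => ?_
  split_ifs <;> simp

/-- Uniqueness for linear differential equations with zero initial value. -/
theorem eq_zero_of_linear_ode {ι : Type*} [Fintype ι] {y : ℝ → ι → ℝ} {a : ι → ι → ℝ → ℝ}
    (ha : ∀ k j, ContinuousOn (a k j) (Set.Icc 0 1))
    (hy : ∀ t ∈ Set.Icc (0 : ℝ) 1, HasDerivAt y (fun k => ∑ j, a k j t * y t j) t)
    (h0 : y 0 = 0) : y 1 = 0 := by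
  obtain ⟨b, hb⟩ := isCompact_Icc.exists_bound_of_continuousOn
    (f := fun t => ∑ k, ∑ j, |a k j t|) (continuousOn_finsetSum _ fun k _ =>
      continuousOn_finsetSum _ fun j _ => (ha k j).abs)
  have hcont : ContinuousOn y (Set.Icc 0 1) := fun t ht => (hy t ht).continuousAt.continuousWithinAt
  have h := norm_le_gronwallBound_of_norm_deriv_right_le (δ := 0) (K := b) (ε := 0) hcont
    (fun t ht => (hy t (Set.Ico_subset_Icc_self ht)).hasDerivWithinAt) (by simp [h0])
    (fun t ht => by
      have hbt := hb t (Set.Ico_subset_Icc_self ht)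
      have hnn : 0 ≤ ∑ k, ∑ j, |a k j t| :=
        Finset.sum_nonneg fun k _ => Finset.sum_nonneg fun j _ => abs_nonneg _
      rw [Real.norm_of_nonneg hnn] at hbt
      rw [add_zero, pi_norm_le_iff_of_nonneg (mul_nonneg (hnn.trans hbt) (norm_nonneg _))]
      intro k
      refine (norm_sum_le _ _).trans ?_
      calc ∑ j, ‖a k j t * y t j‖ ≤ ∑ j, |a k j t| * ‖y t‖ := by
            refine Finset.sum_le_sum fun j _ => ?_
            rw [norm_mul, Real.norm_eq_abs]
            exact mul_le_mul_of_nonneg_left (norm_le_pi_norm (y t) j) (abs_nonneg _)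
        _ = (∑ j, |a k j t|) * ‖y t‖ := by rw [Finset.sum_mul]
        _ ≤ b * ‖y t‖ := by
            refine mul_le_mul_of_nonneg_right (le_trans ?_ hbt) (norm_nonneg _)
            exact Finset.single_le_sum (f := fun k => ∑ j, |a k j t|)
              (fun k _ => Finset.sum_nonneg fun j _ => abs_nonneg _) (Finset.mem_univ k))
    1 (by simp)
  rw [gronwallBound_ε0_δ0] at h
  exact norm_le_zero_iff.1 h

namespace SA

variable {U : Opens C.Pt}

/-- The ideal generated by the family `t`. -/
def InIdeal {ι : Type*} [Fintype ι] (t : ι → SA U) (f : SA U) : Prop :=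
  ∃ n : ι → SA U, f = ∑ j, t j * n j

section Ideal

variable {ι : Type*} [Fintype ι] {t : ι → SA U}

theorem InIdeal.add {f g : SA U} (hf : InIdeal t f) (hg : InIdeal t g) : InIdeal t (f + g) := by
  obtain ⟨m, rfl⟩ := hf
  obtain ⟨n, rfl⟩ := hg
  exact ⟨m + n, by simp [mul_add, Finset.sum_add_distrib]⟩

theorem InIdeal.smul {f : SA U} (c : ℝ) (hf : InIdeal t f) : InIdeal t (c • f) := by
  obtain ⟨m, rfl⟩ := hf
  exact ⟨c • m, by simp [Finset.smul_sum, mul_smul_comm]⟩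

theorem InIdeal.neg {f : SA U} (hf : InIdeal t f) : InIdeal t (-f) := by
  obtain ⟨m, rfl⟩ := hf
  exact ⟨-m, by simp⟩

theorem inIdeal_zero : InIdeal t (0 : SA U) := ⟨0, by simp⟩

theorem InIdeal.sum {κ : Type*} {s : Finset κ} {f : κ → SA U} (h : ∀ i ∈ s, InIdeal t (f i)) :
    InIdeal t (∑ i ∈ s, f i) :=
  Finset.sum_induction f (InIdeal t) (fun _ _ => InIdeal.add) inIdeal_zero h

theorem InIdeal.mul_right {f : SA U} (hf : InIdeal t f) (g : SA U) : InIdeal t (f * g) := by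
  obtain ⟨m, rfl⟩ := hf
  exact ⟨fun j => m j * g, by simp [Finset.sum_mul, mul_assoc]⟩

theorem inIdeal_mul (j : ι) (g : SA U) : InIdeal t (t j * g) := by
  classical
  exact ⟨Pi.single j g, by simp [Pi.single_apply]⟩

/-- `InIdeal` places its coefficients on the right; homogeneity of the generators lets a homogeneous
factor pass from the left. -/
theorem InIdeal.mul_left {p : ι → ZMod 2} (ht : ∀ j, Par (p j) (t j)) {q : ZMod 2} {g : SA U}
    (hg : Par q g) {f : SA U} (hf : InIdeal t f) : InIdeal t (g * f) := by
  obtain ⟨m, rfl⟩ := hf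
  rw [Finset.mul_sum]
  refine InIdeal.sum fun j _ => ?_
  rw [← mul_assoc, mul_comm_of_par hg (ht j), smul_mul_assoc, mul_assoc]
  exact (inIdeal_mul j _).smul _

theorem InIdeal.ordGE {d : ℕ} (ht : ∀ j, OrdGE d (t j)) {f : SA U} (hf : InIdeal t f) :
    OrdGE d f := by
  obtain ⟨m, rfl⟩ := hf
  exact OrdGE.sum fun j _ => (ht j).mul (ordGE_zero (m j))

end Ideal

theorem continuousOn_apply_comp (f : SA U) (μ : C.Mono) {γ : ℝ → C.Pt} {s : Set ℝ}
    (hγ : ContinuousOn γ s) (hs : ∀ t ∈ s, γ t ∈ U) : ContinuousOn (fun t => f μ (γ t)) s :=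
  (f.smooth μ).continuousOn.comp hγ hs

/-- The ideal condition is a homogeneous linear differential system in the longitudinal fields. Even
directions propagate the zero at `p` to the body, odd directions then raise the order step by step.
-/
theorem eq_zero_of_pd_mem_ideal [XiStar U] (hU : Convex ℝ (U : Set C.Pt)) {p : C.Pt} (hp : p ∈ U)
    (hpx : scaleXi 0 p = p) {t : C.Coord → SA U} (ht : ∀ j, t j ∈ thetaSub U)
    (h0 : ∀ j, t j 0 p = 0)
    (hid : ∀ A k, InIdeal t (pd (gcoord (Sum.inr A)) (t k))) (j : C.Coord) : t j = 0 := by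
  -- On the segment from `p` to the projection of `x`, which convexity keeps in `U`, the bodies of
  -- the `t j` solve a linear differential equation with zero initial value.
  have hbody : ∀ j, OrdGE 1 (t j) := fun j => ordGE_one_iff.2 fun x => by
    by_cases hx : x ∈ U
    · rw [← (ht j).2 0 x hx]
      have hx0 := XiStar.zero_mem hx
      set v : C.Pt := scaleXi 0 x - p with hv
      choose n hn using hid
      let γ : ℝ → C.Pt := fun s => p + s • v
      have hγc : Continuous γ := by fun_prop
      have hγ : ∀ s ∈ Set.Icc (0 : ℝ) 1, γ s ∈ U := fun s hs => by
        exact hU.add_smul_sub_mem hp hx0 hs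
      have hγd : ∀ s, HasDerivAt γ v s := fun s => by
        have := ((hasDerivAt_id s).smul_const v).const_add p
        rwa [one_smul] at this
      have hv0 : ∀ I (h : C.εbar (Sum.inl I) = 0), v ⟨Sum.inl I, h⟩ = 0 := fun I h => by
        rw [hv, ← hpx]
        simp [scaleXi]
      have key := eq_zero_of_linear_ode (y := fun s k => t k 0 (γ s))
        (a := fun k j s => ∑ A : Fin C.numTheta,
          (if h : C.εbar (Sum.inr A) = 0 then v ⟨Sum.inr A, h⟩ * n A k j 0 (γ s) else 0))
        (fun k j => continuousOn_finsetSum _ fun A _ => by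
          split_ifs
          · exact continuousOn_const.mul (continuousOn_apply_comp _ _ hγc.continuousOn hγ)
          · exact continuousOn_const)
        (fun s hs => by
          rw [hasDerivAt_pi]
          intro k
          have h1 := (((t k).differentiableAt 0 (hγ s hs)).hasFDerivAt).comp_hasDerivAt s (hγd s)
          refine h1.congr_deriv ?_
          rw [sum_single_theta _ v hv0]
          simp only [Finset.sum_mul]
          rw [Finset.sum_comm]
          refine Finset.sum_congr rfl fun A _ => ?_
          split_ifs with h
          · have h2 := hn A k
            unfold gcoord at h2
            rw [dif_pos h] at h2
            rw [← pd_inl_apply _ _ _ (hγ s hs), h2, sum_apply, Finset.mul_sum]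
            refine Finset.sum_congr rfl fun j _ => ?_
            rw [mul_apply_zero]
            ring
          · simp)
        (funext fun k => by simp [γ, h0])
      have := congrFun key j
      simpa [γ, hv] using this
    · exact eq_zero_of_notMem _ _ hx
  -- If all generators have order at least `d + 1`, so do their odd longitudinal derivatives, which
  -- lie in the ideal. A monomial of degree `d + 1` would leave one of degree `d` in such a
  -- derivative.
  have hord : ∀ d j, OrdGE (d + 1) (t j) := fun d => by
    induction d with
    | zero => exact hbody
    | succ d ih =>
      intro j μ x h
      by_contra hlt
      have hμ : μ.degree = d + 1 := le_antisymm (by omega) (ih j μ x h)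
      obtain ⟨v, hv⟩ : ∃ v, μ v ≠ 0 := by
        by_contra hne
        push Not at hne
        rw [(Finsupp.ext hne : μ = 0)] at hμ
        simp at hμ
      obtain ⟨hf, hs⟩ := (ht j).1 μ x h v hv
      rcases v with ⟨⟨I | A, hA⟩⟩ | ⟨s, α⟩ | ⟨k, α⟩
      · exact absurd hs one_ne_zero
      · have h1 := (hid A j).ordGE ih
        unfold gcoord at h1
        rw [dif_neg hA] at h1
        set v : C.Var := Var.field ⟨Sum.inr A, hA⟩
        obtain ⟨ν, rfl⟩ : ∃ ν, μ = ν + Finsupp.single v 1 := ⟨μ - Finsupp.single v 1, by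
          rw [tsub_add_cancel_of_le]
          rw [Finsupp.single_le_iff]; omega⟩
        rw [map_add, Finsupp.degree_single] at hμ
        have h2 : pd (Sum.inr v) (t j) ν x = 0 := by
          by_contra h3
          have := h1 ν x h3
          omega
        rw [pd_inr_apply] at h2
        have h3 : sg (chi (Finsupp.single v 1) ν) ≠ 0 := fun h4 => by
          have := sg_mul_self (chi (Finsupp.single v 1) ν)
          rw [h4] at this
          simp at this
        have h4 : ((ν v + 1 : ℕ) : ℝ) ≠ 0 := Nat.cast_ne_zero.2 (Nat.succ_ne_zero _)
        exact h ((mul_eq_zero.1 ((mul_eq_zero.1 h2).resolve_left h3)).resolve_left h4)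
      · exact hf
      · exact hf
  refine eq_zero_of_ordGE fun d => ?_
  intro μ x h
  have := hord d j μ x h
  omega

/-- This produces the differential system of `eq_zero_of_pd_mem_ideal`. In the differentiated and
restricted Noether identity, all terms but those with longitudinal generators lie in the ideal of
the restricted `T`; the right inverse `X` isolates each derivative of a longitudinal component. -/
theorem rho_eq_zero_of_noether [XiStar U] (hU : Convex ℝ (U : Set C.Pt)) {p : C.Pt} (hp : p ∈ U)
    (hpx : scaleXi 0 p = p) {κ : Type*} [Fintype κ] {T : C.Coord → SA U} {R : C.Coord → κ → SA U}
    (hT : ∀ j, T j ∈ fieldSub U) (hTp : ∀ j, Par (C.εbar j) (T j)) (h0 : ∀ j, T j 0 p = 0)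
    (hsymm : ∀ j k, ∃ c : ℝ, pd (gcoord k) (T j) = c • pd (gcoord j) (T k))
    (hTR : ∀ α, ∑ j, T j * R j α = 0) (hR : ∀ I α, InIdeal T (R (Sum.inl I) α))
    (X : κ → Fin C.numTheta → SA U)
    (hX : ∀ A B, ∑ α, rho (R (Sum.inr A) α) * X α B = if A = B then 1 else 0) (j : C.Coord) :
    rho (T j) = 0 := by
  have htp : ∀ j, Par (C.εbar j) (rho (T j)) := fun j => (hTp j).rho
  refine eq_zero_of_pd_mem_ideal hU hp hpx (t := fun j => rho (T j))
    (fun j => rho_mem_thetaSub (hT j)) (fun j => ?_) (fun A k => ?_) j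
  · rw [rho_apply _ _ hp, hpx, h0, ite_self]
  · have h1 : ∀ α, InIdeal (fun j => rho (T j))
        (∑ B, rho (pd (gcoord k) (T (Sum.inr B))) * rho (R (Sum.inr B) α)) := fun α => by
      have h2 := congrArg (fun f => rho (pd (gcoord k) f)) (hTR α)
      simp only [map_sum, pd_mul (hTp _), map_add, map_mul, rho_smul, map_zero,
        Finset.sum_add_distrib] at h2
      rw [Fintype.sum_sum_type, add_comm (∑ I, _), add_assoc] at h2
      rw [eq_neg_of_add_eq_zero_left h2]
      refine InIdeal.neg (InIdeal.add (InIdeal.sum fun I _ => ?_) (InIdeal.sum fun j _ => ?_))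
      · refine InIdeal.mul_left htp ((hTp _).pd _).rho ?_
        obtain ⟨n, hn⟩ := hR I α
        rw [hn, map_sum]
        exact InIdeal.sum fun j _ => by
          rw [map_mul]
          exact inIdeal_mul (t := fun j => rho (T j)) j _
      · exact (inIdeal_mul (t := fun j => rho (T j)) j _).smul _
    have h3 : InIdeal (fun j => rho (T j)) (rho (pd (gcoord k) (T (Sum.inr A)))) := by
      have h4 : rho (pd (gcoord k) (T (Sum.inr A))) = ∑ α,
          (∑ B, rho (pd (gcoord k) (T (Sum.inr B))) * rho (R (Sum.inr B) α)) * X α A := by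
        simp only [Finset.sum_mul]
        rw [Finset.sum_comm]
        simp only [mul_assoc, ← Finset.mul_sum, hX]
        simp
      rw [h4]
      exact InIdeal.sum fun α _ => (h1 α).mul_right _
    rw [← rho_pd (gsafn_gcoord_inr A)]
    -- Symmetry of second derivatives turns any derivative of a longitudinal component into a
    -- longitudinal derivative of any component, and such a derivative commutes with `rho`.
    obtain ⟨c, hc⟩ := hsymm k (Sum.inr A)
    rw [hc, rho_smul]
    exact h3.smul c

end SA

namespace SA

variable {U : Opens C.Pt}

/-! ### Comparison with superfunctions that are defined everywhere -/

/-- `f` agrees with `a` over `U`. -/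
def Rep (f : C.SFun) (a : SA U) : Prop := ∀ μ, ∀ x ∈ U, f μ x = a μ x

theorem rep_ofSFun (f : C.SFun) (hf : IsSuperFun (U : Set C.Pt) f) : Rep f (ofSFun f hf) :=
  fun μ _ hx => (ofSFun_apply f hf μ hx).symm

theorem rep_self (a : SA U) : Rep a.1 a := fun _ _ _ => rfl

theorem Rep.eq {f g : C.SFun} {a b : SA U} (hf : Rep f a) (hg : Rep g b)
    (h : SEq (U : Set C.Pt) f g) : a = b :=
  ext fun μ _ x hx => by rw [← hf μ x hx, h μ x hx, hg μ x hx]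

theorem Rep.sEq {f g : C.SFun} {a b : SA U} (hf : Rep f a) (hg : Rep g b) (h : a = b) :
    SEq (U : Set C.Pt) f g := fun μ x hx => by rw [hf μ x hx, hg μ x hx, h]

theorem rep_zero : Rep (0 : C.SFun) (0 : SA U) := fun _ _ _ => rfl

theorem Rep.add {f g : C.SFun} {a b : SA U} (hf : Rep f a) (hg : Rep g b) : Rep (f + g) (a + b) :=
  fun μ x hx => by rw [add_apply, ← hf μ x hx, ← hg μ x hx]; rfl

theorem Rep.sum {ι : Type*} {s : Finset ι} {f : ι → C.SFun} {a : ι → SA U}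
    (h : ∀ i ∈ s, Rep (f i) (a i)) : Rep (∑ i ∈ s, f i) (∑ i ∈ s, a i) := fun μ x hx => by
  rw [sum_apply, Finset.sum_apply, Finset.sum_apply]
  exact Finset.sum_congr rfl fun i hi => h i hi μ x hx

theorem Rep.mul {f g : C.SFun} {a b : SA U} (hf : Rep f a) (hg : Rep g b) :
    Rep (BV.mul f g) (a * b) := fun μ x hx =>
  mul_congr (f' := a.1) (g' := b.1) (fun ν => hf ν x hx) (fun ν => hg ν x hx) μ

theorem Rep.dLeft {f : C.SFun} {a : SA U} (hf : Rep f a) (v : C.Var) :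
    Rep (BV.dLeft v f) (pd (Sum.inr v) a) := fun μ x hx => by
  by_cases h : Legal (μ + Finsupp.single v 1)
  · rw [dLeft_apply _ _ _ _ h, pd_inr_apply, hf _ x hx]
  · rw [dLeft_apply_of_not_legal _ _ _ _ h, pd_inr_apply, a.eq_zero_of_not_legal h]
    ring

/-- The sign is the cost of moving `v` from one end of a monomial of parity `q` to the other,
simplified by the fact that a parity equals its square. -/
theorem Rep.dRight {f : C.SFun} {a : SA U} (hf : Rep f a) {q : ZMod 2} (hq : Par q a)
    (v : C.Var) : Rep (BV.dRight v f) (sg (v.par * (q + 1)) • pd (Sum.inr v) a) := fun μ x hx => by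
  rw [smul_apply, pd_inr_apply]
  by_cases h : Legal (μ + Finsupp.single v 1)
  · rw [dRight_apply _ _ _ _ h, hf _ x hx]
    by_cases hm : monoPar (μ + Finsupp.single v 1) = q
    · have h1 := chi_swap h
      rw [monoPar_single] at h1
      rw [monoPar_add, monoPar_single] at hm
      have h2 : v.par * (q + 1) = monoPar μ * v.par := by
        rw [← hm]
        generalize monoPar μ = r
        generalize v.par = s
        revert r s
        decide
      rw [h2, ← h1, sg_add]
      linear_combination (-(sg (chi μ (Finsupp.single v 1)) * ((μ v + 1 : ℕ) : ℝ) *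
        a (μ + Finsupp.single v 1) x)) * sg_mul_self (chi (Finsupp.single v 1) μ)
    · rw [hq _ _ hm]
      ring
  · rw [a.eq_zero_of_not_legal h]
    simp [BV.dRight, h]

theorem Rep.eventuallyEq {f : C.SFun} {a : SA U} (hf : Rep f a) (μ : C.Mono) {x : C.Pt}
    (hx : x ∈ U) : f μ =ᶠ[𝓝 x] a μ :=
  Filter.eventually_of_mem (U.isOpen.mem_nhds hx) fun y hy => hf μ y hy

theorem Rep.dCoord {f : C.SFun} {a : SA U} (hf : Rep f a) {q : ZMod 2} (hq : Par q a)
    (j : C.Coord) : Rep (BV.dCoord j f) (sg (C.εbar j * (q + 1)) • pd (gcoord j) a) := by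
  unfold BV.dCoord gcoord
  split_ifs with h
  · intro μ x hx
    rw [h, zero_mul, sg_zero, one_smul, pd_inl_apply _ _ _ hx]
    exact congrArg (fun l : C.Pt →L[ℝ] ℝ => l _) (hf.eventuallyEq μ hx).fderiv_eq
  · exact hf.dRight hq _

/-- No homogeneity is needed, since at the trivial monomial left and right derivatives have no sign.
-/
theorem Rep.body_dCoord {f : C.SFun} {a : SA U} (hf : Rep f a) (j : C.Coord) {x : C.Pt}
    (hx : x ∈ U) : body (BV.dCoord j f) x = pd (gcoord j) a 0 x := by
  unfold BV.dCoord gcoord body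
  split_ifs with h
  · rw [pd_inl_apply _ _ _ hx]
    exact congrArg (fun l : C.Pt →L[ℝ] ℝ => l _) (hf.eventuallyEq 0 hx).fderiv_eq
  · rw [dRight_apply _ _ _ _ (by rw [zero_add]; exact legal_single _), pd_inr_apply, hf _ x hx]
    simp

theorem Rep.safnPart_zero [XiStar U] {f : C.SFun} {a : SA U} (hf : Rep f a) :
    Rep (safnPart 0 f) (rho a) := fun μ x hx => by
  rw [rho_apply _ _ hx, safnPart]
  by_cases h : monoSafn μ = 0
  · simp [h, hf μ _ (XiStar.zero_mem hx)]
  · simp [h]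

theorem Rep.par {f : C.SFun} {a : SA U} (hf : Rep f a) {D : Set C.Pt} (hD : (U : Set C.Pt) ⊆ D)
    {q : ZMod 2} (hq : HasParity D q f) : Par q a := fun μ x h => by
  by_cases hx : x ∈ U
  · rw [← hf μ x hx]
    exact hq μ h x (hD hx)
  · exact eq_zero_of_notMem _ _ hx

theorem Rep.mem_fieldSub {f : C.SFun} {a : SA U} (hf : Rep f a) {D : Set C.Pt}
    (hD : (U : Set C.Pt) ⊆ D) (h : IsFieldFun D f) : a ∈ fieldSub U := fun μ x hne v hv => by
  by_contra hP
  by_cases hx : x ∈ U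
  · rw [← hf μ x hx] at hne
    exact hne (h.2 μ ⟨v, Finsupp.mem_support_iff.2 hv, hP⟩ x (hD hx))
  · exact hne (eq_zero_of_notMem _ _ hx)

theorem rep_gen (v : C.Var) : Rep (gen v) (z (Sum.inr v) : SA U) := fun μ x hx => by
  classical
  rw [z, monom_apply _ _ _ _ _ hx]
  rfl

theorem exists_rep {f : C.SFun} {D : Set C.Pt} (hD : (U : Set C.Pt) ⊆ D) (h : IsFieldFun D f) :
    ∃ a : SA U, Rep f a ∧ a ∈ fieldSub U := by
  have hf : IsSuperFun (U : Set C.Pt) f :=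
    ⟨fun μ => (h.1.1 μ).mono hD, fun μ hμ x hx => h.1.2 μ hμ x (hD hx)⟩
  exact ⟨_, rep_ofSFun f hf, (rep_ofSFun f hf).mem_fieldSub hD h⟩

/-! ### The linear part of a function of the fields -/

theorem z_mul_rho_pd_apply [XiStar U] (v : C.Var) (hv : v.safn = 1) (a : SA U) (μ : C.Mono)
    {x : C.Pt} (hx : x ∈ U) : (z (Sum.inr v) * rho (pd (Sum.inr v) a) : SA U) μ x =
      if monoSafn μ = 1 then μ v * a μ (scaleXi 0 x) else 0 := by
  by_cases h0 : μ v = 0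
  · rw [z_mul_apply_of_eq_zero _ _ _ _ h0, h0]
    simp
  · by_cases hμ : Legal μ
    · obtain ⟨ν, rfl⟩ : ∃ ν, μ = ν + Finsupp.single v 1 := ⟨μ - Finsupp.single v 1, by
        rw [tsub_add_cancel_of_le]
        rw [Finsupp.single_le_iff]; omega⟩
      rw [z_mul_apply _ _ _ hx hμ, rho_apply _ _ hx, pd_inr_apply, monoSafn_add, monoSafn_single, hv]
      by_cases h : monoSafn ν = 0
      · rw [if_pos h, if_pos (by omega), ← mul_assoc, sg_mul_self]
        simp
      · rw [if_neg h, if_neg (by omega), mul_zero]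
    · rw [eq_zero_of_not_legal _ hμ, a.eq_zero_of_not_legal hμ, mul_zero, ite_self]

/-- A function of the fields has no antifields, so weight one means either one even `ξ`, giving the
first Taylor term, or one odd `ξ`, giving the coefficient at `ξ = 0`. -/
theorem sum_z_mul_rho_pd_apply [XiStar U] {a : SA U} (ha : a ∈ fieldSub U) (μ : C.Mono) {x : C.Pt}
    (hx : x ∈ U) :
    (∑ I, z (gcoord (Sum.inl I)) * rho (pd (gcoord (Sum.inl I)) a) : SA U) μ x =
      if monoSafn μ = 0 then fderiv ℝ (a μ) (scaleXi 0 x) (xiPart x)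
      else if monoSafn μ = 1 then a μ (scaleXi 0 x) else 0 := by
  have hx0 := XiStar.zero_mem hx
  have h1 : ∀ I : Fin C.numXi,
      (z (gcoord (Sum.inl I)) * rho (pd (gcoord (Sum.inl I)) a) : SA U) μ x =
      (if monoSafn μ = 0 then (if h : C.εbar (Sum.inl I) = 0 then
        x ⟨Sum.inl I, h⟩ * fderiv ℝ (a μ) (scaleXi 0 x) (Pi.single ⟨Sum.inl I, h⟩ 1) else 0) else 0) +
      (if monoSafn μ = 1 then
        ((Sum.elim (fun _ => 0) (fun v => μ v) (gcoord (C := C) (Sum.inl I)) : ℕ) : ℝ) *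
          a μ (scaleXi 0 x) else 0) := fun I => by
    unfold gcoord
    by_cases h : C.εbar (Sum.inl I) = 0
    · simp only [dif_pos h]
      rw [z, const_mul_apply _ _ _ _ hx, rho_apply _ _ hx, pd_inl_apply _ _ _ hx0]
      simp
    · simp only [dif_neg h]
      rw [z_mul_rho_pd_apply _ rfl _ _ hx]
      simp
  rw [sum_apply, Finset.sum_congr rfl fun I _ => h1 I, Finset.sum_add_distrib]
  by_cases hs0 : monoSafn μ = 0
  · simp only [hs0, if_true, zero_ne_one, if_false, Finset.sum_const_zero, add_zero]
    exact sum_single_xi _ x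
  · simp only [hs0, if_false, Finset.sum_const_zero, zero_add]
    by_cases hs1 : monoSafn μ = 1
    · simp only [hs1, if_true]
      by_cases hne : a μ (scaleXi 0 x) = 0
      · simp [hne]
      · have hv : ∃ v, μ v ≠ 0 ∧ v.safn ≠ 0 := by
          by_contra h
          push Not at h
          exact hs0 (monoSafn_eq_zero.2 h)
        obtain ⟨v, hv, hvs⟩ := hv
        have hf := ha μ _ hne v hv
        rcases v with ⟨⟨I | A, hI⟩⟩ | ⟨s, α⟩ | ⟨k, α⟩
        · set v : C.Var := Var.field ⟨Sum.inl I, hI⟩ with hvdef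
          obtain ⟨ν, rfl⟩ : ∃ ν, μ = ν + Finsupp.single v 1 := ⟨μ - Finsupp.single v 1, by
            rw [tsub_add_cancel_of_le]
            rw [Finsupp.single_le_iff]; omega⟩
          rw [monoSafn_add, monoSafn_single, show v.safn = 1 from rfl] at hs1
          have hν := monoSafn_eq_zero.1 (show monoSafn ν = 0 by omega)
          -- A monomial of weight one contains a single odd transversal field, once, so only this
          -- summand counts.
          rw [Finset.sum_eq_single I]
          · have hg : gcoord (Sum.inl I) = (Sum.inr v : GV C) := by
              unfold gcoord
              rw [dif_neg hI]
            have : ν v = 0 := by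
              by_contra h
              exact one_ne_zero (hν v h)
            rw [hg]
            simp [this]
          · intro J _ hJ
            have : Sum.elim (fun _ => 0) (fun v' => (ν + Finsupp.single v 1 : C.Mono) v')
                (gcoord (C := C) (Sum.inl J)) = 0 := by
              unfold gcoord
              split_ifs with h
              · rfl
              · rw [Sum.elim_inr, Finsupp.add_apply, Finsupp.single_apply, if_neg, add_zero]
                · by_contra h'
                  exact one_ne_zero (hν _ h')
                · rw [hvdef]
                  simpa using Ne.symm hJ
            rw [this]
            simp
          · simp
        · exact absurd rfl hvs
        · exact hf.elim
        · exact hf.elim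
    · simp [hs1]

theorem Rep.safnPart_one [XiStar U] {f : C.SFun} {a : SA U} (hf : Rep f a) (ha : a ∈ fieldSub U) :
    Rep (safnPart 1 f) (∑ I, z (gcoord (Sum.inl I)) * rho (pd (gcoord (Sum.inl I)) a)) :=
  fun μ x hx => by
    have hx0 := XiStar.zero_mem hx
    rw [sum_z_mul_rho_pd_apply ha μ hx, safnPart]
    by_cases hs0 : monoSafn μ = 0
    · rw [if_pos (by omega), if_pos hs0, hs0, Nat.sub_zero, iteratedDeriv_one, Nat.factorial_one,
        Nat.cast_one, div_one]
      have h1 : (fun t => f μ (scaleXi t x)) =ᶠ[𝓝 0] fun t => a μ (scaleL t x) := by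
        have hc : Continuous fun t : ℝ => scaleL t x :=
          contDiff_scaleL_uncurry.continuous.comp (by fun_prop : Continuous fun t : ℝ => (t, x))
        have : ∀ᶠ t in 𝓝 (0 : ℝ), scaleL t x ∈ U :=
          hc.continuousAt.eventually_mem (U.isOpen.mem_nhds (by rwa [scaleL_apply]))
        filter_upwards [this] with t ht
        rw [← hf μ _ ht, scaleL_apply]
      have h2 := hasDerivAt_scaleL (a.smooth μ) (t := 0) (x := x) (by rwa [scaleL_apply])
      rw [h1.deriv_eq, h2.deriv, scaleL_apply]
    · rw [if_neg hs0]
      by_cases hs1 : monoSafn μ = 1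
      · rw [if_pos (by omega), if_pos hs1, hs1]
        simp [hf μ _ hx0]
      · rw [if_neg (by omega), if_neg hs1]

end SA

open SA

/-! ### A gauge theory over an open subset -/

/-- The functions of a gauge theory with transversal fields, over `U`. -/
structure LocalModel (G : GaugeData C) (U : Opens C.Pt) where
  T : Fin (C.m 0) → SA U
  Tbar : C.Coord → SA U
  dφ : Fin (C.m 0) → C.Coord → SA U
  jac : C.Coord → Fin (C.m 0) → SA U
  Z : (s : ℕ) → Fin (C.m s) → Fin (C.m (s + 1)) → SA U
  rep_T : ∀ i, Rep (G.T i) (T i)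
  rep_jac : ∀ j i, Rep (G.jac j i) (jac j i)
  rep_Z : ∀ s α β, Rep (G.Z s α β) (Z s α β)
  T_mem : ∀ i, T i ∈ fieldSub U
  T_par : ∀ i, Par (C.ε 0 i) (T i)
  Tbar_mem : ∀ j, Tbar j ∈ fieldSub U
  Tbar_par : ∀ j, Par (C.εbar j) (Tbar j)
  Tbar_symm : ∀ j k, ∃ c : ℝ, pd (gcoord k) (Tbar j) = c • pd (gcoord j) (Tbar k)
  jac_par : ∀ j i, Par (C.εbar j + C.ε 0 i) (jac j i)
  jac_mem : ∀ j i, jac j i ∈ fieldSub U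
  Z_mem : ∀ s α β, Z s α β ∈ fieldSub U
  Z_par : ∀ s α β, Par (C.ε s α + C.ε (s + 1) β) (Z s α β)
  T_eq : ∀ i, T i = ∑ j, Tbar j * jac j i
  jac_right : ∀ i k, ∑ j, dφ i j * jac j k = if i = k then 1 else 0
  jac_left : ∀ j k, ∑ i, jac j i * dφ i k = if j = k then 1 else 0
  noether_zero : ∀ α, ∑ i, T i * Z 0 i α = 0
  noether : ∀ s α γ, InIdeal T (∑ β, Z s α β * Z (s + 1) β γ)
  invariant : ∀ I α, InIdeal T (∑ i, jac (Sum.inl I) i * Z 0 i α)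

theorem exists_localModel {G : GaugeData C} (hG : G.IsGaugeTheory) (hT : G.IsTransversal)
    {U : Opens C.Pt} (hU : (U : Set C.Pt) ⊆ G.dom) : Nonempty (LocalModel G U) := by
  have hres : ∀ {f g : C.SFun}, SEq G.dom f g → SEq (U : Set C.Pt) f g :=
    fun h μ x hx => h μ x (hU hx)
  obtain ⟨S, hS, hSm⟩ := exists_rep hU hG.S₀_fun
  choose φ hφ hφm using fun i => exists_rep hU (hG.φ_fun i)
  choose jac hj hjm using fun j i => exists_rep hU (hG.jac_fun j i)
  choose Z hZ hZm using fun s α β => exists_rep hU (hG.Z_fun s α β)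
  choose B hB hBm using fun s i α γ => exists_rep hU (hG.B_fun s i α γ)
  obtain ⟨K, hK, hinv⟩ := hT.invariant
  choose κ hκ hκm using fun i I α => exists_rep hU (hK i I α)
  have hSp : Par 0 S := hS.par hU hG.S₀_par
  have hφp : ∀ i, Par (C.ε 0 i) (φ i) := fun i => (hφ i).par hU (hG.φ_par i)
  have hjp : ∀ j i, Par (C.εbar j + C.ε 0 i) (jac j i) := fun j i => (hj j i).par hU (hG.jac_par j i)
  -- Left derivatives with the sign that makes them right derivatives; the `0` is the parity of the
  -- action.
  let Tb : C.Coord → SA U := fun j => sg (C.εbar j * (0 + 1)) • pd (gcoord j) S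
  have hTb : ∀ j, Rep (dCoord j G.S₀) (Tb j) := fun j => hS.dCoord hSp j
  have hTbm : ∀ j, Tb j ∈ fieldSub U := fun j => smul_mem_varSub (pd_mem_varSub hSm _) _
  have hTbp : ∀ j, Par (C.εbar j) (Tb j) := fun j => by
    have := (hSp.pd (gcoord j)).smul (sg (C.εbar j * (0 + 1)))
    rwa [gpar_gcoord, add_zero] at this
  let T : Fin (C.m 0) → SA U := fun i => ∑ j, Tb j * jac j i
  have hTr : ∀ i, Rep (G.T i) (T i) := fun i => by
    unfold GaugeData.T GaugeData.dPhi
    exact Rep.sum fun j _ => (hTb j).mul (hj j i)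
  let dφ : Fin (C.m 0) → C.Coord → SA U := fun i j => sg (C.εbar j * (C.ε 0 i + 1)) • pd (gcoord j) (φ i)
  have hdφ : ∀ i j, Rep (dCoord j (G.φ i)) (dφ i j) := fun i j => (hφ i).dCoord (hφp i) j
  have hone : Rep (one : C.SFun) (1 : SA U) := fun μ x hx => (one_apply μ hx).symm
  refine ⟨{
    T := T
    Tbar := Tb
    dφ := dφ
    jac := jac
    Z := Z
    rep_T := hTr
    rep_jac := hj
    rep_Z := hZ
    T_mem := fun i => Subring.sum_mem _ fun j _ => Subring.mul_mem _ (hTbm j) (hjm j i)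
    T_par := fun i => Par.sum fun j _ => ?_
    Tbar_mem := hTbm
    Tbar_par := hTbp
    Tbar_symm := fun j k => ?_
    jac_par := hjp
    jac_mem := hjm
    Z_mem := hZm
    Z_par := fun s α β => (hZ s α β).par hU (hG.Z_par s α β)
    T_eq := fun i => rfl
    jac_right := fun i k => ?_
    jac_left := fun j k => ?_
    noether_zero := fun α => ?_
    noether := fun s α γ => ⟨fun i => B s i α γ, ?_⟩
    invariant := fun I α => ⟨fun i => κ i I α, ?_⟩ }⟩
  · have := (hTbp j).mul (hjp j i)
    rwa [← add_assoc, zmod2_add_self, zero_add] at this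
  · refine ⟨sg (C.εbar j * (0 + 1)) * sg (gpar (gcoord k : GV C) * gpar (gcoord j)) *
      sg (C.εbar k * (0 + 1)), ?_⟩
    simp only [Tb, map_smul, smul_smul]
    rw [pd_comm (gcoord k) (gcoord j), smul_smul]
    congr 1
    linear_combination (-(sg (C.εbar j * (0 + 1)) * sg (gpar (gcoord k : GV C) * gpar (gcoord j)))) *
      sg_mul_self (C.εbar k * (0 + 1))
  · refine (Rep.sum fun j _ => (hdφ i j).mul (hj j k)).eq ?_ (hres (hG.jac_right i k))
    split_ifs
    · exact hone
    · exact rep_zero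
  · refine (Rep.sum fun i _ => (hj j i).mul (hdφ i k)).eq ?_ (hres (hG.jac_left j k))
    split_ifs
    · exact hone
    · exact rep_zero
  · exact (Rep.sum fun i _ => (hTr i).mul (hZ 0 i α)).eq rep_zero (hres (hG.noether_zero α))
  · exact (Rep.sum fun β _ => (hZ s α β).mul (hZ (s + 1) β γ)).eq
      (Rep.sum fun i _ => (hTr i).mul (hB s i α γ)) (hres (hG.noether s α γ))
  · exact (Rep.sum fun i _ => (hj _ i).mul (hZ 0 i α)).eq
      (Rep.sum fun i _ => (hTr i).mul (hκ i I α)) (hres (hinv I α))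

/-! ### Bodies of the matrices, and the generators in the adapted coordinates -/

namespace GaugeData

variable (G : GaugeData C)

/-- The body of the derivatives of the equations of motion along the transversal fields. -/
def bodyH (y : C.Pt) : Matrix (Fin C.numXi) (Fin (C.m 0)) ℝ :=
  Matrix.of fun I i => body (dCoord (Sum.inl I) (G.T i)) y

/-- The body of the generators. -/
def bodyZ (s : ℕ) (y : C.Pt) : Matrix (Fin (C.m s)) (Fin (C.m (s + 1))) ℝ :=
  Matrix.of fun α β => body (G.Z s α β) y

/-- The body of the gauge generators of the longitudinal fields. -/
def bodyR (y : C.Pt) : Matrix (Fin C.numTheta) (Fin (C.m 1)) ℝ :=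
  Matrix.of fun A α => ∑ i, body (G.jac (Sum.inr A) i) y * body (G.Z 0 i α) y

/-- The body of the matrix of the Koszul-Tate operator. -/
def bodyD (y : C.Pt) : Matrix (YI C) (YI C) ℝ :=
  blk (fun I i => G.bodyH y I i) (fun k α β => G.bodyZ k y α β)

end GaugeData

namespace LocalModel

variable {G : GaugeData C} {U : Opens C.Pt} (M : LocalModel G U)

theorem T_inIdeal (i : Fin (C.m 0)) : InIdeal M.Tbar (M.T i) := by
  rw [M.T_eq]
  exact InIdeal.sum fun j _ => inIdeal_mul j _

theorem inIdeal_Tbar {f : SA U} (hf : InIdeal M.T f) : InIdeal M.Tbar f := by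
  obtain ⟨n, rfl⟩ := hf
  exact InIdeal.sum fun i _ => (M.T_inIdeal i).mul_right _

/-- The gauge generators in the coordinates `φbar`. -/
def R (j : C.Coord) (α : Fin (C.m 1)) : SA U := ∑ i, M.jac j i * M.Z 0 i α

theorem R_mem (j : C.Coord) (α : Fin (C.m 1)) : M.R j α ∈ fieldSub U :=
  Subring.sum_mem _ fun _ _ => Subring.mul_mem _ (M.jac_mem _ _) (M.Z_mem _ _ _)

theorem Tbar_mul_R (α : Fin (C.m 1)) : ∑ j, M.Tbar j * M.R j α = 0 := by
  rw [← M.noether_zero α]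
  simp only [R, M.T_eq, Finset.mul_sum, Finset.sum_mul, mul_assoc]
  exact Finset.sum_comm

/-- Inverts the change of coordinates, so that rank information on the original generators passes to
`R`. -/
theorem dφ_mul_R (i : Fin (C.m 0)) (α : Fin (C.m 1)) : ∑ j, M.dφ i j * M.R j α = M.Z 0 i α := by
  simp only [R, Finset.mul_sum, ← mul_assoc]
  rw [Finset.sum_comm]
  simp only [← Finset.sum_mul, M.jac_right, ite_mul, one_mul, zero_mul, Finset.sum_ite_eq,
    Finset.mem_univ, if_true]

theorem T_mul_dφ (k : C.Coord) : ∑ i, M.T i * M.dφ i k = M.Tbar k := by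
  simp only [M.T_eq, Finset.sum_mul, mul_assoc]
  rw [Finset.sum_comm]
  simp only [← Finset.mul_sum, M.jac_left, mul_ite, mul_one, mul_zero, Finset.sum_ite_eq',
    Finset.mem_univ, if_true]

theorem T_body {p : C.Pt} (hp : G.IsStationary p) (hpU : p ∈ U) (i : Fin (C.m 0)) :
    M.T i 0 p = 0 := by
  rw [← M.rep_T i 0 p hpU]
  exact hp.2 i

theorem Tbar_body {p : C.Pt} (hp : G.IsStationary p) (hpU : p ∈ U) (j : C.Coord) :
    M.Tbar j 0 p = 0 := by
  rw [← M.T_mul_dφ, sum_apply]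
  exact Finset.sum_eq_zero fun i _ => by rw [mul_apply_zero, M.T_body hp hpU, zero_mul]

theorem R_body_inl {p : C.Pt} (hp : G.IsStationary p) (hpU : p ∈ U) (I : Fin C.numXi)
    (α : Fin (C.m 1)) : M.R (Sum.inl I) α 0 p = 0 := by
  obtain ⟨n, hn⟩ := M.invariant I α
  rw [R, hn, sum_apply]
  exact Finset.sum_eq_zero fun i _ => by rw [mul_apply_zero, M.T_body hp hpU, zero_mul]

theorem bodyR_apply {y : C.Pt} (hy : y ∈ U) (A : Fin C.numTheta) (α : Fin (C.m 1)) :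
    G.bodyR y A α = M.R (Sum.inr A) α 0 y := by
  rw [R, sum_apply, GaugeData.bodyR, Matrix.of_apply]
  refine Finset.sum_congr rfl fun i _ => ?_
  rw [mul_apply_zero, ← M.rep_jac _ _ 0 y hy, ← M.rep_Z _ _ _ 0 y hy]
  rfl

theorem bodyH_apply {y : C.Pt} (hy : y ∈ U) (I : Fin C.numXi) (i : Fin (C.m 0)) :
    G.bodyH y I i = pd (gcoord (Sum.inl I)) (M.T i) 0 y :=
  (M.rep_T i).body_dCoord (Sum.inl I) hy

theorem bodyZ_apply {y : C.Pt} (hy : y ∈ U) (s : ℕ) (α : Fin (C.m s)) (β : Fin (C.m (s + 1))) :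
    G.bodyZ s y α β = M.Z s α β 0 y :=
  M.rep_Z s α β 0 y hy

theorem bodyD_apply {y : C.Pt} (hy : y ∈ U) (v w : YI C) : G.bodyD y v w =
    blk (fun I i => pd (gcoord (Sum.inl I)) (M.T i)) M.Z v w 0 y := by
  have h := map_blk (fun I i => pd (gcoord (Sum.inl I)) (M.T i)) M.Z
    (coeff (U := U) 0 y).toAddMonoidHom v w
  refine Eq.trans ?_ h.symm
  exact congrArg₂ (fun (h : Fin C.numXi → Fin (C.m 0) → ℝ)
    (Z : (k : ℕ) → Fin (C.m k) → Fin (C.m (k + 1)) → ℝ) => blk h Z v w)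
    (funext fun I => funext fun i => M.bodyH_apply hy I i)
    (funext fun k => funext fun α => funext fun β => M.bodyZ_apply hy k α β)

theorem continuousAt_bodyD (M : LocalModel G U) {y : C.Pt} (hy : y ∈ U) : ContinuousAt G.bodyD y := by
  refine continuousAt_pi.2 fun v => continuousAt_pi.2 fun w => ?_
  have h := SA.contDiffAt (U := U)
    (blk (R := SA U) (fun I i => pd (gcoord (Sum.inl I)) (M.T i)) M.Z v w) 0 hy
  refine h.continuousAt.congr ?_
  exact Filter.eventually_of_mem (U.isOpen.mem_nhds hy) fun x hx => (M.bodyD_apply hx v w).symm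

theorem continuousAt_bodyR (M : LocalModel G U) {y : C.Pt} (hy : y ∈ U) : ContinuousAt G.bodyR y := by
  refine continuousAt_pi.2 fun A => continuousAt_pi.2 fun α => ?_
  refine (((M.R (Sum.inr A) α).contDiffAt 0 hy).continuousAt).congr ?_
  exact Filter.eventually_of_mem (U.isOpen.mem_nhds hy) fun x hx => (M.bodyR_apply hx A α).symm

end LocalModel

open SA

/-! ### The shifted operator as a linear vector field, and `D² = 0` -/

namespace LocalModel

variable {G : GaugeData C} {U : Opens C.Pt} (M : LocalModel G U)

section Shifted

variable [XiStar U]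

/-- The coefficients of the transversal fields in the linear part of the equations of motion. -/
def h (I : Fin C.numXi) (i : Fin (C.m 0)) : SA U := rho (pd (gcoord (Sum.inl I)) (M.T i))

/-- The generators at `ξ = 0`. -/
def Z₀ (s : ℕ) (α : Fin (C.m s)) (β : Fin (C.m (s + 1))) : SA U := rho (M.Z s α β)

/-- The matrix of the shifted Koszul-Tate operator. -/
def D : Matrix (YI C) (YI C) (SA U) := blk M.h M.Z₀

theorem oddMat_D : OddMat ev M.D := by
  unfold OddMat
  refine blk_induction M.h M.Z₀ (P := fun v w a => Par (gpar (ev v) + gpar (ev w) + 1) a)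
    (fun _ _ => par_zero _) (fun _ _ _ _ => Par.add) (fun I i => ?_) (fun k α β => ?_)
  · have h1 := ((M.T_par i).pd (gcoord (Sum.inl I))).rho
    refine cast (congrArg (fun q => Par q _) ?_) h1
    change gpar (gcoord (Sum.inl I)) + C.ε 0 i =
      gpar (gcoord (Sum.inl I)) + (C.ε 0 i + ((0 : ℕ) : ZMod 2) + 1) + 1
    generalize gpar (gcoord (C := C) (Sum.inl I)) = a
    generalize C.ε 0 i = b
    revert a b
    decide
  · have h1 := (M.Z_par k α β).rho
    refine cast (congrArg (fun q => Par q _) ?_) h1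
    change _ = (C.ε k α + ((k : ℕ) : ZMod 2) + 1) +
      (C.ε (k + 1) β + (((k : ℕ) + 1 : ℕ) : ZMod 2) + 1) + 1
    push_cast
    generalize C.ε k α = a
    generalize C.ε (k + 1) β = b
    generalize ((k : ℕ) : ZMod 2) = c
    revert a b c
    decide

theorem D_mem_thetaSub (v w : YI C) : M.D v w ∈ thetaSub U :=
  blk_induction M.h M.Z₀ (P := fun _ _ a => a ∈ thetaSub U)
    (fun _ _ => Subring.zero_mem _) (fun _ _ _ _ => Subring.add_mem _)
    (fun _ i => rho_mem_thetaSub (pd_mem_varSub (M.T_mem i) _))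
    (fun k α β => rho_mem_thetaSub (M.Z_mem k α β)) v w

theorem bodyMat_D {x : C.Pt} (hx : x ∈ U) : bodyMat M.D x = G.bodyD (scaleXi 0 x) := by
  ext v w
  rw [M.bodyD_apply (XiStar.zero_mem hx)]
  have h1 := map_blk (fun I i => pd (gcoord (Sum.inl I)) (M.T i)) M.Z
    (rho (U := U)).toAddMonoidHom v w
  have h2 : M.D v w = rho (blk (fun I i => pd (gcoord (Sum.inl I)) (M.T i)) M.Z v w) := h1.symm
  rw [bodyMat, Matrix.of_apply, h2, rho_apply _ _ hx, if_pos (monoSafn_eq_zero.2 (by simp))]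

/-- The part of `T` of weight one is linear in `ξ`, and the remaining coefficients of `δ` are linear
in the antifields. -/
theorem rep_delta {f : C.SFun} {a : SA U} (hf : Rep f a) : Rep (G.delta f) (vf ev M.D a) := by
  have h1 : vf ev M.D a = ∑ i, (∑ I, z (gcoord (Sum.inl I)) * M.h I i) * pd (Sum.inr (Var.anti 0 i)) a +
      ∑ s ∈ Finset.range (C.L + 1), ∑ α, ∑ β,
        (z (Sum.inr (Var.anti s α)) * M.Z₀ s α β) * pd (Sum.inr (Var.anti (s + 1) β)) a := by
    unfold vf
    rw [Finset.sum_comm, Fintype.sum_sum_type, Fintype.sum_sigma, Fin.sum_univ_succ,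
      Finset.sum_range]
    have h2 : ∀ I, ∑ v, z (ev v) * M.D v (Sum.inl I) * pd (ev (Sum.inl I)) a = 0 := fun I =>
      Finset.sum_eq_zero fun v _ => by rw [D, blk_inl, mul_zero, zero_mul]
    rw [Finset.sum_eq_zero fun I _ => h2 I, zero_add]
    refine congrArg₂ (· + ·) (Finset.sum_congr rfl fun i _ => ?_)
      (Finset.sum_congr rfl fun k _ => ?_)
    · rw [← Finset.sum_mul]
      exact congrArg (· * _) (mul_blk_zero M.h M.Z₀ (fun v => z (ev v)) i)
    · refine Eq.trans (Finset.sum_congr rfl fun β _ => ?_) Finset.sum_comm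
      rw [← Finset.sum_mul, ← Finset.sum_mul]
      exact congrArg (· * _) (mul_blk_succ M.h M.Z₀ (fun v => z (ev v)) k β)
  rw [h1]
  unfold GaugeData.delta
  refine Rep.add (Rep.sum fun i _ => ((M.rep_T i).safnPart_one (M.T_mem i)).mul (hf.dLeft _))
    (Rep.sum fun s _ => Rep.sum fun α _ => Rep.sum fun β _ => ?_)
  exact ((rep_gen _).mul (M.rep_Z s α β).safnPart_zero).mul (hf.dLeft _)

/-- The real matrix `X` is only a right inverse of the longitudinal generators at `p`. Where the
product with `X` keeps an invertible body, it is invertible over superfunctions, and this corrects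
`X` to a right inverse. -/
theorem rho_T_eq_zero (hU : Convex ℝ (U : Set C.Pt)) {p : C.Pt} (hp : G.IsStationary p)
    (hpU : p ∈ U) (hpx : scaleXi 0 p = p) (X : Matrix (Fin (C.m 1)) (Fin C.numTheta) ℝ)
    (hX : ∀ x ∈ U, (G.bodyR (scaleXi 0 x) * X).det ≠ 0) (i : Fin (C.m 0)) : rho (M.T i) = 0 := by
  let P : Matrix (Fin C.numTheta) (Fin (C.m 1)) (SA U) :=
    Matrix.of fun A α => rho (M.R (Sum.inr A) α)
  let Q : Matrix (Fin (C.m 1)) (Fin C.numTheta) (SA U) :=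
    constMat (fun _ => X) fun _ _ => contDiffOn_const
  have hP : ∀ A α, P A α ∈ thetaSub U := fun A α => rho_mem_thetaSub (M.R_mem _ _)
  have hQ : ∀ α A, Q α A ∈ thetaSub U := constMat_mem_thetaSub _ _ fun _ _ => rfl
  obtain ⟨N, -, hN, -⟩ := exists_inverse (M := P * Q) (mul_mem_of_forall_mem hP hQ) fun x hx => by
    have h1 : bodyMat P x = G.bodyR (scaleXi 0 x) := by
      ext A α
      rw [M.bodyR_apply (XiStar.zero_mem hx)]
      change rho (M.R (Sum.inr A) α) 0 x = _
      rw [rho_apply _ _ hx, if_pos (monoSafn_eq_zero.2 (by simp))]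
    rw [bodyMat_mul, bodyMat_constMat _ _ hx, h1]
    exact hX x hx
  rw [Matrix.mul_assoc] at hN
  have h0 := rho_eq_zero_of_noether hU hpU hpx M.Tbar_mem M.Tbar_par (M.Tbar_body hp hpU)
    M.Tbar_symm M.Tbar_mul_R (fun I α => M.inIdeal_Tbar (M.invariant I α)) (Q * N)
    (fun A B => by
      have := congrFun (congrFun hN A) B
      rwa [Matrix.mul_apply, Matrix.one_apply] at this)
  rw [M.T_eq, map_sum]
  exact Finset.sum_eq_zero fun j _ => by rw [map_mul, h0, zero_mul]

variable {M}

theorem rho_inIdeal (hρ : ∀ i, rho (M.T i) = 0) {f : SA U} (hf : InIdeal M.T f) : rho f = 0 := by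
  obtain ⟨n, rfl⟩ := hf
  rw [map_sum]
  exact Finset.sum_eq_zero fun i _ => by rw [map_mul, hρ, zero_mul]

/-- The transversal derivative of the Noether identity at `ξ = 0`; the terms with undifferentiated
`T` drop out there. -/
theorem h_mul_Z₀ (hρ : ∀ i, rho (M.T i) = 0) (I : Fin C.numXi) (β : Fin (C.m 1)) :
    ∑ i, M.h I i * M.Z₀ 0 i β = 0 := by
  have h1 := congrArg (fun f => rho (pd (gcoord (Sum.inl I)) f)) (M.noether_zero β)
  simp only [map_sum, map_zero, pd_mul (M.T_par _), map_add, rho_smul, map_mul, hρ, zero_mul,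
    smul_zero, add_zero] at h1
  exact h1

theorem Z₀_mul_Z₀ (hρ : ∀ i, rho (M.T i) = 0) (k : ℕ) (α : Fin (C.m k))
    (γ : Fin (C.m (k + 2))) :
    ∑ β, M.Z₀ k α β * M.Z₀ (k + 1) β γ = 0 := by
  rw [← rho_inIdeal hρ (M.noether k α γ)]
  simp only [map_sum, map_mul, Z₀]

theorem D_mul_D (hρ : ∀ i, rho (M.T i) = 0) : M.D * M.D = 0 :=
  blk_mul_blk M.h M.Z₀ (h_mul_Z₀ hρ) (Z₀_mul_Z₀ hρ)

end Shifted

end LocalModel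

/-! ### Ranks and exactness at a stationary point -/

open SA

/-- The alternating sums telescope; the one term left over at the end lies beyond the last stage and
is zero. -/
theorem altSum_add_altSum (k : ℕ) : C.altSum k + C.altSum (k + 1) = C.m k := by
  have h1 := Finset.sum_range_succ (fun r => (-1 : ℤ) ^ r * (C.m (r + k) : ℤ)) (C.L + 2)
  rw [Finset.sum_range_succ', C.m_eq_zero (C.L + 2 + k) (by omega)] at h1
  have h2 : C.altSum (k + 1) = -∑ r ∈ Finset.range (C.L + 2),
      (-1 : ℤ) ^ (r + 1) * (C.m (r + 1 + k) : ℤ) := by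
    rw [← Finset.sum_neg_distrib]
    refine Finset.sum_congr rfl fun r _ => ?_
    rw [show r + (k + 1) = r + 1 + k by omega, pow_succ]
    ring
  simp only [Nat.cast_zero, mul_zero, add_zero, pow_zero, one_mul, zero_add] at h1
  rw [h2, FieldContent.altSum, ← h1]
  ring

namespace LocalModel

variable {G : GaugeData C} {U : Opens C.Pt} (M : LocalModel G U)

theorem rank_bodyZ (hG : G.IsGaugeTheory) {p : C.Pt} (hp : G.IsStationary p) (s : ℕ) :
    ((G.bodyZ s p).rank : ℤ) = C.altSum (s + 1) :=
  (hG.rank_Z s p hp).self_of_nhds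

/-- At a stationary point the transversal generators vanish, so the matrix of gauge generators
factors through the longitudinal ones. Its rank `M_0` is the number of longitudinal fields, which
forces full row rank. -/
theorem exists_right_inverse_bodyR (M : LocalModel G U) (hG : G.IsGaugeTheory)
    (hT : G.IsTransversal) {p : C.Pt} (hp : G.IsStationary p) (hpU : p ∈ U) :
    ∃ X : Matrix (Fin (C.m 1)) (Fin C.numTheta) ℝ, G.bodyR p * X = 1 := by
  have h1 : G.bodyZ 0 p = Matrix.of (fun i A => M.dφ i (Sum.inr A) 0 p) * G.bodyR p := by
    ext i α
    rw [M.bodyZ_apply hpU, ← M.dφ_mul_R, sum_apply, Fintype.sum_sum_type, Matrix.mul_apply]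
    have h2 : ∀ I, (M.dφ i (Sum.inl I) * M.R (Sum.inl I) α) 0 p = 0 := fun I => by
      rw [mul_apply_zero, M.R_body_inl hp hpU, mul_zero]
    rw [Finset.sum_eq_zero fun I _ => h2 I, zero_add]
    exact Finset.sum_congr rfl fun A _ => by
      rw [mul_apply_zero, M.bodyR_apply hpU, Matrix.of_apply]
  have h2 : (G.bodyR p).rank = Fintype.card (Fin C.numTheta) := by
    have h3 := Matrix.rank_mul_le_right (Matrix.of fun i A => M.dφ i (Sum.inr A) 0 p) (G.bodyR p)
    rw [← h1] at h3
    have h4 := (G.bodyR p).rank_le_card_height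
    have h5 : _ = C.altSum 1 := rank_bodyZ hG hp 0
    have h6 := hT.numTheta_eq
    rw [Fintype.card_fin] at h4 ⊢
    omega
  choose w hw using fun A : Fin C.numTheta =>
    exists_mulVec_eq_of_rank_eq (G.bodyR p) h2 (Pi.single A 1)
  refine ⟨Matrix.of fun α A => w A α, ?_⟩
  ext A B
  have := congrFun (hw B) A
  rw [Matrix.one_apply]
  simpa [Matrix.mulVec, dotProduct, Matrix.mul_apply, Pi.single_apply] using this

variable [XiStar U]

theorem pd_theta_body {M : LocalModel G U} (hρ : ∀ i, rho (M.T i) = 0) {p : C.Pt} (hpU : p ∈ U)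
    (hpx : scaleXi 0 p = p) (A : Fin C.numTheta) (i : Fin (C.m 0)) :
    pd (gcoord (Sum.inr A)) (M.T i) 0 p = 0 := by
  have h1 := rho_pd (gsafn_gcoord_inr A) (M.T i)
  have h2 := rho_apply (pd (gcoord (Sum.inr A)) (M.T i)) 0 hpU
  rw [if_pos (monoSafn_eq_zero.2 (by simp)), hpx] at h2
  rw [← h2, h1, hρ, map_zero, zero_apply]

/-- The longitudinal derivatives of `T` vanish at `p`, so the Hessian factors through the
transversal derivatives. Its rank `M_{-1}` is the number of transversal fields. -/
theorem rank_bodyH {M : LocalModel G U} (hρ : ∀ i, rho (M.T i) = 0) (hG : G.IsGaugeTheory)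
    (hT : G.IsTransversal) {p : C.Pt} (hp : G.IsStationary p) (hpU : p ∈ U)
    (hpx : scaleXi 0 p = p) : (G.bodyH p).rank = C.numXi := by
  have h1 : (Matrix.of fun i j => body (G.hessian i j) p) =
      Matrix.of (fun i I => M.jac (Sum.inl I) i 0 p) * G.bodyH p := by
    ext i j
    let a : SA U := ∑ k, (sg (C.εbar k * (C.ε 0 j + 1)) • pd (gcoord k) (M.T j)) * M.jac k i
    have ha : Par (C.ε 0 j + C.ε 0 i) a := Par.sum fun k _ => by
      have h2 := (((M.T_par j).pd (gcoord k)).smul (sg (C.εbar k * (C.ε 0 j + 1)))).mul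
        (M.jac_par k i)
      refine cast (congrArg (fun q => Par q _) ?_) h2
      rw [gpar_gcoord]
      generalize C.εbar k = q
      generalize C.ε 0 i = r
      generalize C.ε 0 j = s
      revert q r s
      decide
    have hr : Rep (G.dPhi i (G.T j)) a := by
      unfold GaugeData.dPhi
      exact Rep.sum fun k _ => ((M.rep_T j).dCoord (M.T_par j) k).mul (M.rep_jac k i)
    have h3 : body (G.hessian i j) p = a 0 p := by
      have h4 : body (G.hessian i j) p =
          (-1 : ℝ) ^ ((C.ε 0 i).val * ((C.ε 0 j).val + 1)) * a 0 p := by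
        rw [← hr 0 p hpU]
        rfl
      rw [h4]
      -- The conventional sign of the Hessian is harmless: the body of an entry can be nonzero only
      -- between equal parities, where the exponent is even.
      by_cases hij : C.ε 0 i = C.ε 0 j
      · rw [hij, (Nat.even_mul_succ_self _).neg_one_pow, one_mul]
      · rw [ha 0 p, mul_zero]
        rw [monoPar]
        simp only [Finsupp.support_zero, Finset.sum_empty]
        intro h
        refine hij ?_
        generalize C.ε 0 i = r at h ⊢
        generalize C.ε 0 j = s at h ⊢
        revert r s
        decide
    have h5 : ∀ k, ((sg (C.εbar k * (C.ε 0 j + 1)) • pd (gcoord k) (M.T j)) * M.jac k i : SA U) 0 p =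
        M.jac k i 0 p * body (dCoord k (G.T j)) p := fun k => by
      have h6 := (M.rep_T j).dCoord (M.T_par j) k 0 p hpU
      rw [mul_apply_zero, ← h6, mul_comm]
      rfl
    rw [Matrix.of_apply, h3, sum_apply, Finset.sum_congr rfl fun k _ => h5 k,
      Fintype.sum_sum_type, Matrix.mul_apply]
    have h7 : ∀ A, M.jac (Sum.inr A) i 0 p * body (dCoord (Sum.inr A) (G.T j)) p = 0 := fun A => by
      rw [(M.rep_T j).body_dCoord _ hpU, pd_theta_body hρ hpU hpx, mul_zero]
    rw [Finset.sum_eq_zero fun A _ => h7 A, add_zero]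
    rfl
  have h2 := Matrix.rank_mul_le_right (Matrix.of fun i I => M.jac (Sum.inl I) i 0 p) (G.bodyH p)
  rw [← h1] at h2
  have h3 := (G.bodyH p).rank_le_card_height
  have h4 := (hG.rank_hessian p hp).self_of_nhds
  have h5 := hT.numXi_eq
  rw [Fintype.card_fin] at h3
  omega

theorem exists_bodyD_contraction {M : LocalModel G U} (hρ : ∀ i, rho (M.T i) = 0)
    (hG : G.IsGaugeTheory) (hT : G.IsTransversal) {p : C.Pt} (hp : G.IsStationary p) (hpU : p ∈ U)
    (hpx : scaleXi 0 p = p) :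
    ∃ s : Matrix (YI C) (YI C) ℝ, G.bodyD p * s + s * G.bodyD p = 1 := by
  have hrho : ∀ a : SA U, rho a 0 p = a 0 p := fun a => by
    rw [rho_apply _ _ hpU, if_pos (monoSafn_eq_zero.2 (by simp)), hpx]
  have hHZ : G.bodyH p * G.bodyZ 0 p = 0 := by
    ext I β
    have h1 := congrArg (fun a : SA U => a 0 p) (h_mul_Z₀ hρ I β)
    simp only [sum_apply, mul_apply_zero, h, Z₀, hrho, zero_apply] at h1
    rw [Matrix.mul_apply, Matrix.zero_apply, ← h1]
    exact Finset.sum_congr rfl fun i _ => by rw [M.bodyH_apply hpU, M.bodyZ_apply hpU]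
  have hZZ : ∀ k, G.bodyZ k p * G.bodyZ (k + 1) p = 0 := fun k => by
    ext α γ
    have h1 := congrArg (fun a : SA U => a 0 p) (Z₀_mul_Z₀ hρ k α γ)
    simp only [sum_apply, mul_apply_zero, Z₀, hrho, zero_apply] at h1
    rw [Matrix.mul_apply, Matrix.zero_apply, ← h1]
    exact Finset.sum_congr rfl fun i _ => by rw [M.bodyZ_apply hpU, M.bodyZ_apply hpU]
  have hrH := rank_bodyH hρ hG hT hp hpU hpx
  have hrZ := rank_bodyZ hG hp
  refine exists_contraction (G.bodyD p) ?_ (blk_exact _ _ ?_ ?_ ?_)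
  · exact blk_mul_blk _ _ (fun I β => congrFun (congrFun hHZ I) β)
      fun k α γ => congrFun (congrFun (hZZ k) α) γ
  · intro y
    obtain ⟨u, hu⟩ := exists_mulVec_eq_of_rank_eq (G.bodyH p) (by rw [hrH, Fintype.card_fin]) y
    exact ⟨u, congrFun hu⟩
  · intro u hu
    obtain ⟨w, hw⟩ := exists_mulVec_eq_of_rank (G.bodyH p) (G.bodyZ 0 p) hHZ (by
      have h1 := hrZ 0
      have h2 := altSum_add_altSum (C := C) 0
      have h3 := hT.numXi_eq
      rw [hrH, Fintype.card_fin]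
      omega) u (funext hu)
    exact ⟨w, congrFun hw⟩
  · intro k u hu
    obtain ⟨w, hw⟩ := exists_mulVec_eq_of_rank (G.bodyZ k p) (G.bodyZ (k + 1) p) (hZZ k) (by
      have h1 := hrZ k
      have h2 := hrZ (k + 1)
      have h3 := altSum_add_altSum (C := C) (k + 1)
      rw [Fintype.card_fin]
      omega) u (funext hu)
    exact ⟨w, congrFun hw⟩

end LocalModel

/-! ### Balls -/

theorem scaleXi_zero_of_isStationary {G : GaugeData C} (hT : G.IsTransversal) {p : C.Pt}
    (hp : G.IsStationary p) (t : ℝ) : scaleXi t p = p := by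
  funext ⟨j, hj⟩
  rcases j with I | A
  · rw [scaleXi_inl, hT.normalized p hp, mul_zero]
  · rw [scaleXi_inr]

/-- The distance is that of the sup norm, so it suffices that no single coordinate moves away from
`p`. -/
theorem dist_scaleXi_le {p : C.Pt} (hpx : ∀ t, scaleXi t p = p) {t : ℝ} (ht : t ∈ Set.Icc (0 : ℝ) 1)
    (x : C.Pt) : dist (scaleXi t x) p ≤ dist x p := by
  rw [dist_pi_le_iff dist_nonneg]
  rintro ⟨j, hj⟩
  refine le_trans ?_ (dist_le_pi_dist x p ⟨j, hj⟩)
  rcases j with I | A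
  · have h1 := congrFun (hpx 0) ⟨Sum.inl I, hj⟩
    rw [scaleXi_inl, zero_mul] at h1
    rw [scaleXi_inl, ← h1, Real.dist_eq, Real.dist_eq, sub_zero, sub_zero, abs_mul,
      abs_of_nonneg ht.1]
    exact mul_le_of_le_one_left (abs_nonneg _) ht.2
  · rw [scaleXi_inr]

/-- An open ball. -/
def ballOpens (p : C.Pt) (r : ℝ) : Opens C.Pt := ⟨Metric.ball p r, Metric.isOpen_ball⟩

theorem xiStar_ballOpens {p : C.Pt} (hpx : ∀ t, scaleXi t p = p) (r : ℝ) :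
    XiStar (ballOpens p r) :=
  ⟨fun x hx _ ht => (dist_scaleXi_le hpx ht x).trans_lt hx⟩

end BV

end

/-! ### The theorem: choice of the neighbourhood -/

theorem mainTheorem4 (C : BV.FieldContent) (G : BV.GaugeData C)
    (hG : G.IsGaugeTheory) (hT : G.IsTransversal)
    (p : C.Pt) (hp : G.IsStationary p) (W : Set C.Pt) (hW : W ∈ 𝓝 p) :
    ∃ U : Set C.Pt, IsOpen U ∧ p ∈ U ∧ U ⊆ W ∧ U ⊆ G.dom ∧
      (∀ x ∈ U, ∀ t ∈ Set.Icc (0 : ℝ) 1, BV.scaleXi t x ∈ U) ∧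
      (∀ f : C.SFun, BV.IsSuperFun U f → BV.SEq U (G.delta (G.delta f)) 0) ∧
      ∀ f : C.SFun, BV.IsSuperFun U f → BV.SEq U (G.delta f) 0 → BV.SafnPos U f →
        ∃ g : C.SFun, BV.IsSuperFun U g ∧ (BV.IsPoly U f → BV.IsPoly U g) ∧
          BV.SEq U f (G.delta g) := by
  have hpx := BV.scaleXi_zero_of_isStationary hT hp
  have hball : ∀ (V : Set C.Pt), V ∈ 𝓝 p → ∃ r > 0, (BV.ballOpens p r : Set C.Pt) ⊆ V :=
    fun V hV => Metric.mem_nhds_iff.1 hV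
  have hmem : ∀ {r : ℝ}, 0 < r → p ∈ BV.ballOpens p r := fun hr => Metric.mem_ball_self hr
  have hdom : G.dom ∈ 𝓝 p := hG.isOpen_dom.mem_nhds hp.1
  obtain ⟨r₀, hr₀, hU₀⟩ := hball _ hdom
  obtain ⟨M₀⟩ := BV.exists_localModel hG hT hU₀
  -- Being a right inverse at `p` is stable in the weaker form of a nonzero determinant.
  obtain ⟨X, hX⟩ := M₀.exists_right_inverse_bodyR hG hT hp (hmem hr₀)
  have hV₁ : ∀ᶠ y in 𝓝 p, (G.bodyR y * X).det ≠ 0 := by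
    have hc : ContinuousAt (fun y => (G.bodyR y * X).det) p :=
      (((continuous_id.matrix_mul continuous_const).matrix_det).continuousAt).comp
        (M₀.continuousAt_bodyR (hmem hr₀))
    refine hc.eventually_ne ?_
    rw [hX, Matrix.det_one]
    exact one_ne_zero
  -- On this ball `T` vanishes at `ξ = 0`. That fact at `p` is needed to obtain the contraction `s`,
  -- which in turn determines the final ball.
  obtain ⟨r₁, hr₁, hU₁⟩ := hball _ (Filter.inter_mem hdom hV₁)
  obtain ⟨M₁⟩ := BV.exists_localModel hG hT fun x hx => (hU₁ hx).1
  have := BV.xiStar_ballOpens hpx r₁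
  have hρ₁ := M₁.rho_T_eq_zero (convex_ball p r₁) hp (hmem hr₁) (hpx 0) X
    fun x hx => (hU₁ (BV.XiStar.zero_mem hx)).2
  obtain ⟨s, hs⟩ := BV.LocalModel.exists_bodyD_contraction hρ₁ hG hT hp (hmem hr₁) (hpx 0)
  have hV₂ : ∀ᶠ y in 𝓝 p, (G.bodyD y * s + s * G.bodyD y).det ≠ 0 := by
    have hc : ContinuousAt (fun y => (G.bodyD y * s + s * G.bodyD y).det) p :=
      ((((continuous_id.matrix_mul continuous_const).add
        (continuous_const.matrix_mul continuous_id)).matrix_det).continuousAt).comp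
        (M₁.continuousAt_bodyD (hmem hr₁))
    refine hc.eventually_ne ?_
    rw [hs, Matrix.det_one]
    exact one_ne_zero
  obtain ⟨r₂, hr₂, hU₂⟩ := hball _ (Filter.inter_mem (Filter.inter_mem hdom hW)
    (Filter.inter_mem hV₁ hV₂))
  obtain ⟨M⟩ := BV.exists_localModel hG hT fun x hx => (hU₂ hx).1.1
  have := BV.xiStar_ballOpens hpx r₂
  have hρ := M.rho_T_eq_zero (convex_ball p r₂) hp (hmem hr₂) (hpx 0) X
    fun x hx => (hU₂ (BV.XiStar.zero_mem hx)).2.1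
  have hDD := BV.LocalModel.D_mul_D hρ
  obtain ⟨σ, hσ, hσ', hDσ⟩ := BV.SA.exists_homotopy M.oddMat_D M.D_mem_thetaSub hDD s
    fun x hx => by
      rw [M.bodyMat_D hx]
      exact (hU₂ (BV.XiStar.zero_mem hx)).2.2
  refine ⟨BV.ballOpens p r₂, (BV.ballOpens p r₂).isOpen, hmem hr₂, fun x hx => (hU₂ hx).1.2,
    fun x hx => (hU₂ hx).1.1, fun x hx t ht => BV.XiStar.scale_mem x hx t ht, fun f hf => ?_,
    fun f hf hδ hpos => ?_⟩
  · exact (M.rep_delta (M.rep_delta (BV.SA.rep_ofSFun f hf))).sEq BV.SA.rep_zero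
      (BV.SA.vf_vf_eq_zero M.oddMat_D M.D_mem_thetaSub hDD _)
  · have hr := BV.SA.rep_ofSFun f hf
    obtain ⟨g, hg, hfg⟩ := BV.SA.exists_vf_eq M.oddMat_D hσ M.D_mem_thetaSub hσ' hDD hDσ
      ((M.rep_delta hr).eq BV.SA.rep_zero hδ) (hr.safnPart_zero.eq BV.SA.rep_zero hpos)
    refine ⟨g.1, g.isSuperFun, fun hpoly => ?_, hr.sEq (M.rep_delta (BV.SA.rep_self g)) hfg⟩
    -- `FinSupp` quantifies over all points, `IsPoly` over those of `U`; extension by zero makes up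
    -- for the difference.
    refine (hg (hpoly.subset ?_)).subset ?_
    · rintro μ ⟨x, hx⟩
      by_cases hxU : x ∈ BV.ballOpens p r₂
      · exact ⟨x, hxU, by rwa [hr μ x hxU]⟩
      · exact absurd (BV.SA.eq_zero_of_notMem _ _ hxU) hx
    · rintro μ ⟨x, -, hx⟩
      exact ⟨x, hx⟩
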